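/- Let $\kappa\in\mathbb{Z}\setminus\{0\}$ and let $\phi_{\mathrm{sc}},\phi_{\mathrm{el}},\phi_{\mathrm{am}}:(0,\infty)\to\mathbb{R}$ be potentials, each of the form $\phi=\chi+\psi$ with $\chi$ measurable, $|\chi(r)|\le c\,r^{-1}$ for all $r>0$ and some constant $c>0$, and $\psi\in L^\infty(0,\infty)$. Let $H_\kappa$ be a self-adjoint operator in $L^2(0,\infty)^2$ whose domain contains $C_0^\infty(0,\infty)^2$ and which acts there by $$\begin{pmatrix} 1+\phi_{\mathrm{sc}}+\phi_{\mathrm{el}} & -\frac{d}{dr}+\frac{\kappa}{r}+\phi_{\mathrm{am}}\\ \frac{d}{dr}+\frac{\kappa}{r}+\phi_{\mathrm{am}} & -1-\phi_{\mathrm{sc}}+\phi_{\mathrm{el}}\end{pmatrix}$$ (the closure of this operator, if it is essentially self-adjoint on $C_0^\infty(0,\infty)^2$). For $k=0,1,2,\dots$ let $\Phi_k(r)=c_{2k+1}^{-1}h_{2k+1}(r)e^{-r^2/2}$, $r>0$, where $h_n(x)=(-1)^ne^{x^2}\frac{d^n}{dx^n}e^{-x^2}$ and $c_n=\sqrt{2^{n-1}n!\sqrt{\pi}}$.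 For $N,M\ge 1$ let $\mathcal{L}_{NM}\subset L^2(0,\infty)^2$ be the span of $(\Phi_k,0)$, $0\le k<N$, and $(0,\Phi_k)$, $0\le k<M$. For a self-adjoint operator $G$ and a subspace $\mathcal{L}\subset\operatorname{Dom}(G)$ with basis $b_1,\dots,b_n$, let $Q(z)=z^2B-2zL+K\in\mathbb{C}^{n\times n}$, where $B_{jk}=\langle b_j,b_k\rangle$, $L_{jk}=\langle Gb_j,b_k\rangle$, $K_{jk}=\langle Gb_j,Gb_k\rangle$ and the inner product is linear in its second argument. The second order spectrum $\operatorname{Spec}_2(G,\mathcal{L})$ is the set of $\lambda\in\mathbb{C}$ such that $Q(\lambda)\underline{v}=0$ for some nonzero coordinate vector $\underline{v}\in\mathbb{C}^n$, and $\underline{v}$ is identified with $v=\sum_j\underline{v}_jb_j\in\mathcal{L}$. (Neither the set nor the vectors $v$ depend on the basis.) Let $A=\operatorname{diag}(\tilde A,\tilde A)$, where $\tilde A=-\frac{d^2}{dr^2}+r^2$ is the self-adjoint harmonic oscillator in $L^2(0,\infty)$ with Dirichlet boundary condition at $0$. Let $E\in\mathbb{R}$ be an isolated eigenvalue of $H_\kappa$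 of finite multiplicity with eigenspace $\mathcal{E}$, let $\Pi_{\mathcal{E}}$ be the orthogonal projection onto $\mathcal{E}$, and assume that $\mathcal{E}\subset\operatorname{Dom}(A^q)$ for some $q>1$. Then $\mathcal{L}_{NM}\subset\operatorname{Dom}(H_\kappa)$ for all $N,M\ge1$, and there are a constant $b>0$ independent of $N$ and $M$, an $n_0\in\mathbb{N}$ and points $\lambda_{NM}\in\operatorname{Spec}_2(H_\kappa,\mathcal{L}_{NM})$, $N,M\ge 1$, such that for all $N,M\ge n_0$ $$|\lambda_{NM}-E|<b\left(N^{-\frac{q-1}{2}}+M^{-\frac{q-1}{2}}\right),$$ and every $v_{NM}\in\mathcal{L}_{NM}$ with $\|v_{NM}\|=1$ and $Q(\lambda_{NM})\underline{v_{NM}}=0$ satisfies $$\|(I-\Pi_{\mathcal{E}})v_{NM}\|<b\left(N^{-\frac{q-1}{2}}+M^{-\frac{q-1}{2}}\right).$$ -/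

import Mathlib

open MeasureTheory Set Filter Topology
open scoped InnerProductSpace ContDiff ENNReal

noncomputable section

namespace RadialDirac

/-! ### Eigenspaces, spectrum and powers of unbounded operators -/

section Abstract

variable {X : Type*} [NormedAddCommGroup X] [InnerProductSpace ℂ X]

/-- `ker (T - μ)`: all `x ∈ Dom T` with `T x = μ x`. -/
def eigenspace (T : X →ₗ.[ℂ] X) (μ : ℂ) : Submodule ℂ X where
  carrier := {x | ∃ h : x ∈ T.domain, T ⟨x, h⟩ = μ • x}
  zero_mem' := ⟨T.domain.zero_mem, by
    rw [smul_zero]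
    exact T.map_zero⟩
  add_mem' := by
    rintro x y ⟨hx, ex⟩ ⟨hy, ey⟩
    refine ⟨T.domain.add_mem hx hy, ?_⟩
    rw [smul_add, ← ex, ← ey]
    exact T.map_add ⟨x, hx⟩ ⟨y, hy⟩
  smul_mem' := by
    rintro c x ⟨hx, ex⟩
    refine ⟨T.domain.smul_mem c hx, ?_⟩
    rw [smul_comm, ← ex]
    exact T.map_smul c ⟨x, hx⟩

/-- The spectrum of an unbounded operator `T`: `z` is *not* in the spectrum iff `T - z` maps
`Dom T` bijectively onto `X` with a bounded inverse `R`. -/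
def spectrum (T : X →ₗ.[ℂ] X) : Set ℂ :=
  {z | ¬ ∃ R : X →L[ℂ] X,
      (∀ y : X, ∃ h : R y ∈ T.domain, T ⟨R y, h⟩ - z • R y = y) ∧
      (∀ x : T.domain, R (T x - z • (x : X)) = x)}

/-- `E` is an isolated eigenvalue of finite multiplicity of `T`. -/
structure IsIsolatedEigenvalue (T : X →ₗ.[ℂ] X) (E : ℝ) : Prop where
  eigenspace_ne_bot : eigenspace T E ≠ ⊥
  finite_multiplicity : FiniteDimensional ℂ (eigenspace T E)
  isolated : ∃ ε > 0, ∀ z ∈ spectrum T, ‖z - E‖ < ε → z = E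

/-- The orthogonal projection onto the eigenspace `ker (T - μ)`. (This space is closed for a closed
operator; the closure is only there to have the projection for every `T`.) -/
def eigenProj [CompleteSpace X] (T : X →ₗ.[ℂ] X) (μ : ℂ) : X →L[ℂ] X :=
  (eigenspace T μ).topologicalClosure.starProjection

/-- The domain of the power `T ^ q` of a positive self-adjoint operator with compact resolvent.
If `P μ` is the orthogonal projection onto `ker (T - μ)`, then `T = ∑ μ P μ`,
`T ^ q = ∑ μ ^ q P μ`, and `u ∈ Dom (T ^ q)` iff `∑ μ ^ (2 q) ‖P μ u‖ ^ 2 < ∞`. -/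
def powDomain [CompleteSpace X] (T : X →ₗ.[ℂ] X) (q : ℝ) : Set X :=
  {u | Summable fun μ : ℝ => μ ^ (2 * q) * ‖eigenProj T μ u‖ ^ 2}

/-! ### The second order relative spectrum -/

/-- The matrix `Q(z) = z² B - 2 z L + K` with `B = (⟨b j, b k⟩)`, `L = (⟨G b j, b k⟩)` and
`K = (⟨G b j, G b k⟩)`. Mathlib's inner product is linear in its second argument, so that
`(Q(z) c) j = ⟨(conj z - G) b j, (z - G) v⟩` for `v = ∑ k, c k • b k`. -/
def quadPencil (G : X →ₗ.[ℂ] X) {n : ℕ} (b : Fin n → G.domain) (z : ℂ) :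
    Matrix (Fin n) (Fin n) ℂ :=
  Matrix.of fun j k =>
    z ^ 2 * ⟪(b j : X), (b k : X)⟫_ℂ - 2 * z * ⟪G (b j), (b k : X)⟫_ℂ + ⟪G (b j), G (b k)⟫_ℂ

/-- `v ∈ ℒ` solves `Q(z) v = 0`: in a basis `b` of `ℒ ⊆ Dom G`, the coordinate vector `c` of `v`
is in the kernel of the matrix `Q(z)`. -/
def SolvesQ (G : X →ₗ.[ℂ] X) (ℒ : Submodule ℂ X) (z : ℂ) (v : X) : Prop :=
  ∃ (n : ℕ) (b : Fin n → G.domain) (c : Fin n → ℂ),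
    LinearIndependent ℂ (fun j => (b j : X)) ∧
    Submodule.span ℂ (range fun j => (b j : X)) = ℒ ∧
    v = ∑ j, c j • (b j : X) ∧
    (quadPencil G b z).mulVec c = 0

/-- The second order spectrum of `G` relative to the finite-dimensional subspace `ℒ ⊆ Dom G`. -/
def spec₂ (G : X →ₗ.[ℂ] X) (ℒ : Submodule ℂ X) : Set ℂ :=
  {z | ∃ v : X, v ≠ 0 ∧ SolvesQ G ℒ z v}

end Abstract

/-! ### The Hilbert spaces -/

/-- Lebesgue measure on `(0, ∞)`. -/
abbrev halfLine : Measure ℝ := volume.restrict (Ioi 0)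

/-- `L²(0, ∞)`, complex valued. -/
abbrev L2 : Type := Lp ℂ 2 halfLine

/-- `L²(0, ∞)² = L²(0, ∞) ⊕ L²(0, ∞)`, the orthogonal sum. -/
abbrev Spinor : Type := WithLp 2 (L2 × L2)

/-! ### The radial Dirac operator -/

/-- A potential `φ = χ + ψ` on `(0, ∞)`, with `|χ(r)| ≤ c / r` and `ψ ∈ L^∞(0, ∞)`. -/
def IsAdmissible (φ : ℝ → ℝ) : Prop :=
  ∃ (χ ψ : ℝ → ℝ) (c : ℝ), 0 < c ∧
    (∀ r > 0, φ r = χ r + ψ r) ∧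
    AEStronglyMeasurable χ halfLine ∧ (∀ r > 0, |χ r| ≤ c * r⁻¹) ∧
    MemLp ψ ∞ halfLine

/-- `u ∈ C_0^∞(0, ∞)`. -/
def IsTestFunction (u : ℝ → ℂ) : Prop :=
  ContDiff ℝ ∞ u ∧ HasCompactSupport u ∧ tsupport u ⊆ Ioi 0

/-- First component of the radial Dirac expression,
`(1 + φ_sc + φ_el) u + (-d/dr + κ/r + φ_am) v`. -/
def diracUpper (κ : ℤ) (φsc φel φam : ℝ → ℝ) (u v : ℝ → ℂ) (r : ℝ) : ℂ :=
  ((1 + φsc r + φel r : ℝ) : ℂ) * u r + (- deriv v r + ((κ / r + φam r : ℝ) : ℂ) * v r)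

/-- Second component of the radial Dirac expression,
`(d/dr + κ/r + φ_am) u + (-1 - φ_sc + φ_el) v`. -/
def diracLower (κ : ℤ) (φsc φel φam : ℝ → ℝ) (u v : ℝ → ℂ) (r : ℝ) : ℂ :=
  (deriv u r + ((κ / r + φam r : ℝ) : ℂ) * u r) + ((-1 - φsc r + φel r : ℝ) : ℂ) * v r

/-- `H` is a self-adjoint realisation in `L²(0, ∞)²` of the radial Dirac expression: `H` is
self-adjoint, `C_0^∞(0, ∞)² ⊆ Dom H`, and `H` acts there by the expression. If the expression is
essentially self-adjoint on `C_0^∞(0, ∞)²`, there is exactly one such `H`, namely the closure. -/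
structure IsRadialDirac (κ : ℤ) (φsc φel φam : ℝ → ℝ) (H : Spinor →ₗ.[ℂ] Spinor) : Prop where
  isSelfAdjoint : IsSelfAdjoint H
  extends_expression : ∀ u v : ℝ → ℂ, IsTestFunction u → IsTestFunction v →
    ∃ x : H.domain,
      (x : Spinor).fst =ᵐ[halfLine] u ∧ (x : Spinor).snd =ᵐ[halfLine] v ∧
      (H x).fst =ᵐ[halfLine] diracUpper κ φsc φel φam u v ∧
      (H x).snd =ᵐ[halfLine] diracLower κ φsc φel φam u v

/-! ### Odd Hermite functions and the test spaces -/

/-- The Hermite polynomials `h_n(x) = (-1)^n e^{x²} (d/dx)^n e^{-x²}`. -/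
def hermiteH (n : ℕ) (x : ℝ) : ℝ :=
  (-1) ^ n * Real.exp (x ^ 2) * iteratedDeriv n (fun y : ℝ => Real.exp (-y ^ 2)) x

/-- The normalisation constants `c_n = (2^{n-1} n! √π)^{1/2}`. -/
def hermiteNorm (n : ℕ) : ℝ :=
  √((2 : ℝ) ^ ((n : ℤ) - 1) * n.factorial * √Real.pi)

/-- The odd Hermite functions `Φ_k(r) = c_{2k+1}⁻¹ h_{2k+1}(r) e^{-r²/2}`, `k = 0, 1, 2, …`. -/
def oddHermite (k : ℕ) (r : ℝ) : ℂ :=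
  (((hermiteNorm (2 * k + 1))⁻¹ * hermiteH (2 * k + 1) r * Real.exp (-r ^ 2 / 2) : ℝ) : ℂ)

theorem iteratedDeriv_gaussian (n : ℕ) : ∃ p : Polynomial ℝ,
    iteratedDeriv n (fun y : ℝ => Real.exp (-y ^ 2)) = fun x => p.eval x * Real.exp (-x ^ 2) := by
  induction n with
  | zero => exact ⟨1, by ext x; simp⟩
  | succ n ih =>
    obtain ⟨p, hp⟩ := ih
    refine ⟨Polynomial.derivative p - 2 * Polynomial.X * p, ?_⟩
    rw [iteratedDeriv_succ, hp]
    ext x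
    have h2 : HasDerivAt (fun x : ℝ => Real.exp (-x ^ 2))
        (Real.exp (-x ^ 2) * (-(2 * x))) x := by
      have := ((hasDerivAt_pow 2 x).neg).exp
      simpa using this
    have h3 : deriv (fun x => p.eval x * Real.exp (-x ^ 2)) x = _ :=
      ((p.hasDerivAt x).mul h2).deriv
    rw [h3]
    simp
    ring

theorem memLp_poly_gaussian (p : Polynomial ℝ) :
    MemLp (fun x : ℝ => p.eval x * Real.exp (-x ^ 2 / 2)) 2 volume := by
  have hmeas : ∀ p : Polynomial ℝ,
      AEStronglyMeasurable (fun x : ℝ => p.eval x * Real.exp (-x ^ 2 / 2)) volume := fun p =>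
    (p.continuous.mul (by fun_prop)).aestronglyMeasurable
  induction p using Polynomial.induction_on' with
  | add p q hp hq =>
    have := hp.add hq
    refine this.congr_norm (hmeas _) (Eventually.of_forall fun x => ?_)
    simp [add_mul]
  | monomial n a =>
    rw [memLp_two_iff_integrable_sq_norm (hmeas _)]
    have h := (integrable_rpow_mul_exp_neg_mul_sq (b := 1) one_pos (s := ((2 * n : ℕ) : ℝ))
      (by have : (0 : ℝ) ≤ ((2 * n : ℕ) : ℝ) := Nat.cast_nonneg _
          linarith)).const_mul (a ^ 2)
    refine h.congr (Eventually.of_forall fun x => ?_)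
    simp only [Real.rpow_natCast, Polynomial.eval_monomial, Real.norm_eq_abs, sq_abs]
    rw [mul_pow, mul_pow, ← pow_mul, ← Real.exp_nat_mul]
    push_cast
    ring_nf

theorem memLp_oddHermite (k : ℕ) : MemLp (oddHermite k) 2 halfLine := by
  obtain ⟨p, hp⟩ := iteratedDeriv_gaussian (2 * k + 1)
  have h := ((memLp_poly_gaussian
    (Polynomial.C ((hermiteNorm (2 * k + 1))⁻¹ * (-1) ^ (2 * k + 1)) * p)).restrict
      (Ioi 0)).ofReal (K := ℂ)
  refine h.ae_eq (Eventually.of_forall fun x => ?_)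
  have e : Real.exp (x ^ 2) * Real.exp (-x ^ 2) = 1 := by
    rw [← Real.exp_add]; simp
  simp only [oddHermite, hermiteH, hp, Polynomial.eval_mul, Polynomial.eval_C]
  refine congrArg Complex.ofReal ?_
  have hodd : (-1 : ℝ) ^ (2 * k + 1) = -1 := Odd.neg_one_pow ⟨k, rfl⟩
  rw [hodd]
  simp only [Algebra.algebraMap_self, RingHom.id_apply]
  linear_combination (-((hermiteNorm (2 * k + 1))⁻¹ * (-1) * p.eval x *
    Real.exp (-x ^ 2 / 2))) * e

/-- `Φ_k` as an element of `L²(0, ∞)`. -/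
def hermiteVec (k : ℕ) : L2 := (memLp_oddHermite k).toLp (oddHermite k)

/-- The test space `ℒ_{NM}`, spanned by `(Φ_k, 0)` for the first `N` indices `k` and by `(0, Φ_k)`
for the first `M` indices `k`. -/
def testSpace (N M : ℕ) : Submodule ℂ Spinor :=
  Submodule.span ℂ
    ({x | ∃ k < N, x = WithLp.toLp 2 (hermiteVec k, 0)} ∪
      {x | ∃ k < M, x = WithLp.toLp 2 (0, hermiteVec k)})

/-! ### The Dirichlet harmonic oscillator -/

theorem L2.intervalIntegrable (g : L2) {r : ℝ} (hr : 0 ≤ r) :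
    IntervalIntegrable (g : ℝ → ℂ) volume 0 r := by
  rw [intervalIntegrable_iff_integrableOn_Ioc_of_le hr]
  have h := (Lp.memLp g).mono_measure
    (Measure.restrict_mono (μ := volume) (fun x hx => hx.1 : Ioc 0 r ⊆ Ioi 0) le_rfl)
  exact h.integrable (by norm_num)

theorem intervalIntegrable_of_continuousOn_Ici {F : ℝ → ℂ} (hF : ContinuousOn F (Ici 0)) {r : ℝ}
    (hr : 0 ≤ r) : IntervalIntegrable F volume 0 r :=
  (hF.mono (by rw [uIcc_of_le hr]; exact Icc_subset_Ici_self)).intervalIntegrable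

/-- The graph of the Dirichlet harmonic oscillator `-d²/dr² + r²` in `L²(0, ∞)`: the pairs `(f, g)`
such that `f` is (a.e. equal to) a `C¹` function `F` on `[0, ∞)` with locally absolutely continuous
derivative `F'`, with `F(0) = 0` and `-F'' + r² F = g`. The two differential equations are written
in integrated form. -/
def oscillatorGraph : Submodule ℂ (L2 × L2) where
  carrier := {p | ∃ F F' : ℝ → ℂ, ContinuousOn F (Ici 0) ∧ ContinuousOn F' (Ici 0) ∧
    p.1 =ᵐ[halfLine] F ∧
    (∀ r ≥ 0, F r = ∫ s in (0 : ℝ)..r, F' s) ∧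
    (∀ r ≥ 0, F' r = F' 0 + ∫ s in (0 : ℝ)..r, ((s : ℂ) ^ 2 * F s - p.2 s))}
  zero_mem' := by
    refine ⟨0, 0, continuousOn_const, continuousOn_const, Lp.coeFn_zero _ _ _, by simp, ?_⟩
    intro r hr
    have : ∫ s in (0 : ℝ)..r, ((s : ℂ) ^ 2 * (0 : ℝ → ℂ) s - (0 : L2 × L2).2 s)
        = ∫ s in (0 : ℝ)..r, (0 : ℂ) := by
      rw [intervalIntegral.integral_of_le hr, intervalIntegral.integral_of_le hr]
      refine integral_congr_ae ?_
      have h := ae_restrict_of_ae_restrict_of_subset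
        (fun x hx => hx.1 : Ioc 0 r ⊆ Ioi 0) (Lp.coeFn_zero ℂ 2 halfLine)
      filter_upwards [h] with s hs
      have hs' : ((0 : L2 × L2).2 : ℝ → ℂ) s = 0 := hs
      rw [hs']
      simp
    rw [this]
    simp
  add_mem' := by
    rintro ⟨f, g⟩ ⟨f₁, g₁⟩ ⟨F, F', hF, hF', hf, h1, h2⟩ ⟨G, G', hG, hG', hf₁, k1, k2⟩
    refine ⟨F + G, F' + G', hF.add hG, hF'.add hG', ?_, ?_, ?_⟩
    · exact (Lp.coeFn_add f f₁).trans (hf.add hf₁)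
    · intro r hr
      simp only [Pi.add_apply]
      rw [intervalIntegral.integral_add (intervalIntegrable_of_continuousOn_Ici hF' hr)
        (intervalIntegrable_of_continuousOn_Ici hG' hr), h1 r hr, k1 r hr]
    · intro r hr
      have e : ∫ s in (0 : ℝ)..r, ((s : ℂ) ^ 2 * (F + G) s - ((f, g) + (f₁, g₁) : L2 × L2).2 s)
          = ∫ s in (0 : ℝ)..r, (((s : ℂ) ^ 2 * F s - g s) + ((s : ℂ) ^ 2 * G s - g₁ s)) := by
        rw [intervalIntegral.integral_of_le hr, intervalIntegral.integral_of_le hr]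
        refine integral_congr_ae ?_
        have h := ae_restrict_of_ae_restrict_of_subset
          (fun x hx => hx.1 : Ioc 0 r ⊆ Ioi 0) (Lp.coeFn_add g g₁)
        filter_upwards [h] with s hs
        have hs' : ((f, g) + (f₁, g₁) : L2 × L2).2 s = g s + g₁ s := hs
        rw [hs', Pi.add_apply]
        ring
      have i1 : IntervalIntegrable (fun s : ℝ => (s : ℂ) ^ 2 * F s - g s) volume 0 r :=
        (intervalIntegrable_of_continuousOn_Ici
          ((by fun_prop : Continuous fun s : ℝ => (s : ℂ) ^ 2).continuousOn.mul hF) hr).sub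
          (L2.intervalIntegrable g hr)
      have i2 : IntervalIntegrable (fun s : ℝ => (s : ℂ) ^ 2 * G s - g₁ s) volume 0 r :=
        (intervalIntegrable_of_continuousOn_Ici
          ((by fun_prop : Continuous fun s : ℝ => (s : ℂ) ^ 2).continuousOn.mul hG) hr).sub
          (L2.intervalIntegrable g₁ hr)
      rw [e, intervalIntegral.integral_add i1 i2]
      simp only [Pi.add_apply]
      rw [h2 r hr, k2 r hr]
      ring
  smul_mem' := by
    rintro c ⟨f, g⟩ ⟨F, F', hF, hF', hf, h1, h2⟩
    refine ⟨c • F, c • F', hF.const_smul c, hF'.const_smul c, ?_, ?_, ?_⟩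
    · exact (Lp.coeFn_smul c f).trans (hf.const_smul c)
    · intro r hr
      simp only [Pi.smul_apply]
      rw [intervalIntegral.integral_smul, h1 r hr]
    · intro r hr
      have e : ∫ s in (0 : ℝ)..r, ((s : ℂ) ^ 2 * (c • F) s - (c • (f, g) : L2 × L2).2 s)
          = ∫ s in (0 : ℝ)..r, c • ((s : ℂ) ^ 2 * F s - g s) := by
        rw [intervalIntegral.integral_of_le hr, intervalIntegral.integral_of_le hr]
        refine integral_congr_ae ?_
        have h := ae_restrict_of_ae_restrict_of_subset
          (fun x hx => hx.1 : Ioc 0 r ⊆ Ioi 0) (Lp.coeFn_smul c g)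
        filter_upwards [h] with s hs
        have hs' : (c • (f, g) : L2 × L2).2 s = c * g s := hs
        rw [hs', Pi.smul_apply, smul_eq_mul, smul_eq_mul]
        ring
      rw [e, intervalIntegral.integral_smul]
      simp only [Pi.smul_apply]
      rw [h2 r hr, smul_add]

/-- The harmonic oscillator `-d²/dr² + r²` on `L²(0, ∞)` with Dirichlet condition at the origin. -/
def oscillator : L2 →ₗ.[ℂ] L2 := oscillatorGraph.toLinearPMap

/-- `oscillatorGraph` is the graph of a function, so `oscillator` is what it should be. -/
theorem oscillator_graph : oscillator.graph = oscillatorGraph := by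
  refine Submodule.toLinearPMap_graph_eq _ ?_
  rintro ⟨f, g⟩ hp hf0
  obtain ⟨F, F', hF, hF', hf, h1, h2⟩ := hp
  obtain rfl : f = 0 := hf0
  have hF0 : EqOn F 0 (Ioi 0) := by
    refine Measure.eqOn_open_of_ae_eq (μ := volume) ?_ isOpen_Ioi (hF.mono Ioi_subset_Ici_self)
      continuousOn_const
    exact hf.symm.trans (Lp.coeFn_zero _ _ _)
  have hF'0 : EqOn F' 0 (Ioi 0) := by
    intro r hr
    have hd : HasDerivAt (fun x => ∫ s in (0 : ℝ)..x, F' s) (F' r) r :=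
      intervalIntegral.integral_hasDerivAt_right
        (intervalIntegrable_of_continuousOn_Ici hF' (le_of_lt hr))
        ((hF'.mono Ioi_subset_Ici_self).stronglyMeasurableAtFilter isOpen_Ioi r hr)
        (hF'.continuousAt (Ici_mem_nhds hr))
    have hz : HasDerivAt (fun x => ∫ s in (0 : ℝ)..x, F' s) 0 r := by
      refine (hasDerivAt_const r (0 : ℂ)).congr_of_eventuallyEq ?_
      filter_upwards [Ioi_mem_nhds hr] with x hx
      rw [← h1 x (le_of_lt hx), hF0 hx]
      rfl
    exact hd.unique hz
  have hF'00 : F' 0 = 0 := by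
    have h : Tendsto F' (𝓝[>] 0) (𝓝 (F' 0)) :=
      (hF' 0 self_mem_Ici).mono_left (nhdsWithin_mono _ Ioi_subset_Ici_self)
    refine tendsto_nhds_unique h (tendsto_const_nhds.congr' ?_)
    filter_upwards [self_mem_nhdsWithin] with x hx
    exact (hF'0 hx).symm
  have hg : ∀ r ≥ 0, ∫ s in (0 : ℝ)..r, g s = 0 := by
    intro r hr
    rcases hr.eq_or_lt with rfl | hr'
    · simp
    have h := h2 r hr
    rw [hF'0 hr', hF'00] at h
    have e : ∫ s in (0 : ℝ)..r, ((s : ℂ) ^ 2 * F s - g s) = ∫ s in (0 : ℝ)..r, - g s := by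
      rw [intervalIntegral.integral_of_le hr, intervalIntegral.integral_of_le hr]
      refine setIntegral_congr_fun measurableSet_Ioc fun s hs => ?_
      have : F s = 0 := hF0 hs.1
      simp [this]
    rw [e, intervalIntegral.integral_neg] at h
    simpa using h.symm
  change g = 0
  refine Lp.ext (EventuallyEq.trans ?_ (Lp.coeFn_zero ℂ 2 halfLine).symm)
  have hae : ∀ n : ℕ, ∀ᵐ x : ℝ, x ∈ Ioo (0 : ℝ) n → g x = 0 := by
    intro n
    have hn : (0 : ℝ) ≤ n := n.cast_nonneg
    filter_upwards [(L2.intervalIntegrable g hn).ae_hasDerivAt_integral] with x hx hxn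
    have hx' : x ∈ uIcc (0 : ℝ) n := by
      rw [uIcc_of_le hn]
      exact Ioo_subset_Icc_self hxn
    refine (hx hx' 0 left_mem_uIcc).unique ?_
    refine (hasDerivAt_const x (0 : ℂ)).congr_of_eventuallyEq ?_
    filter_upwards [Ioi_mem_nhds hxn.1] with y hy
    exact hg y (le_of_lt hy)
  refine (ae_restrict_iff' measurableSet_Ioi).2 ?_
  filter_upwards [ae_all_iff.2 hae] with x hx hx0
  obtain ⟨n, hn⟩ := exists_nat_gt x
  exact hx n ⟨hx0, hn⟩

/-- `Dom(A^q)` for `A = diag(Ã, Ã)` on `L²(0, ∞)²`, where `Ã` is the Dirichlet harmonic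
oscillator. -/
def powDomainA (q : ℝ) : Set Spinor :=
  {u | u.fst ∈ powDomain oscillator q ∧ u.snd ∈ powDomain oscillator q}

end RadialDirac

end

/-!
# Second order spectra of radial Dirac operators in the odd Hermite basis

Write `G = H - E`, `𝓔 = ker G`, and let `Π` be the orthogonal projection onto `𝓔`. A point `z`
belongs to the second order spectrum relative to `ℒ` iff the compression to `ℒ` of
`(H - conj z)* (H - z)` is singular (`IsSymm.mem_spec₂_iff`). The theorem combines an abstract
perturbation estimate for this pencil with an approximation estimate for the Hermite basis.

*The pencil near `E`.* Since `E` is isolated in the spectrum, `G` is bounded below on `𝓔ᗮ`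
(`IsSymm.exists_hasGap`, by the continuous functional calculus of a resolvent). Suppose that `ℒ`
approximates every unit vector of `𝓔` up to `δ` in the graph norm. On the circle `|z - E| = 16 δ`
the pencil is bounded below by a multiple of `δ²`: the form is `(z - E)² ‖u‖²` on `𝓔` and has
positive real part on `𝓔ᗮ`, so that rotating the phase of the `𝓔`-component of the test vector
makes it coercive (`re_inner_rotated_ge`, `IsSymm.norm_pencilOp_ge`). At the centre, an
approximate eigenvector forces the inverse of the pencil to be larger
(`le_norm_inverse_pencilOp`). By the maximum principle the inverse cannot be holomorphic in the
disc, hence there is a point of the second order spectrum within `16 δ` of `E`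
(`IsSymm.exists_mem_spec₂`). If `Q(z) v = 0`, testing with `v` itself bounds `‖(1 - Π) v‖` by a
multiple of `|z - E|` (`IsSymm.norm_sub_eigenProj_le`).

*The Hermite basis.* The odd Hermite functions are eigenfunctions of the Dirichlet oscillator with
eigenvalues `4k + 3`, orthogonal because their Wronskians vanish at both ends, and complete in
`L²(0, ∞)` because the odd extension of a function orthogonal to all of them, times a Gaussian,
has vanishing moments (`hasSum_hermiteUnit`). They vanish at the origin, so cutoffs place them in
the domain of the closed operator `H`, and Hardy's inequality bounds `‖H Φ_k‖` by a multiple of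
`(4k + 3)^{1/2} ‖Φ_k‖` (`IsRadialDirac.exists_norm_hermiteUnit_le`). For a vector of `Dom(A^q)`
the tails of the Hermite expansion are then `O(N^{-(q-1)/2})` in the graph norm of `H`
(`exists_tail_le`, `exists_hermite_approx`), uniformly on the unit sphere of the
finite-dimensional space `𝓔`.
-/

noncomputable section

namespace RadialDirac

/-! ### The second order spectrum in coordinate-free form -/

section SecondOrder

variable {X : Type*} [NormedAddCommGroup X] [InnerProductSpace ℂ X]

/-- `T` is symmetric on its domain. -/
def IsSymm (T : X →ₗ.[ℂ] X) : Prop :=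
  ∀ x y : T.domain, ⟪T x, (y : X)⟫_ℂ = ⟪(x : X), T y⟫_ℂ

/-- `T - z` as a linear map on the domain of `T`. -/
def shift (T : X →ₗ.[ℂ] X) (z : ℂ) : T.domain →ₗ[ℂ] X :=
  T.toFun - z • T.domain.subtype

theorem shift_apply (T : X →ₗ.[ℂ] X) (z : ℂ) (x : T.domain) :
    shift T z x = T x - z • (x : X) := rfl

open ComplexConjugate in
theorem IsSymm.inner_shift {T : X →ₗ.[ℂ] X} (hT : IsSymm T) (z : ℂ) (t v : T.domain) :
    ⟪shift T (conj z) t, shift T z v⟫_ℂ =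
      z ^ 2 * ⟪(t : X), (v : X)⟫_ℂ - 2 * z * ⟪T t, (v : X)⟫_ℂ + ⟪T t, T v⟫_ℂ := by
  simp only [shift_apply, inner_sub_left, inner_sub_right, inner_smul_left, inner_smul_right,
    Complex.conj_conj, ← hT t v]
  ring

open ComplexConjugate in
theorem IsSymm.inner_quadPencil {T : X →ₗ.[ℂ] X} (hT : IsSymm T) {n : ℕ} (b : Fin n → T.domain)
    (z : ℂ) (c : Fin n → ℂ) (j : Fin n) :
    (quadPencil T b z).mulVec c j = ⟪shift T (conj z) (b j), shift T z (∑ k, c k • b k)⟫_ℂ := by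
  simp only [map_sum, inner_sum, map_smul, inner_smul_right, hT.inner_shift, Matrix.mulVec,
    dotProduct, quadPencil, Matrix.of_apply]
  exact Finset.sum_congr rfl fun k _ => mul_comm _ _

open ComplexConjugate in
/-- `Q(z) v = 0` says that `(T - z) v` is orthogonal to `(T - conj z) ℒ`. -/
theorem IsSymm.solvesQ_iff {T : X →ₗ.[ℂ] X} (hT : IsSymm T) {ℒ : Submodule ℂ X}
    [FiniteDimensional ℂ ℒ] (hℒ : ℒ ≤ T.domain) {z : ℂ} {v : X} :
    SolvesQ T ℒ z v ↔ ∃ hv : v ∈ ℒ, ∀ (t : X) (ht : t ∈ ℒ),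
      ⟪shift T (conj z) ⟨t, hℒ ht⟩, shift T z ⟨v, hℒ hv⟩⟫_ℂ = 0 := by
  constructor
  · rintro ⟨n, b, c, -, hspan, rfl, hQ⟩
    have hb : ∀ j, (b j : X) ∈ ℒ := fun j => hspan ▸ Submodule.subset_span ⟨j, rfl⟩
    refine ⟨Submodule.sum_mem _ fun j _ => Submodule.smul_mem _ _ (hb j), ?_⟩
    have key : ∀ j, ⟪shift T (conj z) (b j), shift T z (∑ k, c k • b k)⟫_ℂ = 0 := fun j => by
      rw [← hT.inner_quadPencil, hQ]; rfl
    have e : ∀ h, (⟨∑ k, c k • (b k : X), h⟩ : T.domain) = ∑ k, c k • b k := fun h => by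
      ext; simp
    intro t ht
    rw [e]
    have ht' : t ∈ Submodule.span ℂ (range fun j => (b j : X)) := hspan ▸ ht
    obtain ⟨a, rfl⟩ := (Submodule.mem_span_range_iff_exists_fun ℂ).1 ht'
    have e' : ∀ h, (⟨∑ k, a k • (b k : X), h⟩ : T.domain) = ∑ k, a k • b k := fun h => by
      ext; simp
    rw [e', map_sum, sum_inner]
    refine Finset.sum_eq_zero fun j _ => ?_
    rw [map_smul, inner_smul_left, key, mul_zero]
  · rintro ⟨hv, h⟩
    let B := Module.finBasis ℂ ℒ
    have hsum : ∑ k, B.repr ⟨v, hv⟩ k • (B k : X) = v := by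
      have := congrArg ℒ.subtype (B.sum_repr ⟨v, hv⟩)
      simpa only [map_sum, map_smul, Submodule.subtype_apply] using this
    refine ⟨_, fun j => ⟨B j, hℒ (B j).2⟩, B.repr ⟨v, hv⟩, ?_, ?_, ?_, ?_⟩
    · exact B.linearIndependent.map' ℒ.subtype (Submodule.ker_subtype _)
    · have := B.span_eq
      have h2 := congrArg (Submodule.map ℒ.subtype) this
      rw [Submodule.map_span, Submodule.map_top, Submodule.range_subtype, ← range_comp] at h2
      exact h2
    · exact hsum.symm
    · ext j
      rw [hT.inner_quadPencil]
      have e : ∑ k, B.repr ⟨v, hv⟩ k • (⟨B k, hℒ (B k).2⟩ : T.domain) = ⟨v, hℒ hv⟩ := by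
        ext
        simpa using hsum
      rw [e]
      exact h _ (B j).2

/-- The restriction of `T - z` to a finite-dimensional subspace of the domain, as a continuous
linear map. -/
def shiftOn (T : X →ₗ.[ℂ] X) {ℒ : Submodule ℂ X} [FiniteDimensional ℂ ℒ] (hℒ : ℒ ≤ T.domain)
    (z : ℂ) : ℒ →L[ℂ] X :=
  LinearMap.toContinuousLinearMap (shift T z ∘ₗ Submodule.inclusion hℒ)

theorem shiftOn_apply (T : X →ₗ.[ℂ] X) {ℒ : Submodule ℂ X} [FiniteDimensional ℂ ℒ]
    (hℒ : ℒ ≤ T.domain) (z : ℂ) (v : ℒ) : shiftOn T hℒ z v = shift T z ⟨v, hℒ v.2⟩ := rfl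

variable [CompleteSpace X]

open ComplexConjugate in
/-- The quadratic pencil `Q(z) = (T - conj z)* (T - z)`, compressed to `ℒ`. -/
def pencilOp (T : X →ₗ.[ℂ] X) {ℒ : Submodule ℂ X} [FiniteDimensional ℂ ℒ] (hℒ : ℒ ≤ T.domain)
    (z : ℂ) : ℒ →L[ℂ] ℒ :=
  (shiftOn T hℒ (conj z)).adjoint ∘L shiftOn T hℒ z

open ComplexConjugate in
theorem inner_pencilOp (T : X →ₗ.[ℂ] X) {ℒ : Submodule ℂ X} [FiniteDimensional ℂ ℒ]
    (hℒ : ℒ ≤ T.domain) (z : ℂ) (t v : ℒ) :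
    ⟪t, pencilOp T hℒ z v⟫_ℂ = ⟪shift T (conj z) ⟨t, hℒ t.2⟩, shift T z ⟨v, hℒ v.2⟩⟫_ℂ := by
  rw [pencilOp, ContinuousLinearMap.comp_apply, ContinuousLinearMap.adjoint_inner_right]
  rfl

theorem IsSymm.solvesQ_iff_pencilOp {T : X →ₗ.[ℂ] X} (hT : IsSymm T) {ℒ : Submodule ℂ X}
    [FiniteDimensional ℂ ℒ] (hℒ : ℒ ≤ T.domain) {z : ℂ} {v : ℒ} :
    SolvesQ T ℒ z v ↔ pencilOp T hℒ z v = 0 := by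
  rw [hT.solvesQ_iff hℒ, ← inner_self_eq_zero (𝕜 := ℂ)]
  constructor
  · rintro ⟨hv, h⟩
    rw [inner_pencilOp]
    exact h _ (Subtype.mem _)
  · intro h
    refine ⟨v.2, fun t ht => ?_⟩
    rw [inner_self_eq_zero] at h
    rw [← inner_pencilOp T hℒ z ⟨t, ht⟩ v, h, inner_zero_right]

theorem IsSymm.mem_spec₂_iff {T : X →ₗ.[ℂ] X} (hT : IsSymm T) {ℒ : Submodule ℂ X}
    [FiniteDimensional ℂ ℒ] (hℒ : ℒ ≤ T.domain) {z : ℂ} :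
    z ∈ spec₂ T ℒ ↔ ¬ IsUnit (pencilOp T hℒ z) := by
  have hu : IsUnit (pencilOp T hℒ z) ↔ Function.Injective (pencilOp T hℒ z) := by
    rw [ContinuousLinearMap.isUnit_iff_bijective]
    refine ⟨fun h => h.1, fun h => ⟨h, ?_⟩⟩
    exact (LinearMap.injective_iff_surjective (f := (pencilOp T hℒ z).toLinearMap)).1 h
  rw [hu, injective_iff_map_eq_zero]
  push Not
  constructor
  · rintro ⟨v, hv0, hv⟩
    have hm : v ∈ ℒ := ((hT.solvesQ_iff hℒ).1 hv).1
    exact ⟨⟨v, hm⟩, (hT.solvesQ_iff_pencilOp hℒ (v := ⟨v, hm⟩)).1 hv, by simpa using hv0⟩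
  · rintro ⟨v, hv, hv0⟩
    exact ⟨v, by simpa using hv0, (hT.solvesQ_iff_pencilOp hℒ).2 hv⟩

/-- The pencil is a monic quadratic polynomial in `z`. -/
theorem pencilOp_eq (T : X →ₗ.[ℂ] X) {ℒ : Submodule ℂ X} [FiniteDimensional ℂ ℒ]
    (hℒ : ℒ ≤ T.domain) : ∃ L K : ℒ →L[ℂ] ℒ, ∀ z,
      pencilOp T hℒ z = z ^ 2 • (1 : ℒ →L[ℂ] ℒ) - z • L + K := by
  let ι : ℒ →L[ℂ] X := ℒ.subtypeL
  let G := shiftOn T hℒ 0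
  have hs : ∀ z, shiftOn T hℒ z = G - z • ι := by
    intro z; ext v
    simp [shiftOn_apply, shift_apply, G, ι]
  have hι : ι.adjoint ∘L ι = 1 := by
    ext v
    refine congrArg Subtype.val (ext_inner_left ℂ fun w => ?_)
    rw [ContinuousLinearMap.comp_apply, ContinuousLinearMap.adjoint_inner_right]
    rfl
  refine ⟨ι.adjoint ∘L G + G.adjoint ∘L ι, G.adjoint ∘L G, fun z => ?_⟩
  rw [← hι, pencilOp, hs, hs, map_sub, map_smulₛₗ, Complex.conj_conj]
  simp only [ContinuousLinearMap.sub_comp, ContinuousLinearMap.comp_sub,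
    ContinuousLinearMap.smul_comp, ContinuousLinearMap.comp_smul]
  module

theorem differentiable_quadratic {F : Type*} [NormedAddCommGroup F] [NormedSpace ℂ F]
    (a b c : F) : Differentiable ℂ fun z : ℂ => z ^ 2 • a - z • b + c := by
  fun_prop

theorem differentiable_pencilOp (T : X →ₗ.[ℂ] X) {ℒ : Submodule ℂ X} [FiniteDimensional ℂ ℒ]
    (hℒ : ℒ ≤ T.domain) : Differentiable ℂ (pencilOp T hℒ) := by
  obtain ⟨L, K, h⟩ := pencilOp_eq T hℒ
  rw [funext h]
  exact differentiable_quadratic (F := ℒ →L[ℂ] ℒ) 1 L K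

/-- The second order spectrum relative to a nonzero subspace is nonempty: it is the spectrum of
the companion map `(v, w) ↦ (w, L w - K v)` of the pencil. -/
theorem IsSymm.spec₂_nonempty {T : X →ₗ.[ℂ] X} (hT : IsSymm T) {ℒ : Submodule ℂ X}
    [FiniteDimensional ℂ ℒ] (hℒ : ℒ ≤ T.domain) (hne : ℒ ≠ ⊥) : (spec₂ T ℒ).Nonempty := by
  obtain ⟨L, K, h⟩ := pencilOp_eq T hℒ
  have : Nontrivial ℒ := Submodule.nontrivial_iff_ne_bot.2 hne
  let C : Module.End ℂ (ℒ × ℒ) := (LinearMap.snd ℂ ℒ ℒ).prod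
    (L.toLinearMap ∘ₗ LinearMap.snd ℂ ℒ ℒ - K.toLinearMap ∘ₗ LinearMap.fst ℂ ℒ ℒ)
  obtain ⟨z, hz⟩ := Module.End.exists_eigenvalue C
  obtain ⟨⟨v, w⟩, hvw⟩ := hz.exists_hasEigenvector
  have he := hvw.apply_eq_smul
  have h1 : w = z • v := congrArg Prod.fst he
  have h2 : L w - K v = z • w := congrArg Prod.snd he
  subst h1
  have hv : v ≠ 0 := by
    rintro rfl
    exact hvw.2 (by simp)
  refine ⟨z, v, by simpa using hv, (hT.solvesQ_iff_pencilOp hℒ).2 ?_⟩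
  rw [h]
  rw [map_smul] at h2
  change z ^ 2 • v - z • L v + K v = 0
  rw [sub_eq_iff_eq_add.1 h2, smul_smul, pow_two]
  abel

end SecondOrder

/-! ### Second order spectrum near an isolated eigenvalue -/

section Near

variable {X : Type*} [NormedAddCommGroup X] [InnerProductSpace ℂ X]

theorem eigenspace_le_domain (T : X →ₗ.[ℂ] X) (μ : ℂ) : eigenspace T μ ≤ T.domain :=
  fun _ h => h.1

theorem shift_eq_zero {T : X →ₗ.[ℂ] X} {μ : ℂ} {u : X} (hu : u ∈ eigenspace T μ)
    (h : u ∈ T.domain) : shift T μ ⟨u, h⟩ = 0 := by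
  obtain ⟨h', e⟩ := hu
  rw [shift_apply, e, sub_self]

theorem shift_eq_sub (T : X →ₗ.[ℂ] X) (μ z : ℂ) (x : T.domain) :
    shift T z x = shift T μ x - (z - μ) • (x : X) := by
  simp only [shift_apply]
  module

/-- For symmetric `T` and real `E`, the range of `T - E` is orthogonal to `ker (T - E)`. -/
theorem IsSymm.inner_shift_eq_zero {T : X →ₗ.[ℂ] X} (hT : IsSymm T) {E : ℝ} {u : X}
    (hu : u ∈ eigenspace T E) (x : T.domain) : ⟪u, shift T E x⟫_ℂ = 0 := by
  obtain ⟨h, e⟩ := hu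
  have := hT ⟨u, h⟩ x
  rw [shift_apply, inner_sub_right, ← this, e, inner_smul_left, inner_smul_right]
  simp

open ComplexConjugate in
/-- If `ζ w` is small compared with `g`, then `⟪g - conj ζ w, g - ζ w⟫` stays close to `‖g‖²`. -/
theorem half_sq_le_re_inner {g w : X} {ζ : ℂ} (h : ‖ζ‖ * ‖w‖ ≤ ‖g‖ / 8) :
    ‖g‖ ^ 2 / 2 ≤ (⟪g - conj ζ • w, g - ζ • w⟫_ℂ).re := by
  have e : ⟪g - conj ζ • w, g - ζ • w⟫_ℂ
      = (‖g‖ ^ 2 : ℝ) - (ζ * ⟪g, w⟫_ℂ + ζ * ⟪w, g⟫_ℂ - ζ ^ 2 * ⟪w, w⟫_ℂ) := by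
    simp only [inner_sub_left, inner_sub_right, inner_smul_left, inner_smul_right,
      Complex.conj_conj, inner_self_eq_norm_sq_to_K (𝕜 := ℂ) g]
    push_cast
    simp only [Complex.coe_algebraMap]
    ring
  have n1 : ‖ζ * ⟪g, w⟫_ℂ‖ ≤ ‖g‖ ^ 2 / 8 := by
    rw [norm_mul]
    calc ‖ζ‖ * ‖⟪g, w⟫_ℂ‖ ≤ ‖ζ‖ * (‖g‖ * ‖w‖) := by gcongr; exact norm_inner_le_norm _ _
      _ = ‖g‖ * (‖ζ‖ * ‖w‖) := by ring
      _ ≤ ‖g‖ * (‖g‖ / 8) := by gcongr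
      _ = _ := by ring
  have n2 : ‖ζ * ⟪w, g⟫_ℂ‖ ≤ ‖g‖ ^ 2 / 8 := by
    rw [norm_mul, norm_inner_symm, ← norm_mul]; exact n1
  have n3 : ‖ζ ^ 2 * ⟪w, w⟫_ℂ‖ ≤ ‖g‖ ^ 2 / 64 := by
    rw [norm_mul, norm_pow]
    calc ‖ζ‖ ^ 2 * ‖⟪w, w⟫_ℂ‖ ≤ ‖ζ‖ ^ 2 * (‖w‖ * ‖w‖) := by gcongr; exact norm_inner_le_norm _ _
      _ = (‖ζ‖ * ‖w‖) ^ 2 := by ring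
      _ ≤ (‖g‖ / 8) ^ 2 := by gcongr
      _ = _ := by ring
  have h1 := (Complex.re_le_norm _).trans n1
  have h2 := (Complex.re_le_norm _).trans n2
  have h3 := (abs_le.1 ((Complex.abs_re_le_norm _).trans n3)).1
  rw [e, Complex.sub_re, Complex.ofReal_re, Complex.sub_re, Complex.add_re]
  nlinarith [sq_nonneg ‖g‖]

theorem inner_sub_smul_eq_zero {u w g : X} (hw : ⟪u, w⟫_ℂ = 0) (hg : ⟪u, g⟫_ℂ = 0) (c : ℂ) :
    ⟪u, g - c • w⟫_ℂ = 0 := by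
  rw [inner_sub_right, inner_smul_right, hw, hg, mul_zero, sub_zero]

theorem inner_add_add_of_orthogonal {u p q : X} (hp : ⟪u, p⟫_ℂ = 0) (hq : ⟪u, q⟫_ℂ = 0) (a b : ℂ) :
    ⟪a • u + p, b • u + q⟫_ℂ = (starRingEnd ℂ) a * b * (‖u‖ ^ 2 : ℝ) + ⟪p, q⟫_ℂ := by
  have hp' : ⟪p, u⟫_ℂ = 0 := inner_eq_zero_symm.1 hp
  simp only [inner_add_left, inner_add_right, inner_smul_left, inner_smul_right, hp', hq,
    inner_self_eq_norm_sq_to_K (𝕜 := ℂ) u]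
  push_cast
  simp only [Complex.coe_algebraMap]
  ring

open ComplexConjugate in
/-- Coercivity on the circle `‖ζ‖ = r`. Here `u` is the component of `y` in the kernel of `G`,
`w` the orthogonal one, `g = G w`, `h = G e`. The rotated test vector `α u + w`, corrected by
`(1 - α) e` to lie in the trial space, makes both diagonal terms positive. -/
theorem re_inner_rotated_ge {u w g e h : X} {ζ : ℂ} {r δ : ℝ} (hr : 0 < r) (hr1 : r ≤ 1)
    (hδ0 : 0 ≤ δ) (hδ : 16 * δ ≤ r) (hζ : ‖ζ‖ = r) (huw : ⟪u, w⟫_ℂ = 0) (hug : ⟪u, g⟫_ℂ = 0)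
    (hw : r * ‖w‖ ≤ ‖g‖ / 8) (he : ‖e‖ ≤ δ * ‖u‖) (hh : ‖h‖ ≤ δ * ‖u‖) :
    r ^ 2 / 2 * (‖u‖ ^ 2 + ‖w‖ ^ 2) ≤
      (⟪(-(conj ζ * (ζ ^ 2 / r ^ 2))) • u + (g - conj ζ • w) +
          (1 - ζ ^ 2 / r ^ 2) • (h - conj ζ • e),
        (-ζ) • u + (g - ζ • w)⟫_ℂ).re := by
  have hrC : (r : ℂ) ≠ 0 := by exact_mod_cast hr.ne'
  have hconj : conj ζ * ζ = (r : ℂ) ^ 2 := by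
    rw [← hζ, mul_comm, Complex.mul_conj, Complex.normSq_eq_norm_sq]; push_cast; rfl
  rw [inner_add_left, inner_add_add_of_orthogonal (inner_sub_smul_eq_zero huw hug _)
    (inner_sub_smul_eq_zero huw hug _)]
  have c1 : conj (-(conj ζ * (ζ ^ 2 / (r : ℂ) ^ 2))) * (-ζ) = ((r ^ 2 : ℝ) : ℂ) := by
    simp only [map_neg, map_mul, map_div₀, map_pow, Complex.conj_conj, Complex.conj_ofReal]
    field_simp
    push_cast
    linear_combination (conj ζ * ζ + (r : ℂ) ^ 2) * hconj
  rw [c1, Complex.add_re, Complex.add_re, ← Complex.ofReal_mul, Complex.ofReal_re]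
  have m1 : ‖g‖ ^ 2 / 2 ≤ (⟪g - conj ζ • w, g - ζ • w⟫_ℂ).re :=
    half_sq_le_re_inner (by rw [hζ]; exact hw)
  have hα : ‖(1 : ℂ) - ζ ^ 2 / (r : ℂ) ^ 2‖ ≤ 2 := by
    refine (norm_sub_le _ _).trans ?_
    rw [norm_div, norm_pow, norm_pow, hζ, Complex.norm_real, Real.norm_of_nonneg hr.le,
      div_self (by positivity), norm_one]
    norm_num
  have b1 : ‖h - conj ζ • e‖ ≤ 2 * (δ * ‖u‖) := by
    refine (norm_sub_le _ _).trans ?_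
    rw [norm_smul, RCLike.norm_conj, hζ]
    nlinarith [norm_nonneg e]
  have b2 : ‖(-ζ) • u + (g - ζ • w)‖ ≤ r * ‖u‖ + 2 * ‖g‖ := by
    refine (norm_add_le _ _).trans ?_
    have := norm_sub_le g (ζ • w)
    rw [norm_smul, hζ] at this
    rw [norm_smul, norm_neg, hζ]
    linarith [norm_nonneg g]
  have m2 : ‖⟪(1 - ζ ^ 2 / (r : ℂ) ^ 2) • (h - conj ζ • e), (-ζ) • u + (g - ζ • w)⟫_ℂ‖
      ≤ 2 * (2 * (δ * ‖u‖)) * (r * ‖u‖ + 2 * ‖g‖) := by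
    refine (norm_inner_le_norm _ _).trans ?_
    rw [norm_smul]
    gcongr
  have m3 := (abs_le.1 ((Complex.abs_re_le_norm _).trans m2)).1
  have m4 : r * ‖w‖ * (r * ‖w‖) ≤ ‖g‖ / 8 * (‖g‖ / 8) := by gcongr
  have m5 : 4 * δ * ‖u‖ * (r * ‖u‖ + 2 * ‖g‖) ≤ r / 4 * ‖u‖ * (r * ‖u‖ + 2 * ‖g‖) := by
    gcongr; linarith
  nlinarith [sq_nonneg (r * ‖u‖ - ‖g‖), norm_nonneg g, sq_nonneg ‖g‖]

variable [CompleteSpace X]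

theorem eigenProj_mem (T : X →ₗ.[ℂ] X) (μ : ℂ) [FiniteDimensional ℂ (eigenspace T μ)] (y : X) :
    eigenProj T μ y ∈ eigenspace T μ := by
  have h : eigenProj T μ y ∈ (eigenspace T μ).topologicalClosure :=
    Submodule.starProjection_apply_mem _ _
  rwa [(Submodule.closed_of_finiteDimensional (eigenspace T μ)).submodule_topologicalClosure_eq]
    at h

theorem inner_sub_eigenProj (T : X →ₗ.[ℂ] X) (μ : ℂ) {u : X} (hu : u ∈ eigenspace T μ) (y : X) :
    ⟪u, y - eigenProj T μ y⟫_ℂ = 0 :=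
  inner_eq_zero_symm.1
    (Submodule.starProjection_inner_eq_zero y u (Submodule.le_topologicalClosure _ hu))

/-- `T - E` is bounded below by `d` on the orthogonal complement of its kernel. -/
def HasGap (T : X →ₗ.[ℂ] X) (E d : ℝ) : Prop :=
  ∀ w : T.domain, (∀ u ∈ eigenspace T E, ⟪u, (w : X)⟫_ℂ = 0) → d * ‖(w : X)‖ ≤ ‖shift T E w‖

open ComplexConjugate in
/-- A normalised `v` with `Q(z) v = 0` is close to the eigenspace if `z` is close to `E`: testing
with `v` itself, the real part of the complementary component dominates. -/
theorem IsSymm.norm_sub_eigenProj_le {T : X →ₗ.[ℂ] X} (hT : IsSymm T) {E d : ℝ} (hd : 0 < d)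
    (hgap : HasGap T E d) [FiniteDimensional ℂ (eigenspace T E)] {ℒ : Submodule ℂ X}
    [FiniteDimensional ℂ ℒ] (hℒ : ℒ ≤ T.domain) {z : ℂ} (hz : 8 * ‖z - E‖ ≤ d) {v : X}
    (hv : SolvesQ T ℒ z v) (hv1 : ‖v‖ = 1) : ‖v - eigenProj T E v‖ ≤ 2 / d * ‖z - E‖ := by
  obtain ⟨hvL, hQ⟩ := (hT.solvesQ_iff hℒ).1 hv
  set u := eigenProj T E v with hu
  have huE : u ∈ eigenspace T E := eigenProj_mem T E v
  have huD := eigenspace_le_domain T E huE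
  have hw : v - u ∈ T.domain := T.domain.sub_mem (hℒ hvL) huD
  set w : T.domain := ⟨v - u, hw⟩ with hwdef
  set ζ : ℂ := z - E with hζ
  set g := shift T E w with hg
  have hdec : (⟨v, hℒ hvL⟩ : T.domain) = ⟨u, huD⟩ + w := by ext; simp [w]
  have hGv : shift T E ⟨v, hℒ hvL⟩ = g := by
    rw [hdec, map_add, shift_eq_zero huE, zero_add]
  have e1 : shift T z ⟨v, hℒ hvL⟩ = (-ζ) • u + (g - ζ • (w : X)) := by
    rw [shift_eq_sub T E z, hGv]
    change g - ζ • v = _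
    simp only [w]
    module
  have e2 : shift T (conj z) ⟨v, hℒ hvL⟩ = (-conj ζ) • u + (g - conj ζ • (w : X)) := by
    rw [shift_eq_sub T E, hGv]
    have : conj z - (E : ℂ) = conj ζ := by simp [hζ]
    rw [this]
    simp only [w]
    module
  have huw : ⟪u, (w : X)⟫_ℂ = 0 := inner_sub_eigenProj T E huE v
  have hug : ⟪u, g⟫_ℂ = 0 := hT.inner_shift_eq_zero huE w
  have hgw : d * ‖(w : X)‖ ≤ ‖g‖ := hgap w fun u' hu' => inner_sub_eigenProj T E hu' v
  have h0 := hQ v hvL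
  rw [e1, e2, inner_add_add_of_orthogonal (inner_sub_smul_eq_zero huw hug _)
    (inner_sub_smul_eq_zero huw hug _)] at h0
  have h1 : ‖g‖ ^ 2 / 2 ≤ (⟪g - conj ζ • (w : X), g - ζ • (w : X)⟫_ℂ).re :=
    half_sq_le_re_inner (by nlinarith [norm_nonneg (w : X), norm_nonneg ζ])
  have hun : ‖u‖ ≤ 1 := by
    rw [← hv1]; exact Submodule.norm_starProjection_apply_le _ _
  have h2 : ‖conj (-conj ζ) * (-ζ) * ((‖u‖ ^ 2 : ℝ) : ℂ)‖ ≤ ‖ζ‖ ^ 2 := by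
    rw [norm_mul, norm_mul, RCLike.norm_conj, norm_neg, norm_neg, RCLike.norm_conj,
      Complex.norm_real, Real.norm_of_nonneg (by positivity)]
    have : ‖u‖ ^ 2 ≤ 1 := pow_le_one₀ (norm_nonneg _) hun
    nlinarith [norm_nonneg ζ, mul_nonneg (norm_nonneg ζ) (norm_nonneg ζ)]
  have h3 := (abs_le.1 ((Complex.abs_re_le_norm _).trans h2)).1
  have h4 := congrArg Complex.re h0
  rw [Complex.add_re, Complex.zero_re] at h4
  have h5 : (d * ‖(w : X)‖) ^ 2 ≤ (2 * ‖ζ‖) ^ 2 := by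
    have : (d * ‖(w : X)‖) ^ 2 ≤ ‖g‖ ^ 2 := by gcongr
    nlinarith [sq_nonneg ‖ζ‖]
  have h7 := (abs_le.1 (abs_le_of_sq_le_sq h5 (by positivity))).2
  rw [div_mul_eq_mul_div, le_div_iff₀ hd, mul_comm]
  exact h7

open ComplexConjugate in
/-- Bound from below of the pencil on the circle of radius `r` around `E`. -/
theorem IsSymm.norm_pencilOp_ge {T : X →ₗ.[ℂ] X} (hT : IsSymm T) {E d : ℝ}
    (hgap : HasGap T E d) [FiniteDimensional ℂ (eigenspace T E)] {ℒ : Submodule ℂ X}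
    [FiniteDimensional ℂ ℒ] (hℒ : ℒ ≤ T.domain) {δ r : ℝ} (hδ0 : 0 ≤ δ) (hδ : 16 * δ ≤ r)
    (hr : 0 < r) (hr1 : r ≤ 1) (hrd : 8 * r ≤ d)
    (happ : ∀ u : T.domain, (u : X) ∈ eigenspace T E → ∃ v : T.domain, (v : X) ∈ ℒ ∧
      ‖((u - v : T.domain) : X)‖ ≤ δ * ‖(u : X)‖ ∧ ‖shift T E (u - v)‖ ≤ δ * ‖(u : X)‖)
    {z : ℂ} (hz : ‖z - E‖ = r) (y : ℒ) : r ^ 2 / 10 * ‖y‖ ≤ ‖pencilOp T hℒ z y‖ := by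
  set u := eigenProj T E (y : X) with hu
  have huE : u ∈ eigenspace T E := eigenProj_mem T E _
  have huD := eigenspace_le_domain T E huE
  have hw : (y : X) - u ∈ T.domain := T.domain.sub_mem (hℒ y.2) huD
  set w : T.domain := ⟨y - u, hw⟩ with hwdef
  obtain ⟨v, hvL, he, hh⟩ := happ ⟨u, huD⟩ huE
  set e : T.domain := ⟨u, huD⟩ - v with hedef
  set ζ : ℂ := z - E with hζ
  set g := shift T E w with hg
  set h := shift T E e with hhdef
  set α : ℂ := ζ ^ 2 / (r : ℂ) ^ 2 with hα
  have hdec : (⟨y, hℒ y.2⟩ : T.domain) = ⟨u, huD⟩ + w := by ext; simp [w]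
  have e1 : shift T z ⟨y, hℒ y.2⟩ = (-ζ) • u + (g - ζ • (w : X)) := by
    rw [shift_eq_sub T E z, hdec, map_add, shift_eq_zero huE, zero_add]
    change g - ζ • (u + (w : X)) = _
    module
  -- `α u + w` is not in `ℒ`; replacing `u` by `v` and `w` by `y - v` costs the error `(1 - α) e`
  let t : ℒ := α • ⟨v, hvL⟩ + (y - ⟨v, hvL⟩)
  have htdec : (⟨t, hℒ t.2⟩ : T.domain) = α • ⟨u, huD⟩ + w + (1 - α) • e := by
    ext
    simp only [t, w, e, Submodule.coe_add, Submodule.coe_smul, Submodule.coe_sub]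
    module
  have e2 : shift T (conj z) ⟨t, hℒ t.2⟩ = (-(conj ζ * α)) • u + (g - conj ζ • (w : X)) +
      (1 - α) • (h - conj ζ • (e : X)) := by
    have : conj z - (E : ℂ) = conj ζ := by simp [hζ]
    rw [shift_eq_sub T E, htdec, this, map_add, map_add, map_smul, map_smul, shift_eq_zero huE]
    simp only [Submodule.coe_add, Submodule.coe_smul]
    module
  have huw : ⟪u, (w : X)⟫_ℂ = 0 := inner_sub_eigenProj T E huE y
  have hug : ⟪u, g⟫_ℂ = 0 := hT.inner_shift_eq_zero huE w
  have hgw : d * ‖(w : X)‖ ≤ ‖g‖ := hgap w fun u' hu' => inner_sub_eigenProj T E hu' y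
  have key := re_inner_rotated_ge hr hr1 hδ0 hδ hz huw hug
    (by nlinarith [norm_nonneg (w : X)]) he hh
  rw [← hα, ← e1, ← e2, ← inner_pencilOp] at key
  have hpy : ‖y‖ ^ 2 = ‖u‖ ^ 2 + ‖(w : X)‖ ^ 2 := by
    have h1 : (y : X) = u + w := by simp [w]
    have := norm_add_sq_eq_norm_sq_add_norm_sq_of_inner_eq_zero (𝕜 := ℂ) u (w : X) huw
    rw [← h1] at this
    simpa [sq] using this
  rw [← hpy] at key
  have huy : ‖u‖ ≤ ‖y‖ := Submodule.norm_starProjection_apply_le _ _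
  have hvn : ‖(v : X)‖ ≤ 2 * ‖y‖ := by
    have h1 : (v : X) = u - e := by simp [e]
    rw [h1]
    refine (norm_sub_le _ _).trans ?_
    have : δ * ‖u‖ ≤ 1 * ‖u‖ := by gcongr; linarith
    have he' : ‖(e : X)‖ ≤ δ * ‖u‖ := he
    linarith
  have htn : ‖t‖ ≤ 5 * ‖y‖ := by
    refine (norm_add_le _ _).trans ?_
    have h1 : ‖α‖ = 1 := by
      rw [hα, norm_div, norm_pow, norm_pow, hz, Complex.norm_real, Real.norm_of_nonneg hr.le,
        div_self (by positivity)]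
    have h2 := norm_sub_le y (⟨v, hvL⟩ : ℒ)
    have h3 : ‖(⟨v, hvL⟩ : ℒ)‖ = ‖(v : X)‖ := rfl
    rw [norm_smul, h1, h3, one_mul]
    rw [h3] at h2
    linarith
  have h1 : r ^ 2 / 2 * ‖y‖ ^ 2 ≤ 5 * ‖y‖ * ‖pencilOp T hℒ z y‖ :=
    key.trans <| (Complex.re_le_norm _).trans <| (norm_inner_le_norm _ _).trans <| by gcongr
  rcases (norm_nonneg y).eq_or_lt with h0 | h0
  · rw [← h0, mul_zero]; exact norm_nonneg _
  · refine le_of_mul_le_mul_left ?_ h0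
    linarith

open ComplexConjugate in
/-- A trial space containing a good approximation of one normalised eigenvector makes the pencil
at `E` nearly singular: its inverse is large. -/
theorem le_norm_inverse_pencilOp (T : X →ₗ.[ℂ] X) {E : ℝ} {ℒ : Submodule ℂ X}
    [FiniteDimensional ℂ ℒ] (hℒ : ℒ ≤ T.domain) {δ : ℝ} (hδ0 : 0 < δ)
    {v : X} (hv : v ∈ ℒ) (hv1 : 1 / 2 < ‖v‖) (hvδ : ‖shift T E ⟨v, hℒ hv⟩‖ ≤ δ)
    (hu : IsUnit (pencilOp T hℒ E)) :
    1 / (4 * δ ^ 2) < ‖Ring.inverse (pencilOp T hℒ E)‖ := by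
  set A := pencilOp T hℒ E with hA
  set y : ℒ := ⟨v, hv⟩ with hy
  set x : ℒ := Ring.inverse A y with hx
  have hAx : A x = y := by
    change (A * Ring.inverse A) y = y
    rw [Ring.mul_inverse_cancel _ hu]; rfl
  have hEc : conj (E : ℂ) = E := Complex.conj_ofReal E
  have hf : ∀ t s : ℒ, ⟪t, A s⟫_ℂ = ⟪shift T E ⟨t, hℒ t.2⟩, shift T E ⟨s, hℒ s.2⟩⟫_ℂ := by
    intro t s
    rw [hA, inner_pencilOp, hEc]
  set a := ‖shift T E ⟨x, hℒ x.2⟩‖ with ha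
  have hyn : ‖y‖ = ‖v‖ := rfl
  have hy0 : 0 < ‖y‖ := by rw [hyn]; linarith
  -- Cauchy–Schwarz for the form `⟪y, A x⟫`, with `A x = y`, bounds `x` from below
  have h1 : ‖y‖ ^ 2 ≤ δ * a := by
    have h := hf y x
    rw [hAx, inner_self_eq_norm_sq_to_K] at h
    have h' := congrArg norm h
    rw [norm_pow, RCLike.norm_ofReal, abs_of_nonneg hy0.le] at h'
    rw [h']
    exact (norm_inner_le_norm _ _).trans (by gcongr)
  have h2 : a ^ 2 ≤ ‖x‖ * ‖y‖ := by
    have h := hf x x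
    rw [hAx, inner_self_eq_norm_sq_to_K] at h
    have h' := congrArg norm h
    rw [norm_pow, RCLike.norm_ofReal, abs_of_nonneg (norm_nonneg _), ← ha] at h'
    rw [← h']
    exact norm_inner_le_norm _ _
  have h3 : ‖x‖ ≤ ‖Ring.inverse A‖ * ‖y‖ := ContinuousLinearMap.le_opNorm _ _
  set m := ‖Ring.inverse A‖
  have h4 : ‖y‖ ^ 2 * ‖y‖ ^ 2 ≤ δ ^ 2 * m * ‖y‖ ^ 2 := by
    calc ‖y‖ ^ 2 * ‖y‖ ^ 2 ≤ (δ * a) * (δ * a) := by gcongr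
      _ = δ ^ 2 * a ^ 2 := by ring
      _ ≤ δ ^ 2 * (‖x‖ * ‖y‖) := by gcongr
      _ ≤ δ ^ 2 * (m * ‖y‖ * ‖y‖) := by gcongr
      _ = _ := by ring
  have h5 : ‖y‖ ^ 2 ≤ δ ^ 2 * m := le_of_mul_le_mul_right h4 (by positivity)
  rw [div_lt_iff₀ (by positivity)]
  rw [hyn] at h5
  nlinarith

theorem differentiableAt_ringInverse_comp {R : Type*} [NormedRing R] [NormedAlgebra ℂ R]
    [HasSummableGeomSeries R] {f : ℂ → R} {z : ℂ} (hf : DifferentiableAt ℂ f z)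
    (hz : IsUnit (f z)) : DifferentiableAt ℂ (fun z => Ring.inverse (f z)) z :=
  (differentiableAt_inverse hz).comp z hf

/-- If every eigenvector is approximated by the trial space to relative accuracy `δ` in the graph
norm, the second order spectrum has a point within `16 δ` of the eigenvalue. Otherwise the inverse
pencil would be holomorphic near the disc; it is bounded by `10 / (16 δ)²` on its boundary, but
larger than `1 / (4 δ²)` at the centre. -/
theorem IsSymm.exists_mem_spec₂ {T : X →ₗ.[ℂ] X} (hT : IsSymm T) {E d : ℝ}
    (hgap : HasGap T E d) [FiniteDimensional ℂ (eigenspace T E)] (hne : eigenspace T E ≠ ⊥)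
    {ℒ : Submodule ℂ X} [FiniteDimensional ℂ ℒ] (hℒ : ℒ ≤ T.domain) {δ : ℝ} (hδ0 : 0 < δ)
    (hδ1 : 16 * δ ≤ 1) (hδd : 8 * (16 * δ) ≤ d)
    (happ : ∀ u : T.domain, (u : X) ∈ eigenspace T E → ∃ v : T.domain, (v : X) ∈ ℒ ∧
      ‖((u - v : T.domain) : X)‖ ≤ δ * ‖(u : X)‖ ∧ ‖shift T E (u - v)‖ ≤ δ * ‖(u : X)‖) :
    ∃ z ∈ spec₂ T ℒ, ‖z - E‖ ≤ 16 * δ := by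
  by_contra! hcon
  set r := 16 * δ with hr
  have hr0 : 0 < r := by positivity
  have hunit : ∀ z ∈ Metric.closedBall (E : ℂ) r, IsUnit (pencilOp T hℒ z) := by
    intro z hz
    by_contra h
    have := hcon z ((hT.mem_spec₂_iff hℒ).2 h)
    rw [Metric.mem_closedBall, dist_eq_norm] at hz
    linarith
  have hdiff : DiffContOnCl ℂ (fun z => Ring.inverse (pencilOp T hℒ z)) (Metric.ball (E : ℂ) r) := by
    refine DifferentiableOn.diffContOnCl fun z hz => ?_
    rw [closure_ball _ hr0.ne'] at hz
    exact (differentiableAt_ringInverse_comp (R := ℒ →L[ℂ] ℒ) (differentiable_pencilOp T hℒ z)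
      (hunit z hz)).differentiableWithinAt
  have hbd : ∀ z ∈ frontier (Metric.ball (E : ℂ) r),
      ‖Ring.inverse (pencilOp T hℒ z)‖ ≤ 10 / r ^ 2 := by
    intro z hz
    rw [frontier_ball _ hr0.ne', mem_sphere_iff_norm] at hz
    refine ContinuousLinearMap.opNorm_le_bound _ (by positivity) fun y => ?_
    have h := hT.norm_pencilOp_ge hgap hℒ hδ0.le le_rfl hr0 hδ1 hδd happ hz
      (Ring.inverse (pencilOp T hℒ z) y)
    have hu := hunit z (by rw [mem_closedBall_iff_norm]; exact hz.le)
    have e : pencilOp T hℒ z (Ring.inverse (pencilOp T hℒ z) y) = y := by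
      change (pencilOp T hℒ z * Ring.inverse (pencilOp T hℒ z)) y = y
      rw [Ring.mul_inverse_cancel _ hu]; rfl
    rw [e] at h
    rw [div_mul_eq_mul_div, le_div_iff₀ (by positivity)]
    linarith
  have hmax := Complex.norm_le_of_forall_mem_frontier_norm_le Metric.isBounded_ball hdiff hbd
    (subset_closure (Metric.mem_ball_self hr0))
  obtain ⟨u₀, hu₀, hu₀n⟩ := Submodule.exists_mem_ne_zero_of_ne_bot hne
  set c : ℂ := ((‖u₀‖⁻¹ : ℝ) : ℂ)
  have hu1 : ‖c • u₀‖ = 1 := by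
    rw [norm_smul, Complex.norm_real, norm_inv, norm_norm, inv_mul_cancel₀ (norm_ne_zero_iff.2 hu₀n)]
  have huE : c • u₀ ∈ eigenspace T E := Submodule.smul_mem _ _ hu₀
  have huD := eigenspace_le_domain T E huE
  obtain ⟨v, hvL, h1, h2⟩ := happ ⟨c • u₀, huD⟩ huE
  simp only [hu1, mul_one] at h1 h2
  rw [map_sub, shift_eq_zero huE, zero_sub, norm_neg] at h2
  have hvn : 1 / 2 < ‖(v : X)‖ := by
    have := norm_sub_norm_le (c • u₀) (v : X)
    have h3 : ‖c • u₀ - (v : X)‖ ≤ δ := h1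
    rw [hu1] at this
    linarith
  have hbig := le_norm_inverse_pencilOp T (E := E) hℒ hδ0 hvL hvn h2
    (hunit E (Metric.mem_closedBall_self hr0.le))
  have := hbig.trans_le hmax
  rw [div_lt_div_iff₀ (by positivity) (by positivity), hr] at this
  nlinarith [sq_pos_of_pos hδ0]

end Near

/-! ### The spectral gap around an isolated eigenvalue -/

section Gap

variable {X : Type*} [NormedAddCommGroup X] [InnerProductSpace ℂ X]

/-- `R` is the bounded inverse of `T - z`. -/
def IsResolvent (T : X →ₗ.[ℂ] X) (z : ℂ) (R : X →L[ℂ] X) : Prop :=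
  (∀ y : X, ∃ h : R y ∈ T.domain, T ⟨R y, h⟩ - z • R y = y) ∧
    ∀ x : T.domain, R (T x - z • (x : X)) = x

/-- The resolvent of a symmetric operator at a real point is symmetric. -/
theorem IsSymm.isSymmetric_resolvent {T : X →ₗ.[ℂ] X} (hT : IsSymm T) {z : ℝ} {R : X →L[ℂ] X}
    (hR : IsResolvent T z R) : (R : X →ₗ[ℂ] X).IsSymmetric := by
  intro x y
  obtain ⟨hx, ex⟩ := hR.1 x
  obtain ⟨hy, ey⟩ := hR.1 y
  have h := hT ⟨R x, hx⟩ ⟨R y, hy⟩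
  change ⟪R x, y⟫_ℂ = ⟪x, R y⟫_ℂ
  nth_rw 2 [← ex]
  nth_rw 1 [← ey]
  rw [inner_sub_left, inner_sub_right, h, inner_smul_left, inner_smul_right, Complex.conj_ofReal]

/-- Eigenvectors of the resolvent at `z` are eigenvectors of the operator. -/
theorem IsResolvent.mem_eigenspace {T : X →ₗ.[ℂ] X} {z : ℂ} {R : X →L[ℂ] X}
    (hR : IsResolvent T z R) {ν : ℂ} (hν : ν ≠ 0) {p : X} (hp : R p = ν • p) :
    p ∈ eigenspace T (z + ν⁻¹) := by
  obtain ⟨h, e⟩ := hR.1 p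
  have hpR : p = ν⁻¹ • R p := by rw [hp, smul_smul, inv_mul_cancel₀ hν, one_smul]
  have hpD : p ∈ T.domain := hpR ▸ T.domain.smul_mem _ h
  refine ⟨hpD, ?_⟩
  have e1 : (⟨R p, h⟩ : T.domain) = ν • ⟨p, hpD⟩ := by ext; exact hp
  rw [e1, hp, LinearPMap.map_smul, smul_comm, ← smul_sub] at e
  have e2 := congrArg (fun x => ν⁻¹ • x) e
  simp only [smul_smul, inv_mul_cancel₀ hν, one_smul] at e2
  rw [add_smul, ← e2]
  abel

variable [CompleteSpace X]

/-- Points of the resolvent set of `T` give points `ν` of the resolvent set of `R`: the inverse of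
`ν - R` is `ν⁻¹ (1 + ν⁻¹ R')`. -/
theorem IsResolvent.isUnit_algebraMap_sub {T : X →ₗ.[ℂ] X} {z ν : ℂ} {R R' : X →L[ℂ] X}
    (hR : IsResolvent T z R) (hν : ν ≠ 0) (hR' : IsResolvent T (z + ν⁻¹) R') :
    IsUnit (algebraMap ℂ (X →L[ℂ] X) ν - R) := by
  have happ : ∀ x, (algebraMap ℂ (X →L[ℂ] X) ν - R) x = ν • x - R x := fun x => by
    simp [Algebra.algebraMap_eq_smul_one]
  rw [ContinuousLinearMap.isUnit_iff_bijective]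
  constructor
  · rw [injective_iff_map_eq_zero]
    intro x hx
    rw [happ, sub_eq_zero] at hx
    obtain ⟨h, e⟩ := hR.mem_eigenspace hν hx.symm
    have := hR'.2 ⟨x, h⟩
    rw [e, sub_self, map_zero] at this
    exact this.symm
  · intro y
    obtain ⟨h, e⟩ := hR'.1 y
    have h1 : R (y + ν⁻¹ • R' y) = R' y := by
      have h2 := hR.2 ⟨R' y, h⟩
      have h3 : T ⟨R' y, h⟩ - z • R' y = y + ν⁻¹ • R' y := by
        rw [add_smul, ← sub_sub] at e
        exact sub_eq_iff_eq_add.1 e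
      rwa [h3] at h2
    refine ⟨ν⁻¹ • (y + ν⁻¹ • R' y), ?_⟩
    rw [happ, map_smul, h1, smul_smul, mul_inv_cancel₀ hν]
    module

/-- A bounded self-adjoint operator is bounded below, off the kernel of `R - μ`, at an isolated
point `μ` of its spectrum. With `g(x) = (x - μ)⁻¹` and `g(μ) = 0`, which is continuous on the
spectrum, `1 - g(R) (R - μ)` maps into that kernel. -/
theorem exists_leftInverse_of_isolated {R : X →L[ℂ] X} (hR : IsSelfAdjoint R) {μ : ℝ}
    (hiso : ∀ᶠ x in 𝓝 μ, x ∈ _root_.spectrum ℝ R → x = μ) :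
    ∃ S : X →L[ℂ] X, ∀ w : X, (∀ p, R p = (μ : ℂ) • p → ⟪p, w⟫_ℂ = 0) →
      w = S (R w - (μ : ℂ) • w) := by
  have hcont : ContinuousOn (fun x : ℝ => (x - μ)⁻¹) (_root_.spectrum ℝ R) := by
    intro x hx
    rcases eq_or_ne x μ with rfl | hne
    · refine (continuousWithinAt_const (b := ((x - x)⁻¹ : ℝ))).congr_of_eventuallyEq ?_ rfl
      filter_upwards [nhdsWithin_le_nhds hiso, self_mem_nhdsWithin] with y hy hys
      rw [hy hys]
    · exact ((continuousAt_id.sub continuousAt_const).inv₀ (sub_ne_zero.2 hne)).continuousWithinAt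
  have hcl : ContinuousOn (fun x : ℝ => x - μ) (_root_.spectrum ℝ R) := by fun_prop
  have hRμ : cfc (fun x : ℝ => x - μ) R = R - algebraMap ℝ (X →L[ℂ] X) μ := by
    rw [cfc_sub (R := ℝ) (fun x => x) (fun _ => μ) R, cfc_id' ℝ R, cfc_const μ R]
  set S := cfc (fun x : ℝ => (x - μ)⁻¹) R with hS
  set P : X →L[ℂ] X := 1 - S * (R - algebraMap ℝ (X →L[ℂ] X) μ) with hP
  have hPf : P = cfc (fun x : ℝ => 1 - (x - μ)⁻¹ * (x - μ)) R := by
    rw [cfc_sub (R := ℝ) (fun x => 1) (fun x => (x - μ)⁻¹ * (x - μ)) R continuousOn_const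
      (hcont.mul hcl), cfc_const_one ℝ R, cfc_mul _ _ R hcont hcl, hRμ]
  have hPsa : IsSelfAdjoint P := by rw [hPf]; exact cfc_predicate _ _
  have hRP : (R - algebraMap ℝ (X →L[ℂ] X) μ) * P = 0 := by
    rw [hPf, ← hRμ, ← cfc_mul (R := ℝ) (fun x => x - μ)
      (fun x => 1 - (x - μ)⁻¹ * (x - μ)) R hcl (continuousOn_const.sub (hcont.mul hcl))]
    have : (fun x : ℝ => (x - μ) * (1 - (x - μ)⁻¹ * (x - μ))) = fun _ => 0 := by
      funext x
      rcases eq_or_ne x μ with rfl | hne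
      · simp
      · rw [inv_mul_cancel₀ (sub_ne_zero.2 hne)]; simp
    rw [this, cfc_const_zero]
  have happ : ∀ x, (R - algebraMap ℝ (X →L[ℂ] X) μ) x = R x - (μ : ℂ) • x := fun x => by
    simp [Algebra.algebraMap_eq_smul_one]
  refine ⟨S, fun w hw => ?_⟩
  have hker : ∀ x, R (P x) = (μ : ℂ) • P x := fun x => by
    have := congrArg (fun A : X →L[ℂ] X => A x) hRP
    change (R - algebraMap ℝ (X →L[ℂ] X) μ) (P x) = 0 at this
    rwa [happ, sub_eq_zero] at this
  have hPw : P w = 0 := by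
    rw [← inner_self_eq_zero (𝕜 := ℂ)]
    have h1 := (ContinuousLinearMap.isSelfAdjoint_iff_isSymmetric.1 hPsa) (P w) w
    change ⟪P (P w), w⟫_ℂ = ⟪P w, P w⟫_ℂ at h1
    rw [← h1]
    exact hw _ (hker _)
  have : P w = w - S (R w - (μ : ℂ) • w) := by
    rw [← happ]; rfl
  rw [hPw] at this
  exact (sub_eq_zero.1 this.symm)

/-- A symmetric operator has a gap at an isolated point of its spectrum. The statement for bounded
operators is applied to the resolvent at the real point `E + ε / 2`. -/
theorem IsSymm.exists_hasGap {T : X →ₗ.[ℂ] X} (hT : IsSymm T) {E : ℝ}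
    (hE : ∃ ε > 0, ∀ z ∈ spectrum T, ‖z - E‖ < ε → z = E) : ∃ d > 0, HasGap T E d := by
  obtain ⟨ε, hε, hiso⟩ := hE
  have hres : ∀ z : ℂ, ‖z - E‖ < ε → z ≠ E → ∃ R, IsResolvent T z R := by
    intro z hz hne
    by_contra h
    exact hne (hiso z h hz)
  set z₀ : ℝ := E + ε / 2 with hz₀
  obtain ⟨R, hR⟩ := hres z₀ (by
      rw [← Complex.ofReal_sub, Complex.norm_real, Real.norm_eq_abs, abs_lt]
      constructor <;> linarith)
    (by rw [Ne, Complex.ofReal_inj]; linarith)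
  set μ : ℝ := -(2 / ε) with hμ
  have hμ0 : μ < 0 := by rw [hμ, neg_lt_zero]; positivity
  have hμi : μ⁻¹ = -(ε / 2) := by rw [hμ, inv_neg, inv_div]
  have hE' : (z₀ : ℂ) + (μ : ℂ)⁻¹ = E := by
    rw [← Complex.ofReal_inv, hμi, ← Complex.ofReal_add, hz₀]; congr 1; ring
  have hsa : IsSelfAdjoint R :=
    ContinuousLinearMap.isSelfAdjoint_iff_isSymmetric.2 (hT.isSymmetric_resolvent hR)
  have hisoR : ∀ᶠ x in 𝓝 μ, x ∈ _root_.spectrum ℝ R → x = μ := by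
    have hc : ContinuousAt (fun x : ℝ => x⁻¹) μ := continuousAt_inv₀ hμ0.ne
    have h1 : ∀ᶠ x : ℝ in 𝓝 μ, x⁻¹ ∈ Ioo (-ε) 0 := by
      refine hc.eventually (Ioo_mem_nhds ?_ ?_) <;> dsimp only <;> rw [hμi] <;> linarith
    filter_upwards [h1] with x hx hxs
    by_contra hne
    have hx0 : x ≠ 0 := by rintro rfl; simp at hx
    refine (_root_.spectrum.mem_iff.1 hxs) ?_
    obtain ⟨R', hR'⟩ := hres (z₀ + (x : ℂ)⁻¹) (by
      rw [← Complex.ofReal_inv, ← Complex.ofReal_add, ← Complex.ofReal_sub, Complex.norm_real,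
        Real.norm_eq_abs, abs_lt]
      constructor <;> linarith [hx.1, hx.2])
      (by
        rw [← hE', Ne, add_right_inj, inv_inj, Complex.ofReal_inj]
        exact hne)
    rw [IsScalarTower.algebraMap_apply ℝ ℂ (X →L[ℂ] X)]
    exact hR.isUnit_algebraMap_sub (ν := (x : ℂ)) (by exact_mod_cast hx0) hR'
  obtain ⟨S, hS⟩ := exists_leftInverse_of_isolated hsa hisoR
  set C := ‖S‖ * (|μ| * ‖R‖) with hC
  have hC0 : 0 ≤ C := by positivity
  refine ⟨(C + 1)⁻¹, by positivity, fun w hw => ?_⟩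
  have h1 := hS w fun p hp => hw p (by
    have := hR.mem_eigenspace (by exact_mod_cast hμ0.ne) hp
    rwa [hE'] at this)
  have h2 : R w - (μ : ℂ) • (w : X) = (-(μ : ℂ)) • R (shift T E w) := by
    have h3 := hR.2 w
    have h4 : T w - (z₀ : ℂ) • (w : X) = shift T E w + (μ : ℂ)⁻¹ • (w : X) := by
      rw [shift_apply, ← hE']; module
    rw [h4, map_add, map_smul] at h3
    have hμC : (μ : ℂ) ≠ 0 := by exact_mod_cast hμ0.ne
    nth_rw 2 [← h3]
    rw [smul_add, smul_smul, mul_inv_cancel₀ hμC]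
    module
  rw [h2] at h1
  have h5 : ‖(w : X)‖ ≤ C * ‖shift T E w‖ := by
    calc ‖(w : X)‖ = ‖S ((-(μ : ℂ)) • R (shift T E w))‖ := by rw [← h1]
      _ ≤ ‖S‖ * ‖(-(μ : ℂ)) • R (shift T E w)‖ := S.le_opNorm _
      _ = ‖S‖ * (|μ| * ‖R (shift T E w)‖) := by
        rw [norm_smul, norm_neg, Complex.norm_real, Real.norm_eq_abs]
      _ ≤ ‖S‖ * (|μ| * (‖R‖ * ‖shift T E w‖)) := by gcongr; exact R.le_opNorm _
      _ = _ := by rw [hC]; ring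
  rw [inv_mul_le_iff₀ (by positivity)]
  nlinarith [norm_nonneg (shift T E w)]

end Gap

/-! ### Polynomials times a Gaussian on the half-line -/

section PolyGauss

open Polynomial

/-- The function `p(x) e^{-x²/2}`. -/
def polyGauss (p : ℝ[X]) (x : ℝ) : ℝ := p.eval x * Real.exp (-x ^ 2 / 2)

/-- `D p = p' - x p`, the polynomial factor of the derivative of `p(x) e^{-x²/2}`. -/
def gaussDeriv (p : ℝ[X]) : ℝ[X] := derivative p - X * p

theorem hasDerivAt_polyGauss (p : ℝ[X]) (x : ℝ) :
    HasDerivAt (polyGauss p) (polyGauss (gaussDeriv p) x) x := by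
  have h2 : HasDerivAt (fun x : ℝ => Real.exp (-x ^ 2 / 2))
      (Real.exp (-x ^ 2 / 2) * (-(2 * x) / 2)) x := by
    have := (((hasDerivAt_pow 2 x).neg).div_const 2).exp
    simpa using this
  refine ((p.hasDerivAt x).mul h2).congr_deriv ?_
  simp only [polyGauss, gaussDeriv, eval_sub, eval_mul, eval_X]
  ring

theorem contDiff_polyGauss (p : ℝ[X]) : ContDiff ℝ ∞ (polyGauss p) := by
  unfold polyGauss
  have h : ContDiff ℝ ∞ fun x : ℝ => p.eval x := by simpa using p.contDiff_aeval (𝕜 := ℝ) ∞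
  fun_prop

theorem continuous_polyGauss (p : ℝ[X]) : Continuous (polyGauss p) :=
  (contDiff_polyGauss p).continuous

theorem memLp_polyGauss (p : ℝ[X]) : MemLp (fun x => (polyGauss p x : ℂ)) 2 halfLine :=
  ((memLp_poly_gaussian p).restrict (Ioi 0)).ofReal (K := ℂ)

/-- `p(x) e^{-x²/2}` as an element of `L²(0, ∞)`. -/
def polyVec (p : ℝ[X]) : L2 := (memLp_polyGauss p).toLp _

theorem coeFn_polyVec (p : ℝ[X]) : polyVec p =ᵐ[halfLine] fun x => (polyGauss p x : ℂ) :=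
  (memLp_polyGauss p).coeFn_toLp

/-- `∫₀^∞ p(x) e^{-x²} dx`. -/
def gaussIntegral (p : ℝ[X]) : ℝ := ∫ x in Ioi 0, p.eval x * Real.exp (-x ^ 2)

theorem integrable_poly_mul_exp (p : ℝ[X]) :
    Integrable (fun x : ℝ => p.eval x * Real.exp (-x ^ 2)) := by
  induction p using Polynomial.induction_on' with
  | add p q hp hq => exact (hp.add hq).congr (Eventually.of_forall fun x => by simp [add_mul])
  | monomial n a =>
    have h := (integrable_rpow_mul_exp_neg_mul_sq (b := 1) one_pos (s := (n : ℝ))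
      (by have : (0 : ℝ) ≤ n := Nat.cast_nonneg _
          linarith)).const_mul a
    refine h.congr (Eventually.of_forall fun x => ?_)
    simp [mul_assoc]

theorem tendsto_poly_mul_exp (p : ℝ[X]) :
    Tendsto (fun x : ℝ => p.eval x * Real.exp (-x ^ 2)) atTop (𝓝 0) := by
  induction p using Polynomial.induction_on' with
  | add p q hp hq => simpa [add_mul] using hp.add hq
  | monomial n a =>
    have h := ((rpow_mul_exp_neg_mul_sq_isLittleO_exp_neg one_pos (n : ℝ)).trans_tendsto
      (Real.tendsto_exp_neg_atTop_nhds_zero.comp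
        (tendsto_id.const_mul_atTop (by norm_num : (0 : ℝ) < 1 / 2)) |>.congr
          fun x => by simp [neg_mul])).const_mul a
    rw [mul_zero] at h
    refine h.congr fun x => ?_
    simp [mul_assoc]

theorem gaussIntegral_add (p q : ℝ[X]) :
    gaussIntegral (p + q) = gaussIntegral p + gaussIntegral q := by
  simp only [gaussIntegral, eval_add, add_mul]
  exact integral_add (integrable_poly_mul_exp p).integrableOn
    (integrable_poly_mul_exp q).integrableOn

theorem gaussIntegral_C_mul (a : ℝ) (p : ℝ[X]) :
    gaussIntegral (C a * p) = a * gaussIntegral p := by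
  simp only [gaussIntegral, eval_mul, eval_C, mul_assoc]
  exact integral_const_mul _ _

theorem gaussIntegral_mono {p q : ℝ[X]} (h : ∀ x, p.eval x ≤ q.eval x) :
    gaussIntegral p ≤ gaussIntegral q := by
  refine integral_mono (integrable_poly_mul_exp p).integrableOn
    (integrable_poly_mul_exp q).integrableOn fun x => ?_
  exact mul_le_mul_of_nonneg_right (h x) (Real.exp_pos _).le

/-- Integration by parts: the derivative of `p(x) e^{-x²}` integrates to zero if `p(0) = 0`. -/
theorem gaussIntegral_derivative (p : ℝ[X]) (hp : p.eval 0 = 0) :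
    gaussIntegral (derivative p - 2 * X * p) = 0 := by
  have hd : ∀ x ∈ Ici (0 : ℝ), HasDerivAt (fun x => p.eval x * Real.exp (-x ^ 2))
      ((derivative p - 2 * X * p).eval x * Real.exp (-x ^ 2)) x := by
    intro x _
    have h2 : HasDerivAt (fun x : ℝ => Real.exp (-x ^ 2)) (Real.exp (-x ^ 2) * (-(2 * x))) x := by
      have := ((hasDerivAt_pow 2 x).neg).exp
      simpa using this
    refine ((p.hasDerivAt x).mul h2).congr_deriv ?_
    simp
    ring
  have := integral_Ioi_of_hasDerivAt_of_tendsto' hd (integrable_poly_mul_exp _).integrableOn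
    (tendsto_poly_mul_exp p)
  rw [gaussIntegral, this, hp]
  simp

theorem inner_polyVec (p q : ℝ[X]) : ⟪polyVec p, polyVec q⟫_ℂ = (gaussIntegral (p * q) : ℂ) := by
  rw [L2.inner_def, gaussIntegral, ← integral_complex_ofReal]
  refine integral_congr_ae ?_
  filter_upwards [coeFn_polyVec p, coeFn_polyVec q] with x hx hy
  rw [hx, hy]
  have e : Real.exp (-x ^ 2) = Real.exp (-x ^ 2 / 2) * Real.exp (-x ^ 2 / 2) := by
    rw [← Real.exp_add]; congr 1; ring
  simp only [RCLike.inner_apply, Complex.conj_ofReal, ← Complex.ofReal_mul, polyGauss, eval_mul, e]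
  congr 1
  ring

theorem norm_polyVec_sq (p : ℝ[X]) : ‖polyVec p‖ ^ 2 = gaussIntegral (p * p) := by
  have h : (‖polyVec p‖ : ℂ) ^ 2 = gaussIntegral (p * p) :=
    (inner_self_eq_norm_sq_to_K _).symm.trans (inner_polyVec p p)
  exact_mod_cast h

theorem polyVec_add (p q : ℝ[X]) : polyVec (p + q) = polyVec p + polyVec q := by
  rw [polyVec, polyVec, polyVec, ← MemLp.toLp_add]
  congr 1
  funext x
  simp [polyGauss, add_mul]

theorem polyVec_C_mul (a : ℝ) (p : ℝ[X]) : polyVec (C a * p) = (a : ℂ) • polyVec p := by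
  rw [polyVec, polyVec, ← MemLp.toLp_const_smul]
  congr 1
  funext x
  simp [polyGauss, mul_assoc]

theorem polyVec_ne_zero {p : ℝ[X]} (hp : p ≠ 0) : polyVec p ≠ 0 := by
  intro h
  have h1 : (fun x => (polyGauss p x : ℂ)) =ᵐ[volume.restrict (Ioi 0)] 0 :=
    (coeFn_polyVec p).symm.trans (h ▸ Lp.coeFn_zero _ _ _)
  have h2 : EqOn (fun x => (polyGauss p x : ℂ)) 0 (Ioi 0) :=
    Measure.eqOn_open_of_ae_eq h1 isOpen_Ioi
      (Complex.continuous_ofReal.comp (continuous_polyGauss p)).continuousOn continuousOn_const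
  refine hp (Polynomial.eq_zero_of_infinite_isRoot p ((Ioi_infinite (0 : ℝ)).mono fun x hx => ?_))
  have h3 : (polyGauss p x : ℂ) = 0 := h2 hx
  have h4 : polyGauss p x = 0 := by exact_mod_cast h3
  exact (mul_eq_zero.1 h4).resolve_right (Real.exp_pos _).ne'

/-- Hardy's inequality `‖u / r‖ ≤ 2 ‖u'‖` for `u = r s(r) e^{-r²/2}`. -/
theorem norm_polyVec_le_of_X_mul (s : ℝ[X]) :
    ‖polyVec s‖ ≤ 2 * ‖polyVec (gaussDeriv (X * s))‖ := by
  have h := gaussIntegral_derivative (X * (s * s)) (by simp)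
  set b := gaussDeriv (X * s) with hb
  have e : derivative (X * (s * s)) - 2 * X * (X * (s * s)) = C (-1) * (s * s) + C 2 * (s * b) := by
    simp only [hb, gaussDeriv, derivative_mul, derivative_X, map_neg, map_one, map_ofNat]
    ring
  have h2 : gaussIntegral (C 2 * (s * b)) ≤
      gaussIntegral (C (1 / 2) * (s * s) + C 2 * (b * b)) := by
    refine gaussIntegral_mono fun x => ?_
    simp only [eval_mul, eval_C, eval_add]
    nlinarith [sq_nonneg (s.eval x - 2 * b.eval x)]
  rw [e, gaussIntegral_add, gaussIntegral_C_mul, gaussIntegral_C_mul] at h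
  rw [gaussIntegral_add, gaussIntegral_C_mul, gaussIntegral_C_mul, gaussIntegral_C_mul] at h2
  refine abs_le_of_sq_le_sq' ?_ (by positivity) |>.2
  rw [mul_pow, norm_polyVec_sq, norm_polyVec_sq]
  linarith

end PolyGauss

/-! ### Hermite polynomials and the oscillator -/

section Hermite

open Polynomial

/-- The Hermite polynomials of the weight `e^{-x²}`. -/
def hermitePoly : ℕ → ℝ[X]
  | 0 => 1
  | n + 1 => 2 * X * hermitePoly n - derivative (hermitePoly n)

theorem hermiteH_eq (n : ℕ) (x : ℝ) : hermiteH n x = (hermitePoly n).eval x := by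
  have h : ∀ n, iteratedDeriv n (fun y : ℝ => Real.exp (-y ^ 2)) =
      fun x => (-1) ^ n * (hermitePoly n).eval x * Real.exp (-x ^ 2) := by
    intro n
    induction n with
    | zero => ext x; simp [hermitePoly]
    | succ n ih =>
      rw [iteratedDeriv_succ, ih]
      ext x
      have h2 : HasDerivAt (fun x : ℝ => Real.exp (-x ^ 2))
          (Real.exp (-x ^ 2) * (-(2 * x))) x := by
        have := ((hasDerivAt_pow 2 x).neg).exp
        simpa using this
      refine ((((hermitePoly n).hasDerivAt x).const_mul _).mul h2).deriv.trans ?_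
      simp [hermitePoly, pow_succ]
      ring
  have e : Real.exp (x ^ 2) * Real.exp (-x ^ 2) = 1 := by
    rw [← Real.exp_add]; simp
  have e2 : ((-1 : ℝ) ^ n) * (-1) ^ n = 1 := by rw [← mul_pow]; simp
  rw [hermiteH, h]
  linear_combination ((-1 : ℝ) ^ n) * (-1) ^ n * (hermitePoly n).eval x * e +
    (hermitePoly n).eval x * e2

theorem derivative_hermitePoly (n : ℕ) :
    derivative (hermitePoly (n + 1)) = C (2 * (n + 1) : ℝ) * hermitePoly n := by
  induction n with
  | zero => simp [hermitePoly, C_ofNat]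
  | succ m ih =>
    have e : hermitePoly (m + 1 + 1) =
        2 * X * hermitePoly (m + 1) - C (2 * (m + 1) : ℝ) * hermitePoly m := by
      rw [← ih]; rfl
    have e' : hermitePoly (m + 1) = 2 * X * hermitePoly m - derivative (hermitePoly m) := rfl
    have d2 : derivative (2 : ℝ[X]) = 0 := derivative_ofNat 2
    rw [e, derivative_sub, derivative_mul, derivative_mul, derivative_C_mul, ih, derivative_X, d2]
    simp only [map_mul, map_add, map_one, map_ofNat, map_natCast]
    push_cast
    linear_combination (-2 * ((m : ℝ[X]) + 1)) * e'

/-- Hermite's differential equation. -/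
theorem hermitePoly_ode (n : ℕ) :
    derivative (derivative (hermitePoly n)) =
      2 * X * derivative (hermitePoly n) - C (2 * n : ℝ) * hermitePoly n := by
  have h := derivative_hermitePoly n
  have d2 : derivative (2 : ℝ[X]) = 0 := derivative_ofNat 2
  rw [show hermitePoly (n + 1) = 2 * X * hermitePoly n - derivative (hermitePoly n) from rfl,
    derivative_sub, derivative_mul, derivative_mul, derivative_X, d2] at h
  simp only [map_mul, map_add, map_one, map_ofNat, map_natCast] at h ⊢
  linear_combination -h

theorem gaussDeriv_gaussDeriv_hermitePoly (n : ℕ) :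
    gaussDeriv (gaussDeriv (hermitePoly n)) = (X ^ 2 - C (2 * n + 1 : ℝ)) * hermitePoly n := by
  have h := hermitePoly_ode n
  simp only [gaussDeriv, derivative_sub, derivative_mul, derivative_X, h]
  simp only [map_mul, map_add, map_one, map_ofNat, map_natCast]
  ring

theorem two_X_mul_hermitePoly (n : ℕ) :
    2 * X * hermitePoly (n + 1) = hermitePoly (n + 2) + C (2 * (n + 1) : ℝ) * hermitePoly n := by
  rw [← derivative_hermitePoly]
  simp [hermitePoly]

theorem hermitePoly_eval_zero (k : ℕ) : (hermitePoly (2 * k + 1)).eval 0 = 0 := by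
  induction k with
  | zero => simp [hermitePoly]
  | succ k ih =>
    have h := congrArg (eval 0) (two_X_mul_hermitePoly (2 * k + 1))
    simp only [eval_mul, eval_X, eval_add, ih, mul_zero, zero_mul, add_zero] at h
    exact h.symm

theorem hermitePoly_ne_zero (n : ℕ) : hermitePoly n ≠ 0 := by
  induction n with
  | zero => simp [hermitePoly]
  | succ n ih =>
    intro h
    have := derivative_hermitePoly n
    rw [h, derivative_zero, eq_comm, mul_eq_zero] at this
    refine this.elim (fun h => ?_) ih
    rw [C_eq_zero] at h
    linarith [(n.cast_nonneg : (0 : ℝ) ≤ n)]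

theorem hermiteNorm_pos (n : ℕ) : 0 < hermiteNorm n :=
  Real.sqrt_pos.2 (by positivity)

theorem hermiteVec_eq (k : ℕ) : hermiteVec k =
    (((hermiteNorm (2 * k + 1))⁻¹ : ℝ) : ℂ) • polyVec (hermitePoly (2 * k + 1)) := by
  rw [hermiteVec, polyVec, ← MemLp.toLp_const_smul]
  congr 1
  funext x
  simp [oddHermite, polyGauss, hermiteH_eq, mul_assoc]

/-- `p(r) e^{-r²/2}`, with `p` the Hermite polynomial of degree `2k+1`, is an eigenvector of the
Dirichlet oscillator. -/
theorem polyVec_mem_eigenspace (k : ℕ) :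
    polyVec (hermitePoly (2 * k + 1)) ∈ eigenspace oscillator ((4 * k + 3 : ℝ) : ℂ) := by
  set p := hermitePoly (2 * k + 1) with hp
  set Λ : ℝ := 4 * k + 3 with hΛ
  have hode : ∀ x, polyGauss (gaussDeriv (gaussDeriv p)) x = (x ^ 2 - Λ) * polyGauss p x := by
    intro x
    rw [hp, gaussDeriv_gaussDeriv_hermitePoly, ← hp]
    simp only [polyGauss, eval_mul, eval_sub, eval_pow, eval_X, eval_C, hΛ]
    push_cast
    ring
  have hcont : ∀ s : ℝ[X], Continuous fun x => (polyGauss s x : ℂ) := fun s =>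
    Complex.continuous_ofReal.comp (continuous_polyGauss s)
  have hftc : ∀ (s : ℝ[X]) (r : ℝ), ∫ x in (0 : ℝ)..r, (polyGauss (gaussDeriv s) x : ℂ) =
      polyGauss s r - polyGauss s 0 := fun s r =>
    intervalIntegral.integral_eq_sub_of_hasDerivAt
      (f := fun x => (polyGauss s x : ℂ)) (fun x _ => (hasDerivAt_polyGauss s x).ofReal_comp)
      ((hcont _).intervalIntegrable _ _)
  have hgraph : (polyVec p, (Λ : ℂ) • polyVec p) ∈ oscillator.graph := by
    rw [oscillator_graph]
    refine ⟨fun x => polyGauss p x, fun x => polyGauss (gaussDeriv p) x, (hcont _).continuousOn,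
      (hcont _).continuousOn, coeFn_polyVec p, fun r _ => ?_, fun r hr => ?_⟩
    · rw [hftc]
      have : polyGauss p 0 = 0 := by simp [polyGauss, hp, hermitePoly_eval_zero]
      rw [this]; simp
    · have e : ∫ s in (0 : ℝ)..r, ((s : ℂ) ^ 2 * (polyGauss p s : ℂ) -
          (((Λ : ℂ) • polyVec p : L2) : ℝ → ℂ) s) =
          ∫ s in (0 : ℝ)..r, (polyGauss (gaussDeriv (gaussDeriv p)) s : ℂ) := by
        rw [intervalIntegral.integral_of_le hr, intervalIntegral.integral_of_le hr]
        refine integral_congr_ae ?_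
        have hsub : Ioc 0 r ⊆ Ioi 0 := fun x hx => hx.1
        filter_upwards [ae_restrict_of_ae_restrict_of_subset hsub
          (Lp.coeFn_smul (Λ : ℂ) (polyVec p)),
          ae_restrict_of_ae_restrict_of_subset hsub (coeFn_polyVec p)] with s h1 h2
        rw [h1, Pi.smul_apply, h2, hode, smul_eq_mul]
        push_cast
        ring
      rw [e, hftc]
      ring
  obtain ⟨y, hy1, hy2⟩ := (LinearPMap.mem_graph_iff _).1 hgraph
  have hy1' : (y : L2) = polyVec p := hy1
  refine ⟨hy1' ▸ y.2, ?_⟩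
  have : (⟨polyVec p, hy1' ▸ y.2⟩ : oscillator.domain) = y := by ext1; exact hy1'.symm
  rw [this]
  exact hy2

theorem inner_polyVec_hermitePoly {j k : ℕ} (hjk : j ≠ k) :
    ⟪polyVec (hermitePoly (2 * j + 1)), polyVec (hermitePoly (2 * k + 1))⟫_ℂ = 0 := by
  set p := hermitePoly (2 * j + 1) with hp
  set s := hermitePoly (2 * k + 1) with hs
  -- the Wronskian vanishes at both ends
  have h := gaussIntegral_derivative (gaussDeriv p * s - p * gaussDeriv s) (by
    simp [hp, hs, hermitePoly_eval_zero])
  have e : derivative (gaussDeriv p * s - p * gaussDeriv s) -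
      2 * X * (gaussDeriv p * s - p * gaussDeriv s) = C (4 * k - 4 * j : ℝ) * (p * s) := by
    have h1 := gaussDeriv_gaussDeriv_hermitePoly (2 * j + 1)
    have h2 := gaussDeriv_gaussDeriv_hermitePoly (2 * k + 1)
    rw [← hp] at h1
    rw [← hs] at h2
    have d : ∀ t : ℝ[X], derivative t = gaussDeriv t + X * t := fun t => by simp [gaussDeriv]
    rw [derivative_sub, derivative_mul, derivative_mul, d (gaussDeriv p), d (gaussDeriv s), d p,
      d s, h1, h2]
    simp only [map_sub, map_mul, map_add, map_one, map_ofNat, map_natCast]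
    push_cast
    ring
  rw [e, gaussIntegral_C_mul] at h
  have hne : (4 * k - 4 * j : ℝ) ≠ 0 := by
    intro h0
    apply hjk
    have : (j : ℝ) = k := by linarith
    exact_mod_cast this
  rw [inner_polyVec, (mul_eq_zero.1 h).resolve_left hne, Complex.ofReal_zero]

/-- The oscillator energy of an odd Hermite function bounds its derivative. -/
theorem norm_polyVec_gaussDeriv_le (k : ℕ) :
    ‖polyVec (gaussDeriv (hermitePoly (2 * k + 1)))‖ ≤
      √(4 * k + 3) * ‖polyVec (hermitePoly (2 * k + 1))‖ := by
  set p := hermitePoly (2 * k + 1) with hp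
  have h := gaussIntegral_derivative (p * gaussDeriv p) (by simp [hp, hermitePoly_eval_zero])
  have e : derivative (p * gaussDeriv p) - 2 * X * (p * gaussDeriv p) =
      gaussDeriv p * gaussDeriv p + (X ^ 2 - C (4 * k + 3 : ℝ)) * (p * p) := by
    have h1 := gaussDeriv_gaussDeriv_hermitePoly (2 * k + 1)
    rw [← hp] at h1
    have d : ∀ t : ℝ[X], derivative t = gaussDeriv t + X * t := fun t => by simp [gaussDeriv]
    rw [derivative_mul, d (gaussDeriv p), d p, h1]
    simp only [map_mul, map_add, map_one, map_ofNat, map_natCast]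
    push_cast
    ring
  rw [e, gaussIntegral_add] at h
  have h2 : gaussIntegral (C (-(4 * k + 3) : ℝ) * (p * p)) ≤
      gaussIntegral ((X ^ 2 - C (4 * k + 3 : ℝ)) * (p * p)) := by
    refine gaussIntegral_mono fun x => ?_
    simp only [eval_mul, eval_C, eval_sub, eval_pow, eval_X]
    nlinarith [mul_nonneg (sq_nonneg x) (mul_self_nonneg (p.eval x))]
  rw [gaussIntegral_C_mul] at h2
  refine abs_le_of_sq_le_sq' ?_ (by positivity) |>.2
  rw [mul_pow, norm_polyVec_sq, norm_polyVec_sq, Real.sq_sqrt (by positivity)]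
  linarith

end Hermite

/-! ### Completeness of the odd Hermite functions -/

section Completeness

open FourierTransform SchwartzMap in
/-- The Fourier transform is injective on integrable functions. -/
theorem ae_eq_zero_of_fourier_eq_zero {G : ℝ → ℂ} (hG : Integrable G) (h : ∀ w, 𝓕 G w = 0) :
    ∀ᵐ x, G x = 0 := by
  refine ae_eq_zero_of_integral_contDiff_smul_eq_zero hG.locallyIntegrable fun g hg hc => ?_
  have hc' : HasCompactSupport fun x => (g x : ℂ) := hc.comp_left Complex.ofReal_zero
  let gS : 𝓢(ℝ, ℂ) := hc'.toSchwartzMap (Complex.ofRealCLM.contDiff.comp hg)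
  let ψ : 𝓢(ℝ, ℂ) := 𝓕⁻ gS
  have hψ : 𝓕 ψ = gS := FourierTransform.fourier_fourierInv_eq gS
  have key : ∫ ξ, (𝓕 G ξ) • ψ ξ = ∫ x, G x • (𝓕 ψ) x := by
    simpa using! VectorFourier.integral_fourierIntegral_smul_eq_flip (L := innerₗ ℝ)
      Real.continuous_fourierChar continuous_inner hG ψ.integrable
  simp only [h, zero_smul, integral_zero, hψ] at key
  rw [key]
  refine integral_congr_ae (Eventually.of_forall fun x => ?_)
  change g x • G x = G x • (g x : ℂ)
  rw [Complex.real_smul, smul_eq_mul, mul_comm]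

open FourierTransform in
/-- A function with exponential decay of every order is determined by its moments. -/
theorem ae_eq_zero_of_moments_eq_zero {G : ℝ → ℂ} (hm : AEStronglyMeasurable G)
    (hexp : ∀ c : ℝ, Integrable fun x => Real.exp (c * |x|) * ‖G x‖)
    (hmom : ∀ n : ℕ, ∫ x : ℝ, (x : ℂ) ^ n * G x = 0) : ∀ᵐ x, G x = 0 := by
  have hG : Integrable G := by
    have h := hexp 0
    simp only [zero_mul, Real.exp_zero, one_mul] at h
    exact (integrable_norm_iff hm).1 h
  refine ae_eq_zero_of_fourier_eq_zero hG fun w => ?_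
  rw [Real.fourier_real_eq_integral_exp_smul]
  set a : ℂ := -2 * Real.pi * w * Complex.I with ha
  set F : ℕ → ℝ → ℂ := fun n x => (a ^ n / n.factorial) * ((x : ℂ) ^ n * G x) with hF
  set bound : ℕ → ℝ → ℝ := fun n x => (‖a‖ * |x|) ^ n / n.factorial * ‖G x‖ with hbound
  have hsb : ∀ x, HasSum (fun n => bound n x) (Real.exp (‖a‖ * |x|) * ‖G x‖) := fun x => by
    have h := NormedSpace.expSeries_div_hasSum_exp (𝔸 := ℝ) (‖a‖ * |x|)
    rw [← Real.exp_eq_exp_ℝ] at h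
    exact h.mul_right _
  have hsum := hasSum_integral_of_dominated_convergence (μ := volume) (F := F)
    (f := fun x => Complex.exp (↑(-2 * Real.pi * x * w) * Complex.I) • G x) bound
    (fun n => by
      refine AEStronglyMeasurable.const_mul ?_ _
      exact (by fun_prop : Continuous fun x : ℝ => (x : ℂ) ^ n).aestronglyMeasurable.mul hm)
    (fun n => Eventually.of_forall fun x => by
      simp only [hF, hbound, norm_mul, norm_div, norm_pow, Complex.norm_natCast, Complex.norm_real,
        Real.norm_eq_abs, mul_pow]
      apply le_of_eq
      ring)
    (Eventually.of_forall fun x => (hsb x).summable)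
    (by
      refine (hexp ‖a‖).congr (Eventually.of_forall fun x => ?_)
      exact (hsb x).tsum_eq.symm)
    (Eventually.of_forall fun x => by
      have h := NormedSpace.expSeries_div_hasSum_exp (𝔸 := ℂ) (a * x)
      rw [← Complex.exp_eq_exp_ℂ] at h
      have h2 := h.mul_right (G x)
      have e1 : (↑(-2 * Real.pi * x * w) * Complex.I : ℂ) = a * x := by
        rw [ha]; push_cast; ring
      rw [e1, smul_eq_mul]
      refine h2.congr_fun ?_
      intro n
      simp only [hF]
      ring)
  refine hsum.unique ?_
  have h0 : ∀ n, ∫ x, F n x = 0 := fun n => by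
    simp only [hF]
    rw [integral_const_mul, hmom, mul_zero]
  simp only [h0]
  exact hasSum_zero

open Polynomial

theorem inner_polyVec_left (p : ℝ[X]) (f : L2) :
    ⟪polyVec p, f⟫_ℂ = ∫ x in Ioi 0, (polyGauss p x : ℂ) * f x := by
  rw [L2.inner_def]
  refine integral_congr_ae ?_
  filter_upwards [coeFn_polyVec p] with x hx
  rw [hx, RCLike.inner_apply, Complex.conj_ofReal, mul_comm]

/-- The functions `r^{2k+1} e^{-r²/2}` are total in `L²(0, ∞)`: the odd extension of
`f(r) e^{-r²/2}` has vanishing moments of every order. -/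
theorem eq_zero_of_inner_polyVec_X_pow {f : L2}
    (h : ∀ k : ℕ, ⟪polyVec (X ^ (2 * k + 1)), f⟫_ℂ = 0) : f = 0 := by
  set F : ℝ → ℂ := (Ioi 0).indicator fun x => (Real.exp (-x ^ 2 / 2) : ℂ) * f x with hF
  have hFm : AEStronglyMeasurable F := by
    rw [hF, aestronglyMeasurable_indicator_iff measurableSet_Ioi]
    exact (by fun_prop : Continuous fun x : ℝ => (Real.exp (-x ^ 2 / 2) : ℂ)).aestronglyMeasurable.mul
      (Lp.aestronglyMeasurable f)
  have hFexp : ∀ c : ℝ, Integrable fun x => Real.exp (c * |x|) * ‖F x‖ := by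
    intro c
    have hg : MemLp (fun x : ℝ => Real.exp (c * x) * Real.exp (-x ^ 2 / 2)) 2 halfLine := by
      refine MemLp.restrict _ ?_
      rw [memLp_two_iff_integrable_sq_norm (by fun_prop)]
      have h1 := (integrable_exp_neg_mul_sq one_pos).comp_sub_right c |>.const_mul
        (Real.exp (c ^ 2))
      refine h1.congr (Eventually.of_forall fun x => ?_)
      simp only [Real.norm_eq_abs, sq_abs]
      rw [← Real.exp_add, ← Real.exp_add, ← Real.exp_nat_mul]
      congr 1
      push_cast
      ring
    have hi : IntegrableOn (fun x : ℝ => Real.exp (c * x) * Real.exp (-x ^ 2 / 2) * ‖f x‖) (Ioi 0) :=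
      hg.integrable_mul (Lp.memLp f).norm
    have h2 := (integrable_indicator_iff measurableSet_Ioi).2 hi
    refine h2.congr (Eventually.of_forall fun x => ?_)
    by_cases hx : x ∈ Ioi (0 : ℝ)
    · simp only [hF, indicator_of_mem hx, norm_mul, Complex.norm_real, Real.norm_eq_abs,
        Real.abs_exp, abs_of_pos (show (0 : ℝ) < x from hx)]
      ring
    · simp [hF, indicator_of_notMem hx]
  set G : ℝ → ℂ := fun x => F x - F (-x) with hG
  have hneg : MeasurePreserving (fun x : ℝ => -x) volume volume := Measure.measurePreserving_neg _
  have hGm : AEStronglyMeasurable G := hFm.sub (hFm.comp_measurePreserving hneg)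
  have hmomF : ∀ n : ℕ, Integrable fun x : ℝ => (x : ℂ) ^ n * F x := by
    intro n
    have hle : ∀ x : ℝ, ‖(x : ℂ) ^ n * F x‖ ≤ ‖(n.factorial : ℝ) * (Real.exp (1 * |x|) * ‖F x‖)‖ := by
      intro x
      rw [Real.norm_of_nonneg (by positivity), norm_mul, norm_pow, Complex.norm_real,
        Real.norm_eq_abs, one_mul, ← mul_assoc]
      gcongr
      have := Real.pow_div_factorial_le_exp |x| (abs_nonneg x) n
      rwa [div_le_iff₀' (by positivity)] at this
    exact ((hFexp 1).const_mul _).mono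
      ((by fun_prop : Continuous fun x : ℝ => (x : ℂ) ^ n).aestronglyMeasurable.mul hFm)
      (Eventually.of_forall hle)
  have hG0 : ∀ᵐ x, G x = 0 := by
    refine ae_eq_zero_of_moments_eq_zero hGm (fun c => ?_) fun n => ?_
    · have h1 := hFexp c
      have h2 := h1.comp_neg
      refine (h1.add h2).mono' ((by fun_prop : Continuous fun x : ℝ =>
        Real.exp (c * |x|)).aestronglyMeasurable.mul hGm.norm) (Eventually.of_forall fun x => ?_)
      rw [Real.norm_of_nonneg (by positivity)]
      simp only [Pi.add_apply, abs_neg]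
      rw [← mul_add]
      gcongr
      exact norm_sub_le _ _
    · have e : ∀ x : ℝ, (x : ℂ) ^ n * G x =
          (x : ℂ) ^ n * F x - (-1) ^ n * (((-x : ℝ) : ℂ) ^ n * F (-x)) := by
        intro x
        have : ((-x : ℝ) : ℂ) ^ n = (-1) ^ n * (x : ℂ) ^ n := by
          rw [← mul_pow]; simp
        have e2 : ((-1 : ℂ) ^ n) * (-1) ^ n = 1 := by rw [← mul_pow]; simp
        rw [this, hG]
        linear_combination (x : ℂ) ^ n * F (-x) * e2
      simp only [e]
      rw [integral_sub (hmomF n) ((hmomF n).comp_neg.const_mul _), integral_const_mul,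
        integral_neg_eq_self (fun x : ℝ => (x : ℂ) ^ n * F x)]
      rcases Nat.even_or_odd n with hn | ⟨k, rfl⟩
      · rw [hn.neg_one_pow]; ring
      · have h0 : ∫ x : ℝ, (x : ℂ) ^ (2 * k + 1) * F x = 0 := by
          have h1 := h k
          rw [inner_polyVec_left] at h1
          rw [← h1, ← integral_indicator measurableSet_Ioi]
          refine integral_congr_ae (Eventually.of_forall fun x => ?_)
          by_cases hx : x ∈ Ioi (0 : ℝ)
          · simp only [hF, indicator_of_mem hx, polyGauss, eval_pow, eval_X]
            push_cast
            ring
          · simp [hF, indicator_of_notMem hx]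
        rw [h0]; ring
  refine Lp.ext (EventuallyEq.trans ?_ (Lp.coeFn_zero ℂ 2 halfLine).symm)
  refine (ae_restrict_iff' measurableSet_Ioi).2 ?_
  filter_upwards [hG0] with x hx hx0
  have hx1 : -x ∉ Ioi (0 : ℝ) := fun h' => by
    simp only [mem_Ioi] at h' hx0; linarith
  simp only [hG, hF, indicator_of_mem hx0, indicator_of_notMem hx1, sub_zero, mul_eq_zero,
    Complex.ofReal_eq_zero] at hx
  exact hx.resolve_left (Real.exp_pos _).ne'

/-- The odd Hermite functions are total in `L²(0, ∞)`, since the odd Hermite polynomials span the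
odd powers. -/
theorem eq_zero_of_inner_hermite {f : L2}
    (h : ∀ k : ℕ, ⟪polyVec (hermitePoly (2 * k + 1)), f⟫_ℂ = 0) : f = 0 := by
  have hadd : ∀ {p s : ℝ[X]}, ⟪polyVec p, f⟫_ℂ = 0 → ⟪polyVec s, f⟫_ℂ = 0 →
      ⟪polyVec (p + s), f⟫_ℂ = 0 := fun hp hs => by
    rw [polyVec_add, inner_add_left, hp, hs, add_zero]
  have hmul : ∀ {p : ℝ[X]} (a : ℝ), ⟪polyVec p, f⟫_ℂ = 0 → ⟪polyVec (C a * p), f⟫_ℂ = 0 :=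
    fun a hp => by rw [polyVec_C_mul, inner_smul_left, hp, mul_zero]
  let S : Submodule ℝ ℝ[X] := Submodule.span ℝ (range fun k : ℕ => hermitePoly (2 * k + 1))
  have hS : ∀ p ∈ S, ⟪polyVec p, f⟫_ℂ = 0 := by
    intro p hp
    induction hp using Submodule.span_induction with
    | mem p hp => obtain ⟨k, rfl⟩ := hp; exact h k
    | zero => simpa using hmul 0 (h 0)
    | add p s _ _ hp hs => exact hadd hp hs
    | smul a p _ hp => rw [smul_eq_C_mul]; exact hmul a hp
  have hH : ∀ k, hermitePoly (2 * k + 1) ∈ S := fun k => Submodule.subset_span ⟨k, rfl⟩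
  -- the span of the odd Hermite polynomials is invariant under multiplication by `x²`
  have hX : ∀ p ∈ S, X ^ 2 * p ∈ S := by
    intro p hp
    induction hp using Submodule.span_induction with
    | zero => simp
    | add p s _ _ hp hs => rw [mul_add]; exact S.add_mem hp hs
    | smul a p _ hp => rw [mul_smul_comm]; exact S.smul_mem a hp
    | mem p hp =>
      obtain ⟨k, rfl⟩ := hp
      have quarter : ∀ s : ℝ[X], 4 * X ^ 2 * s ∈ S → X ^ 2 * s ∈ S := fun s hs => by
        have := S.smul_mem (1 / 4 : ℝ) hs
        rwa [smul_eq_C_mul, show C (1 / 4 : ℝ) * (4 * X ^ 2 * s) = X ^ 2 * s by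
          have : C (1 / 4 : ℝ) * 4 = 1 := by
            rw [← C_ofNat, ← C_mul, ← C_1]; norm_num
          linear_combination X ^ 2 * s * this] at this
      apply quarter
      dsimp only
      rcases k with _ | k
      · have e1 := two_X_mul_hermitePoly 1
        have e2 := two_X_mul_hermitePoly 0
        have : (4 * X ^ 2 * hermitePoly (2 * 0 + 1) : ℝ[X]) =
            hermitePoly (2 * 1 + 1) + C (6 : ℝ) * hermitePoly (2 * 0 + 1) := by
          have e3 : hermitePoly 1 = 2 * X * hermitePoly 0 := by simp [hermitePoly]
          simp only [map_mul, map_add, map_one, map_ofNat, map_natCast] at e1 e2 ⊢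
          push_cast at e1 e2
          linear_combination e1 + 2 * X * e2 - 2 * e3
        rw [this, ← smul_eq_C_mul]
        exact S.add_mem (hH 1) (S.smul_mem _ (hH 0))
      · have e1 := two_X_mul_hermitePoly (2 * (k + 1) + 1)
        have e2 := two_X_mul_hermitePoly (2 * (k + 1))
        have e3 := two_X_mul_hermitePoly (2 * k + 1)
        have : (4 * X ^ 2 * hermitePoly (2 * (k + 1) + 1) : ℝ[X]) =
            hermitePoly (2 * (k + 2) + 1) + C (2 * (4 * k + 7) : ℝ) * hermitePoly (2 * (k + 1) + 1) +
              C (4 * (2 * k + 3) * (2 * k + 2) : ℝ) * hermitePoly (2 * k + 1) := by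
          have i1 : 2 * (k + 1) + 1 + 1 = 2 * (k + 1) + 2 := rfl
          have i2 : 2 * (k + 1) + 1 + 2 = 2 * (k + 2) + 1 := by ring
          have i3 : 2 * k + 1 + 1 = 2 * (k + 1) := by ring
          have i4 : 2 * k + 1 + 2 = 2 * (k + 1) + 1 := by ring
          rw [i2, i1] at e1
          rw [i3, i4] at e3
          simp only [map_mul, map_add, map_one, map_ofNat, map_natCast] at e1 e2 e3 ⊢
          push_cast at e1 e2 e3
          linear_combination e1 + 2 * X * e2 + 2 * (2 * (k : ℝ[X]) + 3) * e3
        rw [this, ← smul_eq_C_mul, ← smul_eq_C_mul]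
        exact S.add_mem (S.add_mem (hH _) (S.smul_mem _ (hH _))) (S.smul_mem _ (hH _))
  have hXk : ∀ k : ℕ, (X ^ (2 * k + 1) : ℝ[X]) ∈ S := by
    intro k
    induction k with
    | zero =>
      have : (X ^ (2 * 0 + 1) : ℝ[X]) = (1 / 2 : ℝ) • hermitePoly (2 * 0 + 1) := by
        rw [smul_eq_C_mul]
        have : C (1 / 2 : ℝ) * 2 = 1 := by
          rw [← C_ofNat, ← C_mul, ← C_1]; norm_num
        simp only [hermitePoly, derivative_one]
        linear_combination -X * this
      rw [this]
      exact S.smul_mem _ (hH 0)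
    | succ k ih =>
      have := hX _ ih
      rwa [← pow_add, show 2 + (2 * k + 1) = 2 * (k + 1) + 1 by ring] at this
  exact eq_zero_of_inner_polyVec_X_pow fun k => hS _ (hXk k)

end Completeness

/-! ### Functions in the domain of the radial Dirac operator -/

section DiracDomain

theorem deriv_smoothTransition_eq_zero {y : ℝ} (hy : y ∉ Icc (0 : ℝ) 1) :
    deriv Real.smoothTransition y = 0 := by
  rw [mem_Icc, not_and_or, not_le, not_le] at hy
  rcases hy with hy | hy
  · have : Real.smoothTransition =ᶠ[𝓝 y] fun _ => 0 := by
      filter_upwards [Iio_mem_nhds hy] with x hx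
      exact Real.smoothTransition.zero_of_nonpos (le_of_lt hx)
    rw [this.deriv_eq, deriv_const]
  · have : Real.smoothTransition =ᶠ[𝓝 y] fun _ => 1 := by
      filter_upwards [Ioi_mem_nhds hy] with x hx
      exact Real.smoothTransition.one_of_one_le (le_of_lt hx)
    rw [this.deriv_eq, deriv_const]

/-- Smooth cutoffs `ζ n` exhausting `(0, ∞)`, with the scale invariant bound `r |ζ'(r)| ≤ C`. -/
theorem exists_cutoff : ∃ (ζ : ℕ → ℝ → ℝ) (C : ℝ), 0 ≤ C ∧
    (∀ n, ContDiff ℝ ∞ (ζ n) ∧ HasCompactSupport (ζ n) ∧ tsupport (ζ n) ⊆ Ioi 0) ∧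
    (∀ n r, |ζ n r| ≤ 1) ∧ (∀ n, ∀ r > 0, r * |deriv (ζ n) r| ≤ C) ∧
    ∀ r > 0, ∀ᶠ n in atTop, ζ n =ᶠ[𝓝 r] fun _ => 1 := by
  set S := Real.smoothTransition with hS
  have hSd : ∀ y, DifferentiableAt ℝ S y := fun y =>
    (Real.smoothTransition.contDiff (n := 1)).differentiable one_ne_zero y
  have hSc : Continuous (deriv S) :=
    (Real.smoothTransition.contDiff (n := 1)).continuous_deriv le_rfl
  obtain ⟨M, hM⟩ := isCompact_Icc.exists_bound_of_continuousOn (s := Icc (0 : ℝ) 1) hSc.continuousOn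
  have hM0 : 0 ≤ M := (norm_nonneg _).trans (hM 0 (by simp))
  have hS1 : ∀ y, |S y| ≤ 1 := fun y => by
    rw [abs_of_nonneg (Real.smoothTransition.nonneg y)]; exact Real.smoothTransition.le_one y
  have hSM : ∀ a y : ℝ, 0 ≤ a → (y ∈ Icc (0 : ℝ) 1 → a ≤ 2) → a * |deriv S y| ≤ 2 * M := by
    intro a y ha h
    by_cases hy : y ∈ Icc (0 : ℝ) 1
    · exact mul_le_mul (h hy) (hM y hy) (abs_nonneg _) (by norm_num)
    · rw [hS, deriv_smoothTransition_eq_zero hy, abs_zero, mul_zero]; positivity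
  have hpos : ∀ n : ℕ, (0 : ℝ) < n + 1 := fun n => by positivity
  refine ⟨fun n r => S ((n + 1) * r - 1) * S (2 - r / (n + 1)), 4 * M, by positivity,
    fun n => ?_, fun n r => ?_, fun n r hr => ?_, fun r hr => ?_⟩
  · have hsup : tsupport (fun r => S ((n + 1) * r - 1) * S (2 - r / (n + 1))) ⊆
        Icc (1 / (n + 1) : ℝ) (2 * (n + 1)) := by
      refine closure_minimal (fun r hr => ?_) isClosed_Icc
      rw [Function.mem_support] at hr
      have h1 : 0 < (n + 1) * r - 1 := by
        by_contra h
        exact hr (by rw [hS, Real.smoothTransition.zero_of_nonpos (not_lt.1 h), zero_mul])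
      have h2 : 0 < 2 - r / (n + 1) := by
        by_contra h
        exact hr (by rw [hS, Real.smoothTransition.zero_of_nonpos (not_lt.1 h), mul_zero])
      rw [sub_pos, div_lt_iff₀ (hpos n)] at h2
      refine ⟨?_, h2.le⟩
      rw [div_le_iff₀ (hpos n)]
      linarith
    refine ⟨?_, HasCompactSupport.of_support_subset_isCompact isCompact_Icc
      ((subset_tsupport _).trans hsup), fun r hr => ?_⟩
    · have := Real.smoothTransition.contDiff (n := ⊤)
      exact (this.comp (by fun_prop)).mul (this.comp (by fun_prop))
    · exact lt_of_lt_of_le (by have := hpos n; positivity) (hsup hr).1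
  · rw [abs_mul]
    exact mul_le_one₀ (hS1 _) (abs_nonneg _) (hS1 _)
  · have d1 : HasDerivAt (fun r : ℝ => S ((n + 1) * r - 1))
        (deriv S ((n + 1) * r - 1) * ((n + 1) * 1)) r :=
      (hSd _).hasDerivAt.comp r (((hasDerivAt_id r).const_mul _).sub_const _)
    have d2 : HasDerivAt (fun r : ℝ => S (2 - r / (n + 1)))
        (deriv S (2 - r / (n + 1)) * (-(1 / (n + 1)))) r :=
      (hSd _).hasDerivAt.comp r (((hasDerivAt_id r).div_const _).const_sub _)
    change r * |deriv ((fun r => S ((n + 1) * r - 1)) * fun r => S (2 - r / (n + 1))) r| ≤ 4 * M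
    rw [(d1.mul d2).deriv]
    have hn := hpos n
    have b1 := hSM ((n + 1) * r) ((n + 1) * r - 1) (by positivity) fun h => by linarith [h.2]
    have b2 := hSM (r / (n + 1)) (2 - r / (n + 1)) (by positivity) fun h => by linarith [h.1]
    calc r * |deriv S ((n + 1) * r - 1) * ((n + 1) * 1) * S (2 - r / (n + 1)) +
          S ((n + 1) * r - 1) * (deriv S (2 - r / (n + 1)) * -(1 / (n + 1)))|
        ≤ r * (|deriv S ((n + 1) * r - 1)| * (n + 1) * 1 +
          1 * (|deriv S (2 - r / (n + 1))| * (1 / (n + 1)))) := by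
          gcongr
          refine (abs_add_le _ _).trans ?_
          simp only [abs_mul, mul_one, abs_neg, abs_of_pos hn, abs_of_pos (one_div_pos.2 hn)]
          exact add_le_add (mul_le_of_le_one_right (by positivity) (hS1 _))
            (mul_le_mul_of_nonneg_right (hS1 _) (by positivity))
      _ = (n + 1) * r * |deriv S ((n + 1) * r - 1)| +
          r / (n + 1) * |deriv S (2 - r / (n + 1))| := by ring
      _ ≤ 4 * M := by linarith
  · obtain ⟨n₀, hn₀⟩ := exists_nat_gt (max (4 / r) (2 * r))
    filter_upwards [eventually_ge_atTop n₀] with n hn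
    have hn' : (n₀ : ℝ) ≤ n := by exact_mod_cast hn
    have h1 : 4 / r < n := (le_max_left _ _).trans_lt (hn₀.trans_le hn')
    have h2 : 2 * r < n := (le_max_right _ _).trans_lt (hn₀.trans_le hn')
    rw [div_lt_iff₀ hr] at h1
    filter_upwards [Ioo_mem_nhds (show r / 2 < r by linarith) (show r < 2 * r by linarith)]
      with x hx
    have e1 : 1 ≤ (n + 1) * x - 1 := by nlinarith [hx.1, (n.cast_nonneg : (0 : ℝ) ≤ n)]
    have e2 : 1 ≤ 2 - x / (n + 1) := by
      have : x / (n + 1) ≤ 1 := by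
        rw [div_le_iff₀ (hpos n)]; linarith [hx.2]
      linarith
    rw [hS, Real.smoothTransition.one_of_one_le e1, Real.smoothTransition.one_of_one_le e2, one_mul]

/-- An admissible potential is measurable and bounded by a multiple of `1 + 1/r`. -/
theorem IsAdmissible.exists_bound {φ : ℝ → ℝ} (h : IsAdmissible φ) :
    AEStronglyMeasurable φ halfLine ∧
      ∃ K, 0 ≤ K ∧ ∀ᵐ r ∂halfLine, |φ r| ≤ K * (1 + r⁻¹) := by
  obtain ⟨χ, ψ, c, hc, hφ, hχm, hχ, hψ⟩ := h
  have hae : ∀ᵐ r ∂halfLine, r ∈ Ioi (0 : ℝ) := ae_restrict_mem measurableSet_Ioi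
  refine ⟨(hχm.add hψ.1).congr ?_, c + (eLpNormEssSup ψ halfLine).toReal, by positivity, ?_⟩
  · filter_upwards [hae] with r hr
    exact (hφ r hr).symm
  · have hfin : eLpNormEssSup ψ halfLine ≠ ⊤ := by
      have := hψ.2
      rw [eLpNorm_exponent_top] at this
      exact this.ne
    filter_upwards [hae, enorm_ae_le_eLpNormEssSup ψ halfLine] with r hr hψr
    have h1 : |ψ r| ≤ (eLpNormEssSup ψ halfLine).toReal := by
      have := (ENNReal.toReal_le_toReal (by simp) hfin).2 hψr
      rwa [toReal_enorm] at this
    have hr' : 0 < r⁻¹ := inv_pos.2 hr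
    have h0 : (0 : ℝ) ≤ (eLpNormEssSup ψ halfLine).toReal := ENNReal.toReal_nonneg
    rw [hφ r hr]
    refine (abs_add_le _ _).trans ((add_le_add (hχ r hr) h1).trans ?_)
    nlinarith [mul_nonneg h0 hr'.le]

theorem L2.norm_sq_eq (f : L2) : ‖f‖ ^ 2 = ∫ x in Ioi 0, ‖f x‖ ^ 2 := by
  have h : ((‖f‖ ^ 2 : ℝ) : ℂ) = ((∫ x in Ioi 0, ‖f x‖ ^ 2 : ℝ) : ℂ) := by
    have h1 : ((‖f‖ : ℝ) : ℂ) ^ 2 = ⟪f, f⟫_ℂ := (inner_self_eq_norm_sq_to_K f).symm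
    rw [Complex.ofReal_pow, h1, L2.inner_def, ← integral_complex_ofReal]
    refine integral_congr_ae (Eventually.of_forall fun x => ?_)
    dsimp only
    rw [inner_self_eq_norm_sq_to_K]
    push_cast
    rfl
  exact_mod_cast h

/-- Dominated convergence in `L²(0, ∞)`. -/
theorem tendsto_toLp_of_dominated {F : ℕ → ℝ → ℂ} {f : ℝ → ℂ} {g : ℝ → ℝ}
    (hg : MemLp g 2 halfLine) (hF : ∀ n, AEStronglyMeasurable (F n) halfLine)
    (hb : ∀ n, ∀ᵐ x ∂halfLine, ‖F n x‖ ≤ g x)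
    (hlim : ∀ᵐ x ∂halfLine, Tendsto (fun n => F n x) atTop (𝓝 (f x))) :
    ∃ hf : MemLp f 2 halfLine, ‖hf.toLp f‖ ≤ ‖hg.toLp g‖ ∧
      ∀ y : ℕ → L2, (∀ n, y n =ᵐ[halfLine] F n) → Tendsto y atTop (𝓝 (hf.toLp f)) := by
  have hb' := ae_all_iff.2 hb
  have hfm : AEStronglyMeasurable f halfLine := aestronglyMeasurable_of_tendsto_ae _ hF hlim
  have hfb : ∀ᵐ x ∂halfLine, ‖f x‖ ≤ g x := by
    filter_upwards [hb', hlim] with x h1 h2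
    exact le_of_tendsto h2.norm (Eventually.of_forall h1)
  have hf : MemLp f 2 halfLine := hg.mono hfm (hfb.mono fun x hx => hx.trans (Real.le_norm_self _))
  refine ⟨hf, ?_, fun y hy => ?_⟩
  · refine Lp.norm_le_norm_of_ae_le ?_
    filter_upwards [hf.coeFn_toLp, hg.coeFn_toLp, hfb] with x h1 h2 h3
    rw [h1, h2]
    exact h3.trans (Real.le_norm_self _)
  · rw [tendsto_iff_norm_sub_tendsto_zero]
    have h0 : Tendsto (fun n => ∫ x in Ioi 0, ‖F n x - f x‖ ^ 2) atTop (𝓝 0) := by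
      have hgi : Integrable (fun x => 4 * ‖g x‖ ^ 2) halfLine :=
        ((memLp_two_iff_integrable_sq_norm hg.1).1 hg).const_mul 4
      have := tendsto_integral_of_dominated_convergence (μ := halfLine)
        (F := fun n x => ‖F n x - f x‖ ^ 2) (f := fun _ => (0 : ℝ)) _
        (fun n => (((hF n).sub hfm).norm.pow 2)) hgi (fun n => ?_) ?_
      · simpa using this
      · filter_upwards [hb n, hfb] with x h1 h2
        rw [Real.norm_of_nonneg (by positivity)]
        have h3 : ‖F n x - f x‖ ≤ 2 * ‖g x‖ := by
          have := norm_sub_le (F n x) (f x)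
          have := Real.le_norm_self (g x)
          linarith
        calc ‖F n x - f x‖ ^ 2 ≤ (2 * ‖g x‖) ^ 2 := by gcongr
          _ = _ := by ring
      · filter_upwards [hlim] with x hx
        have := ((hx.sub_const (f x)).norm).pow 2
        simpa using this
    have e : ∀ n, ‖y n - hf.toLp f‖ ^ 2 = ∫ x in Ioi 0, ‖F n x - f x‖ ^ 2 := fun n => by
      rw [L2.norm_sq_eq]
      refine integral_congr_ae ?_
      filter_upwards [Lp.coeFn_sub (y n) (hf.toLp f), hy n, hf.coeFn_toLp] with x h1 h2 h3
      rw [h1, Pi.sub_apply, h2, h3]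
    have h1 : Tendsto (fun n => ‖y n - hf.toLp f‖ ^ 2) atTop (𝓝 0) := by simpa only [e] using h0
    have := h1.sqrt
    simpa using this

open Polynomial

/-- `|p(r)| e^{-r²/2}` as a real `L²` function. -/
def absPolyVec (p : ℝ[X]) : Lp ℝ 2 halfLine := (memLp_polyGauss p).norm.toLp _

theorem coeFn_absPolyVec (p : ℝ[X]) : absPolyVec p =ᵐ[halfLine] fun x => |polyGauss p x| := by
  filter_upwards [(memLp_polyGauss p).norm.coeFn_toLp] with x hx
  rw [absPolyVec, hx, Complex.norm_real, Real.norm_eq_abs]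

theorem norm_absPolyVec (p : ℝ[X]) : ‖absPolyVec p‖ = ‖polyVec p‖ := by
  rw [absPolyVec, polyVec, Lp.norm_toLp, Lp.norm_toLp, eLpNorm_norm]

/-- Pointwise bound for one component of the Dirac expression, in terms of weighted bounds `A`, `B`
for the two functions and a bound `V'` for the derivative. -/
theorem norm_diracUpper_le {κ : ℤ} {φsc φel φam : ℝ → ℝ} {K r : ℝ} {u v : ℝ → ℂ} {A B V' : ℝ}
    (hr : 0 < r) (h1 : |φsc r| ≤ K * (1 + r⁻¹)) (h2 : |φel r| ≤ K * (1 + r⁻¹))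
    (h3 : |φam r| ≤ K * (1 + r⁻¹)) (hu : (1 + r⁻¹) * ‖u r‖ ≤ A) (hv : (1 + r⁻¹) * ‖v r‖ ≤ B)
    (hK : 0 ≤ K) (hV : ‖deriv v r‖ ≤ V') :
    ‖diracUpper κ φsc φel φam u v r‖ ≤ (1 + |(κ : ℝ)| + 2 * K) * (A + B + V') := by
  have hri : 0 < r⁻¹ := inv_pos.2 hr
  have hA : 0 ≤ A := le_trans (by positivity) hu
  have hB : 0 ≤ B := le_trans (by positivity) hv
  have hV0 : 0 ≤ V' := (norm_nonneg _).trans hV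
  have e1 : |1 + φsc r + φel r| ≤ (1 + 2 * K) * (1 + r⁻¹) := by
    refine (abs_add_three _ _ _).trans ?_
    rw [abs_one]; nlinarith
  have e2 : |κ / r + φam r| ≤ (|(κ : ℝ)| + K) * (1 + r⁻¹) := by
    refine (abs_add_le _ _).trans ?_
    rw [abs_div, abs_of_pos hr, div_eq_mul_inv]
    nlinarith [abs_nonneg (κ : ℝ)]
  have t1 : ‖((1 + φsc r + φel r : ℝ) : ℂ) * u r‖ ≤ (1 + 2 * K) * A := by
    rw [norm_mul, Complex.norm_real, Real.norm_eq_abs]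
    calc _ ≤ (1 + 2 * K) * (1 + r⁻¹) * ‖u r‖ := by gcongr
      _ = (1 + 2 * K) * ((1 + r⁻¹) * ‖u r‖) := by ring
      _ ≤ _ := by gcongr
  have t2 : ‖((κ / r + φam r : ℝ) : ℂ) * v r‖ ≤ (|(κ : ℝ)| + K) * B := by
    rw [norm_mul, Complex.norm_real, Real.norm_eq_abs]
    calc _ ≤ (|(κ : ℝ)| + K) * (1 + r⁻¹) * ‖v r‖ := by gcongr
      _ = (|(κ : ℝ)| + K) * ((1 + r⁻¹) * ‖v r‖) := by ring
      _ ≤ _ := by gcongr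
  have t3 : ‖-deriv v r‖ ≤ V' := by rwa [norm_neg]
  have := (norm_add_le (((1 + φsc r + φel r : ℝ) : ℂ) * u r)
    (-deriv v r + ((κ / r + φam r : ℝ) : ℂ) * v r)).trans
    (add_le_add t1 ((norm_add_le _ _).trans (add_le_add t3 t2)))
  refine this.trans ?_
  nlinarith [abs_nonneg (κ : ℝ), mul_nonneg hK hA, mul_nonneg hK hB, mul_nonneg hK hV0,
    mul_nonneg (abs_nonneg (κ : ℝ)) hA, mul_nonneg (abs_nonneg (κ : ℝ)) hV0]

/-- The lower component of the Dirac expression, up to sign, is an upper component with the roles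
of the two functions exchanged. -/
theorem diracLower_eq (κ : ℤ) (φsc φel φam : ℝ → ℝ) (u v : ℝ → ℂ) (r : ℝ) :
    diracLower κ φsc φel φam u v r =
      -diracUpper (-κ) φsc (fun r => -φel r) (fun r => -φam r) v u r := by
  simp only [diracLower, diracUpper]
  push_cast
  ring

theorem aestronglyMeasurable_diracUpper {κ : ℤ} {φsc φel φam : ℝ → ℝ}
    (h1 : AEStronglyMeasurable φsc halfLine) (h2 : AEStronglyMeasurable φel halfLine)
    (h3 : AEStronglyMeasurable φam halfLine) {u v : ℝ → ℂ} (hu : Continuous u) (hv : Continuous v) :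
    AEStronglyMeasurable (diracUpper κ φsc φel φam u v) halfLine := by
  have m1 : AEStronglyMeasurable (fun r => ((1 + φsc r + φel r : ℝ) : ℂ)) halfLine :=
    Complex.continuous_ofReal.comp_aestronglyMeasurable
      ((aestronglyMeasurable_const.add h1).add h2)
  have m2 : AEStronglyMeasurable (fun r => ((κ / r + φam r : ℝ) : ℂ)) halfLine :=
    Complex.continuous_ofReal.comp_aestronglyMeasurable
      ((by fun_prop : Measurable fun r : ℝ => (κ : ℝ) / r).aestronglyMeasurable.add h3)
  have m3 : AEStronglyMeasurable (fun r => -deriv v r) halfLine :=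
    (measurable_deriv v).neg.aestronglyMeasurable
  exact (m1.mul hu.aestronglyMeasurable).add (m3.add (m2.mul hv.aestronglyMeasurable))

/-- One component of the Dirac expression, applied to `ζ n` times `r s(r) e^{-r²/2}` and
`r t(r) e^{-r²/2}`, converges in `L²` to a limit of controlled norm. -/
theorem exists_tendsto_diracUpper {φsc φel φam : ℝ → ℝ} (hsc : IsAdmissible φsc)
    (hel : IsAdmissible φel) (ham : IsAdmissible φam) (κ : ℤ) {ζ : ℕ → ℝ → ℝ} {C : ℝ} (hC : 0 ≤ C)
    (hζ : ∀ n, ContDiff ℝ ∞ (ζ n)) (hζ1 : ∀ n r, |ζ n r| ≤ 1)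
    (hζ2 : ∀ n, ∀ r > 0, r * |deriv (ζ n) r| ≤ C)
    (hζ3 : ∀ r > 0, ∀ᶠ n in atTop, ζ n =ᶠ[𝓝 r] fun _ => 1) :
    ∃ D, 0 ≤ D ∧ ∀ s t : ℝ[X], ∃ w : L2,
      ‖w‖ ≤ D * (‖polyVec (X * s)‖ + ‖polyVec s‖ + ‖polyVec (X * t)‖ + ‖polyVec t‖ +
        ‖polyVec (gaussDeriv (X * t))‖) ∧
      ∀ y : ℕ → L2, (∀ n, y n =ᵐ[halfLine] diracUpper κ φsc φel φam
        (fun r => (ζ n r * polyGauss (X * s) r : ℝ))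
        (fun r => (ζ n r * polyGauss (X * t) r : ℝ))) → Tendsto y atTop (𝓝 w) := by
  obtain ⟨m1, K1, hK1, b1⟩ := hsc.exists_bound
  obtain ⟨m2, K2, hK2, b2⟩ := hel.exists_bound
  obtain ⟨m3, K3, hK3, b3⟩ := ham.exists_bound
  set K := K1 + K2 + K3 with hK
  have hK0 : 0 ≤ K := by positivity
  set D := (1 + |(κ : ℝ)| + 2 * K) * (1 + C) with hD
  have hD0 : 0 ≤ D := by positivity
  refine ⟨D, hD0, fun s t => ?_⟩
  have hae : ∀ᵐ r ∂halfLine, r ∈ Ioi (0 : ℝ) := ae_restrict_mem measurableSet_Ioi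
  set g : Lp ℝ 2 halfLine := D • (absPolyVec (X * s) + absPolyVec s + absPolyVec (X * t) +
    absPolyVec t + absPolyVec (gaussDeriv (X * t))) with hg
  have hgx : ∀ᵐ r ∂halfLine, g r = D * (|polyGauss (X * s) r| + |polyGauss s r| +
      |polyGauss (X * t) r| + |polyGauss t r| + |polyGauss (gaussDeriv (X * t)) r|) := by
    rw [hg]
    filter_upwards [Lp.coeFn_smul D (absPolyVec (X * s) + absPolyVec s + absPolyVec (X * t) +
      absPolyVec t + absPolyVec (gaussDeriv (X * t))),
      Lp.coeFn_add (absPolyVec (X * s) + absPolyVec s + absPolyVec (X * t) +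
      absPolyVec t) (absPolyVec (gaussDeriv (X * t))),
      Lp.coeFn_add (absPolyVec (X * s) + absPolyVec s + absPolyVec (X * t)) (absPolyVec t),
      Lp.coeFn_add (absPolyVec (X * s) + absPolyVec s) (absPolyVec (X * t)),
      Lp.coeFn_add (absPolyVec (X * s)) (absPolyVec s),
      coeFn_absPolyVec (X * s), coeFn_absPolyVec s, coeFn_absPolyVec (X * t), coeFn_absPolyVec t,
      coeFn_absPolyVec (gaussDeriv (X * t))] with r a1 a2 a3 a4 a5 a6 a7 a8 a9 a10
    rw [a1, Pi.smul_apply, a2, Pi.add_apply, a3, Pi.add_apply, a4, Pi.add_apply, a5, Pi.add_apply,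
      a6, a7, a8, a9, a10, smul_eq_mul]
  have hgn : ‖g‖ ≤ D * (‖polyVec (X * s)‖ + ‖polyVec s‖ + ‖polyVec (X * t)‖ + ‖polyVec t‖ +
      ‖polyVec (gaussDeriv (X * t))‖) := by
    rw [hg, norm_smul, Real.norm_of_nonneg hD0]
    gcongr
    simp only [← norm_absPolyVec]
    exact (norm_add_le _ _).trans (by gcongr; exact norm_add₄_le)
  have hXp : ∀ (p : ℝ[X]) (r : ℝ), polyGauss (X * p) r = r * polyGauss p r := fun p r => by
    simp [polyGauss, mul_assoc]
  have hweight : ∀ (p : ℝ[X]) (n : ℕ) (r : ℝ), 0 < r →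
      (1 + r⁻¹) * ‖((ζ n r * polyGauss (X * p) r : ℝ) : ℂ)‖ ≤
        |polyGauss (X * p) r| + |polyGauss p r| := by
    intro p n r hr
    rw [Complex.norm_real, Real.norm_eq_abs, abs_mul]
    have h1 : |ζ n r| * |polyGauss (X * p) r| ≤ 1 * |polyGauss (X * p) r| := by
      gcongr; exact hζ1 n r
    have hri : 0 < r⁻¹ := inv_pos.2 hr
    have h2 : r⁻¹ * |polyGauss (X * p) r| = |polyGauss p r| := by
      rw [hXp, abs_mul, abs_of_pos hr, ← mul_assoc, inv_mul_cancel₀ hr.ne', one_mul]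
    calc _ ≤ (1 + r⁻¹) * (1 * |polyGauss (X * p) r|) := by gcongr
      _ = _ := by rw [one_mul, add_mul, one_mul, h2]
  have hdζ : ∀ n r, DifferentiableAt ℝ (ζ n) r := fun n r => (hζ n).differentiable (by simp) r
  have hbound : ∀ n, ∀ᵐ r ∂halfLine, ‖diracUpper κ φsc φel φam
      (fun r => (ζ n r * polyGauss (X * s) r : ℝ))
      (fun r => (ζ n r * polyGauss (X * t) r : ℝ)) r‖ ≤ g r := by
    intro n
    filter_upwards [hae, b1, b2, b3, hgx] with r hr c1 c2 c3 hgr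
    have hr : 0 < r := hr
    have hri : 0 < r⁻¹ := inv_pos.2 hr
    have hd : ‖deriv (fun r => ((ζ n r * polyGauss (X * t) r : ℝ) : ℂ)) r‖ ≤
        C * |polyGauss t r| + |polyGauss (gaussDeriv (X * t)) r| := by
      have hd' : HasDerivAt (fun r => ((ζ n r * polyGauss (X * t) r : ℝ) : ℂ)) _ r :=
        ((hdζ n r).hasDerivAt.mul (hasDerivAt_polyGauss (X * t) r)).ofReal_comp
      rw [hd'.deriv, Complex.norm_real, Real.norm_eq_abs]
      refine (abs_add_le _ _).trans ?_
      rw [abs_mul, abs_mul]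
      have := hζ2 n r hr
      have h1 : |ζ n r| * |polyGauss (gaussDeriv (X * t)) r| ≤
          1 * |polyGauss (gaussDeriv (X * t)) r| := by gcongr; exact hζ1 n r
      have h2 : |deriv (ζ n) r| * |polyGauss (X * t) r| =
          (r * |deriv (ζ n) r|) * |polyGauss t r| := by
        rw [hXp, abs_mul, abs_of_pos hr]; ring
      have h3 : (r * |deriv (ζ n) r|) * |polyGauss t r| ≤ C * |polyGauss t r| := by gcongr
      linarith
    have key := norm_diracUpper_le (κ := κ) (φsc := φsc) (φel := φel) (φam := φam) (K := K)
      (u := fun r => ((ζ n r * polyGauss (X * s) r : ℝ) : ℂ))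
      (v := fun r => ((ζ n r * polyGauss (X * t) r : ℝ) : ℂ)) hr
      (c1.trans (by gcongr; linarith)) (c2.trans (by gcongr; linarith))
      (c3.trans (by gcongr; linarith)) (hweight s n r hr) (hweight t n r hr) hK0 hd
    refine key.trans ?_
    rw [hgr, hD, mul_assoc]
    gcongr
    have p1 := abs_nonneg (polyGauss (X * s) r)
    have p2 := abs_nonneg (polyGauss s r)
    have p3 := abs_nonneg (polyGauss (X * t) r)
    have p4 := abs_nonneg (polyGauss t r)
    have p5 := abs_nonneg (polyGauss (gaussDeriv (X * t)) r)
    nlinarith [mul_nonneg hC p1, mul_nonneg hC p2, mul_nonneg hC p3, mul_nonneg hC p5]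
  have hlim : ∀ᵐ r ∂halfLine, Tendsto (fun n => diracUpper κ φsc φel φam
      (fun r => (ζ n r * polyGauss (X * s) r : ℝ))
      (fun r => (ζ n r * polyGauss (X * t) r : ℝ)) r) atTop
      (𝓝 (diracUpper κ φsc φel φam (fun r => (polyGauss (X * s) r : ℝ))
        (fun r => (polyGauss (X * t) r : ℝ)) r)) := by
    filter_upwards [hae] with r hr
    refine tendsto_const_nhds.congr' ?_
    filter_upwards [hζ3 r hr] with n hn
    have h1 : ζ n r = 1 := hn.eq_of_nhds
    have h2 : (fun r => ((ζ n r * polyGauss (X * t) r : ℝ) : ℂ)) =ᶠ[𝓝 r]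
        fun r => (polyGauss (X * t) r : ℂ) := by
      filter_upwards [hn] with x hx
      rw [hx, one_mul]
    simp only [diracUpper, h2.deriv_eq, h1, one_mul]
  have hcont : ∀ (n : ℕ) (p : ℝ[X]), Continuous fun r => ((ζ n r * polyGauss p r : ℝ) : ℂ) :=
    fun n p => Complex.continuous_ofReal.comp ((hζ n).continuous.mul (continuous_polyGauss p))
  obtain ⟨hf, hn, hy⟩ := tendsto_toLp_of_dominated (Lp.memLp g)
    (fun n => aestronglyMeasurable_diracUpper m1 m2 m3 (hcont n _) (hcont n _)) hbound hlim
  rw [Lp.toLp_coeFn] at hn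
  exact ⟨_, hn.trans hgn, hy⟩

theorem IsAdmissible.neg {φ : ℝ → ℝ} (h : IsAdmissible φ) : IsAdmissible fun r => -φ r := by
  obtain ⟨χ, ψ, c, hc, hφ, hχm, hχ, hψ⟩ := h
  refine ⟨fun r => -χ r, fun r => -ψ r, c, hc, fun r hr => ?_, hχm.neg, fun r hr => ?_, hψ.neg⟩
  · dsimp only; rw [hφ r hr]; ring
  · rw [abs_neg]; exact hχ r hr

theorem exists_domain_of_mem_graph {X : Type*} [NormedAddCommGroup X] [InnerProductSpace ℂ X]
    {T : X →ₗ.[ℂ] X} {x y : X} (h : (x, y) ∈ T.graph) : ∃ hx : x ∈ T.domain, T ⟨x, hx⟩ = y := by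
  obtain ⟨z, hz1, hz2⟩ := T.mem_graph_iff.1 h
  have hz1' : (z : X) = x := hz1
  subst hz1'
  exact ⟨z.2, hz2⟩

theorem norm_spinor_le (x : Spinor) : ‖x‖ ≤ ‖x.fst‖ + ‖x.snd‖ := by
  have : x = WithLp.toLp 2 (x.fst, 0) + WithLp.toLp 2 (0, x.snd) := by
    rw [← WithLp.toLp_add, Prod.mk_add_mk, add_zero, zero_add]; rfl
  calc ‖x‖ = ‖WithLp.toLp 2 (x.fst, (0 : L2)) + WithLp.toLp 2 ((0 : L2), x.snd)‖ := by rw [← this]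
    _ ≤ _ := (norm_add_le _ _).trans (by rw [WithLp.norm_toLp_fst, WithLp.norm_toLp_snd])

/-- The norms entering the bound of the Dirac expression on `r s(r) e^{-r²/2}`. -/
def graphBound (s : ℝ[X]) : ℝ :=
  ‖polyVec (X * s)‖ + ‖polyVec s‖ + ‖polyVec (gaussDeriv (X * s))‖

/-- Pairs of functions `r s(r) e^{-r²/2}`, which vanish at the origin, are in the domain of every
self-adjoint realisation: cut them off to test functions and use that the operator is closed. -/
theorem IsRadialDirac.exists_mem_domain {κ : ℤ} {φsc φel φam : ℝ → ℝ}
    (hsc : IsAdmissible φsc) (hel : IsAdmissible φel) (ham : IsAdmissible φam)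
    {H : Spinor →ₗ.[ℂ] Spinor} (hH : IsRadialDirac κ φsc φel φam H) :
    ∃ D, 0 ≤ D ∧ ∀ s t : ℝ[X], ∃ h : WithLp.toLp 2 (polyVec (X * s), polyVec (X * t)) ∈ H.domain,
      ‖H ⟨_, h⟩‖ ≤ D * (graphBound s + graphBound t) := by
  obtain ⟨ζ, C, hC, hζ, hζ1, hζ2, hζ3⟩ := exists_cutoff
  obtain ⟨D₁, hD₁, h₁⟩ := exists_tendsto_diracUpper hsc hel ham κ hC (fun n => (hζ n).1) hζ1 hζ2 hζ3
  obtain ⟨D₂, hD₂, h₂⟩ := exists_tendsto_diracUpper hsc hel.neg ham.neg (-κ) hC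
    (fun n => (hζ n).1) hζ1 hζ2 hζ3
  have hae : ∀ᵐ r ∂halfLine, r ∈ Ioi (0 : ℝ) := ae_restrict_mem measurableSet_Ioi
  have htest : ∀ (p : ℝ[X]) (n : ℕ), IsTestFunction fun r => ((ζ n r * polyGauss p r : ℝ) : ℂ) := by
    intro p n
    obtain ⟨a1, a2, a3⟩ := hζ n
    have hs : Function.support (fun r => ((ζ n r * polyGauss p r : ℝ) : ℂ)) ⊆
        Function.support (ζ n) := by
      intro r hr h0
      simp [h0] at hr
    exact ⟨Complex.ofRealCLM.contDiff.comp (a1.mul (contDiff_polyGauss p)),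
      a2.mono hs, (closure_mono hs).trans a3⟩
  have hconv : ∀ (p : ℝ[X]) (y : ℕ → L2),
      (∀ n, y n =ᵐ[halfLine] fun r => ((ζ n r * polyGauss p r : ℝ) : ℂ)) →
      Tendsto y atTop (𝓝 (polyVec p)) := by
    intro p y hy
    obtain ⟨hf, -, h⟩ := tendsto_toLp_of_dominated (f := fun r => (polyGauss p r : ℂ))
      (memLp_polyGauss p).norm (F := fun n r => ((ζ n r * polyGauss p r : ℝ) : ℂ))
      (fun n => (Complex.continuous_ofReal.comp
        ((hζ n).1.continuous.mul (continuous_polyGauss p))).aestronglyMeasurable)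
      (fun n => Eventually.of_forall fun r => by
        rw [Complex.norm_real, Complex.norm_real, norm_mul]
        exact mul_le_of_le_one_left (norm_nonneg _) (hζ1 n r))
      (by
        filter_upwards [hae] with r hr
        refine tendsto_const_nhds.congr' ?_
        filter_upwards [hζ3 r hr] with n hn
        rw [hn.eq_of_nhds, one_mul])
    exact h y hy
  refine ⟨D₁ + D₂, by positivity, fun s t => ?_⟩
  obtain ⟨w₁, hw₁, hc₁⟩ := h₁ s t
  obtain ⟨w₂, hw₂, hc₂⟩ := h₂ t s
  choose x hx1 hx2 hx3 hx4 using fun n =>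
    hH.extends_expression _ _ (htest (X * s) n) (htest (X * t) n)
  have hxlim : Tendsto (fun n => (x n : Spinor)) atTop
      (𝓝 (WithLp.toLp 2 (polyVec (X * s), polyVec (X * t)))) := by
    have := (WithLp.prod_continuous_toLp 2 L2 L2).continuousAt.tendsto.comp
      ((hconv (X * s) _ hx1).prodMk_nhds (hconv (X * t) _ hx2))
    exact this
  have hsnd : Tendsto (fun n => (H (x n)).snd) atTop (𝓝 (-w₂)) := by
    have := (hc₂ (fun n => -(H (x n)).snd) fun n => by
      filter_upwards [Lp.coeFn_neg (H (x n)).snd, hx4 n] with r a1 a2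
      rw [a1, Pi.neg_apply, a2, diracLower_eq, neg_neg]).neg
    simpa using this
  have hHlim : Tendsto (fun n => H (x n)) atTop (𝓝 (WithLp.toLp 2 (w₁, -w₂))) := by
    have := (WithLp.prod_continuous_toLp 2 L2 L2).continuousAt.tendsto.comp
      ((hc₁ _ hx3).prodMk_nhds hsnd)
    exact this
  have hcl : _root_.IsClosed (H.graph : Set (Spinor × Spinor)) := hH.isSelfAdjoint.isClosed
  have hmem := hcl.mem_of_tendsto (hxlim.prodMk_nhds hHlim)
    (Eventually.of_forall fun n => H.mem_graph (x n))
  obtain ⟨hd, hv⟩ := exists_domain_of_mem_graph hmem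
  refine ⟨hd, ?_⟩
  rw [hv]
  refine (norm_spinor_le _).trans ?_
  have e1 : ‖w₁‖ ≤ D₁ * (graphBound s + graphBound t) := by
    refine hw₁.trans (mul_le_mul_of_nonneg_left ?_ hD₁)
    simp only [graphBound]
    linarith [norm_nonneg (polyVec (gaussDeriv (X * s)))]
  have e2 : ‖w₂‖ ≤ D₂ * (graphBound s + graphBound t) := by
    refine hw₂.trans (mul_le_mul_of_nonneg_left ?_ hD₂)
    simp only [graphBound]
    linarith [norm_nonneg (polyVec (gaussDeriv (X * t)))]
  change ‖w₁‖ + ‖-w₂‖ ≤ _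
  rw [norm_neg]
  linarith

/-! ### The Hermite basis -/

/-- The odd Hermite functions, normalised in `L²(0, ∞)`. -/
def hermiteUnit (k : ℕ) : L2 :=
  ((‖polyVec (hermitePoly (2 * k + 1))‖⁻¹ : ℝ) : ℂ) • polyVec (hermitePoly (2 * k + 1))

theorem norm_polyVec_hermitePoly_pos (k : ℕ) : 0 < ‖polyVec (hermitePoly (2 * k + 1))‖ :=
  norm_pos_iff.2 (polyVec_ne_zero (hermitePoly_ne_zero _))

theorem orthonormal_hermiteUnit : Orthonormal ℂ hermiteUnit := by
  refine ⟨fun k => ?_, fun j k hjk => ?_⟩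
  · have h := norm_polyVec_hermitePoly_pos k
    rw [hermiteUnit, norm_smul, Complex.norm_real, norm_inv, norm_norm, inv_mul_cancel₀ h.ne']
  · simp only [hermiteUnit, inner_smul_left, inner_smul_right, inner_polyVec_hermitePoly hjk,
      mul_zero]

theorem hasSum_hermiteUnit (f : L2) :
    HasSum (fun k => ⟪hermiteUnit k, f⟫_ℂ • hermiteUnit k) f := by
  have hsp : (Submodule.span ℂ (range hermiteUnit))ᗮ = ⊥ := by
    rw [Submodule.eq_bot_iff]
    intro g hg
    refine eq_zero_of_inner_hermite fun k => ?_
    have h := (Submodule.mem_orthogonal _ _).1 hg _ (Submodule.subset_span ⟨k, rfl⟩)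
    rw [hermiteUnit, inner_smul_left, mul_eq_zero] at h
    refine h.resolve_left ?_
    rw [Complex.conj_ofReal]
    exact Complex.ofReal_ne_zero.2 (inv_pos.2 (norm_polyVec_hermitePoly_pos k)).ne'
  have h := (HilbertBasis.mkOfOrthogonalEqBot orthonormal_hermiteUnit hsp).hasSum_repr f
  simpa only [HilbertBasis.repr_apply_apply, HilbertBasis.coe_mkOfOrthogonalEqBot] using h

theorem hermiteUnit_mem_eigenspace (k : ℕ) :
    hermiteUnit k ∈ eigenspace oscillator ((4 * k + 3 : ℝ) : ℂ) :=
  Submodule.smul_mem _ _ (polyVec_mem_eigenspace k)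

theorem hermiteUnit_eq_smul (k : ℕ) : ∃ a : ℂ, hermiteUnit k = a • hermiteVec k := by
  refine ⟨((‖polyVec (hermitePoly (2 * k + 1))‖⁻¹ : ℝ) : ℂ) * hermiteNorm (2 * k + 1), ?_⟩
  have h : (hermiteNorm (2 * k + 1) : ℂ) ≠ 0 := by exact_mod_cast (hermiteNorm_pos _).ne'
  rw [hermiteVec_eq, smul_smul, Complex.ofReal_inv (hermiteNorm _), mul_assoc, mul_inv_cancel₀ h,
    mul_one, hermiteUnit]

theorem exists_hermitePoly_eq_X_mul (k : ℕ) : ∃ s : ℝ[X], hermitePoly (2 * k + 1) = X * s := by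
  refine X_dvd_iff.2 ?_
  rw [coeff_zero_eq_eval_zero]
  exact hermitePoly_eval_zero k

theorem graphBound_le {k : ℕ} {s : ℝ[X]} (hs : hermitePoly (2 * k + 1) = X * s) :
    graphBound s ≤ 4 * √(4 * k + 3) * ‖polyVec (hermitePoly (2 * k + 1))‖ := by
  have h1 := norm_polyVec_le_of_X_mul s
  have h2 := norm_polyVec_gaussDeriv_le k
  have h3 : (1 : ℝ) ≤ √(4 * k + 3) := by
    rw [Real.one_le_sqrt]
    linarith [(k.cast_nonneg : (0 : ℝ) ≤ k)]
  have h4 := mul_le_mul_of_nonneg_right h3 (norm_nonneg (polyVec (hermitePoly (2 * k + 1))))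
  rw [graphBound, ← hs] at *
  linarith

theorem polyVec_zero : polyVec (0 : ℝ[X]) = 0 := by
  have := polyVec_C_mul 0 (0 : ℝ[X])
  simpa using this

theorem graphBound_zero : graphBound 0 = 0 := by
  simp [graphBound, gaussDeriv, polyVec_zero]

/-- The inclusion of the first component, `f ↦ (f, 0)`. -/
def upperIncl : L2 →L[ℂ] Spinor :=
  ((WithLp.prodContinuousLinearEquiv 2 ℂ L2 L2).symm : L2 × L2 →L[ℂ] Spinor) ∘L
    ContinuousLinearMap.inl ℂ L2 L2

/-- The inclusion of the second component, `f ↦ (0, f)`. -/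
def lowerIncl : L2 →L[ℂ] Spinor :=
  ((WithLp.prodContinuousLinearEquiv 2 ℂ L2 L2).symm : L2 × L2 →L[ℂ] Spinor) ∘L
    ContinuousLinearMap.inr ℂ L2 L2

theorem upperIncl_apply (f : L2) : upperIncl f = WithLp.toLp 2 (f, 0) := rfl

theorem lowerIncl_apply (f : L2) : lowerIncl f = WithLp.toLp 2 (0, f) := rfl

theorem norm_upperIncl (f : L2) : ‖upperIncl f‖ = ‖f‖ := WithLp.norm_toLp_fst 2 L2 L2 f

theorem norm_lowerIncl (f : L2) : ‖lowerIncl f‖ = ‖f‖ := WithLp.norm_toLp_snd 2 L2 L2 f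

theorem upperIncl_add_lowerIncl (x : Spinor) : upperIncl x.fst + lowerIncl x.snd = x := by
  rw [upperIncl_apply, lowerIncl_apply, ← WithLp.toLp_add, Prod.mk_add_mk, add_zero, zero_add]
  rfl

/-- The Dirac operator is bounded by the square root of the oscillator on the Hermite basis. -/
theorem IsRadialDirac.exists_norm_hermiteUnit_le {κ : ℤ} {φsc φel φam : ℝ → ℝ}
    (hsc : IsAdmissible φsc) (hel : IsAdmissible φel) (ham : IsAdmissible φam)
    {H : Spinor →ₗ.[ℂ] Spinor} (hH : IsRadialDirac κ φsc φel φam H) :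
    ∃ D, 0 ≤ D ∧ ∀ k : ℕ,
      (∃ h : upperIncl (hermiteUnit k) ∈ H.domain, ‖H ⟨_, h⟩‖ ≤ D * √(4 * k + 3)) ∧
      (∃ h : lowerIncl (hermiteUnit k) ∈ H.domain, ‖H ⟨_, h⟩‖ ≤ D * √(4 * k + 3)) := by
  obtain ⟨D, hD, h⟩ := hH.exists_mem_domain hsc hel ham
  refine ⟨D * 4, by positivity, fun k => ?_⟩
  obtain ⟨s, hs⟩ := exists_hermitePoly_eq_X_mul k
  have hp := norm_polyVec_hermitePoly_pos k
  set n := ‖polyVec (hermitePoly (2 * k + 1))‖ with hn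
  have hb := graphBound_le hs
  rw [← hn] at hb
  have scale : ∀ (x y : Spinor) (hx : x ∈ H.domain), y = ((n⁻¹ : ℝ) : ℂ) • x →
      ‖H ⟨x, hx⟩‖ ≤ D * (4 * √(4 * k + 3) * n) →
      ∃ hy : y ∈ H.domain, ‖H ⟨y, hy⟩‖ ≤ D * 4 * √(4 * k + 3) := by
    rintro x y hx rfl hle
    refine ⟨H.domain.smul_mem _ hx, ?_⟩
    have e : (⟨((n⁻¹ : ℝ) : ℂ) • x, H.domain.smul_mem _ hx⟩ : H.domain) =
      ((n⁻¹ : ℝ) : ℂ) • ⟨x, hx⟩ := rfl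
    rw [e, H.map_smul, norm_smul, Complex.norm_real, Real.norm_of_nonneg (by positivity),
      inv_mul_le_iff₀ hp]
    linarith
  constructor
  · obtain ⟨hd, hle⟩ := h s 0
    rw [graphBound_zero, add_zero] at hle
    refine scale _ _ hd ?_ (hle.trans (by gcongr))
    rw [← hs, mul_zero, polyVec_zero, hermiteUnit, map_smul, upperIncl_apply]
  · obtain ⟨hd, hle⟩ := h 0 s
    rw [graphBound_zero, zero_add] at hle
    refine scale _ _ hd ?_ (hle.trans (by gcongr))
    rw [← hs, mul_zero, polyVec_zero, hermiteUnit, map_smul, lowerIncl_apply]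

end DiracDomain

/-! ### Approximation of eigenfunctions from the test spaces -/

section Approximation

/-- A closed operator may be applied termwise to a series that converges absolutely in the graph
norm. -/
theorem norm_apply_le_tsum {X : Type*} [NormedAddCommGroup X] [InnerProductSpace ℂ X]
    [CompleteSpace X] {T : X →ₗ.[ℂ] X} (hT : T.IsClosed) {x : ℕ → T.domain} {y : X}
    (hx : HasSum (fun k => (x k : X)) y) (hs : Summable fun k => ‖T (x k)‖) :
    ∃ h : y ∈ T.domain, ‖T ⟨y, h⟩‖ ≤ ∑' k, ‖T (x k)‖ := by
  have hcl : _root_.IsClosed (T.graph : Set (X × X)) := hT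
  have h1 : Tendsto (fun n => ∑ k ∈ Finset.range n, (x k : X)) atTop (𝓝 y) :=
    hx.tendsto_sum_nat
  have h2 : Tendsto (fun n => ∑ k ∈ Finset.range n, T (x k)) atTop (𝓝 (∑' k, T (x k))) :=
    hs.of_norm.hasSum.tendsto_sum_nat
  have hmem := hcl.mem_of_tendsto (h1.prodMk_nhds h2) (Eventually.of_forall fun n => by
    have := T.mem_graph (∑ k ∈ Finset.range n, x k)
    have e : T (∑ k ∈ Finset.range n, x k) = ∑ k ∈ Finset.range n, T (x k) :=
      map_sum T.toFun _ _
    rw [e] at this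
    simpa using this)
  obtain ⟨hd, hv⟩ := exists_domain_of_mem_graph hmem
  refine ⟨hd, ?_⟩
  rw [hv]
  exact norm_tsum_le_tsum_norm hs

/-- Coefficients that are square summable against `(4k+3)^{2q}` have tails of order
`N^{-(q-1)/2}` in the `ℓ¹` norm weighted with `(4k+3)^{1/2}`. -/
theorem exists_tail_le {q : ℝ} (hq : 1 < q) {a : ℕ → ℝ} (ha : ∀ k, 0 ≤ a k)
    (hs : Summable fun k : ℕ => (4 * k + 3 : ℝ) ^ (2 * q) * a k ^ 2) :
    ∃ C, 0 ≤ C ∧ ∀ N : ℕ, 1 ≤ N →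
      Summable (fun k => a (k + N) * √(4 * (k + N : ℕ) + 3)) ∧
      ∑' k, a (k + N) * √(4 * (k + N : ℕ) + 3) ≤ C * (N : ℝ) ^ (-((q - 1) / 2)) := by
  have hw : ∀ k : ℕ, (0 : ℝ) < 4 * k + 3 := fun k => by positivity
  have hs2 : Summable fun k : ℕ => (4 * k + 3 : ℝ) ^ (-q) := by
    refine Summable.of_nonneg_of_le (fun k => (Real.rpow_pos_of_pos (hw k) _).le) (fun k => ?_)
      ((summable_nat_add_iff 1).2 (Real.summable_nat_rpow.2 (by linarith : -q < -1)))
    refine Real.rpow_le_rpow_of_nonpos (by positivity) ?_ (by linarith)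
    push_cast
    linarith [(k.cast_nonneg : (0 : ℝ) ≤ k)]
  set B : ℕ → ℝ := fun k => (4 * k + 3 : ℝ) ^ (2 * q) * a k ^ 2 + (4 * k + 3 : ℝ) ^ (-q) with hB
  have hBs : Summable B := hs.add hs2
  have hB0 : ∀ k, 0 ≤ B k := fun k => by
    have := Real.rpow_pos_of_pos (hw k) (2 * q)
    have := Real.rpow_pos_of_pos (hw k) (-q)
    positivity
  refine ⟨∑' k, B k, tsum_nonneg hB0, fun N hN => ?_⟩
  have hN0 : (0 : ℝ) < N := by exact_mod_cast hN
  have hterm : ∀ k, a (k + N) * √(4 * (k + N : ℕ) + 3) ≤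
      B (k + N) * (N : ℝ) ^ (-((q - 1) / 2)) := by
    intro k
    set m := k + N with hm
    set w : ℝ := 4 * m + 3 with hwdef
    have hw0 : 0 < w := hw m
    -- the splitting `1/2 = q - q/2 - (q-1)/2` of the exponent
    have e : a m * √w = (w ^ q * a m) * w ^ (-(q / 2)) * w ^ (-((q - 1) / 2)) := by
      rw [Real.sqrt_eq_rpow, mul_comm (w ^ q), mul_assoc, mul_assoc, ← Real.rpow_add hw0,
        ← Real.rpow_add hw0]
      congr 2
      ring
    have e1 : (w ^ q * a m) * w ^ (-(q / 2)) ≤ B m := by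
      have h1 : (w ^ q * a m) ^ 2 = w ^ (2 * q) * a m ^ 2 := by
        rw [mul_pow, ← Real.rpow_natCast, ← Real.rpow_mul hw0.le]
        congr 2
        push_cast
        ring
      have h2 : (w ^ (-(q / 2))) ^ 2 = w ^ (-q) := by
        rw [← Real.rpow_natCast, ← Real.rpow_mul hw0.le]
        congr 1
        push_cast
        ring
      have h3 : B m = (w ^ q * a m) ^ 2 + (w ^ (-(q / 2))) ^ 2 := by rw [h1, h2]
      rw [h3]
      have := ha m
      nlinarith [sq_nonneg (w ^ q * a m - w ^ (-(q / 2))), Real.rpow_pos_of_pos hw0 q,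
        Real.rpow_pos_of_pos hw0 (-(q / 2)), sq_nonneg (w ^ q * a m), sq_nonneg (w ^ (-(q / 2)))]
    have e2 : w ^ (-((q - 1) / 2)) ≤ (N : ℝ) ^ (-((q - 1) / 2)) := by
      refine Real.rpow_le_rpow_of_nonpos hN0 ?_ (by linarith)
      rw [hwdef, hm]
      push_cast
      linarith [(k.cast_nonneg : (0 : ℝ) ≤ k)]
    rw [e]
    exact mul_le_mul e1 e2 (Real.rpow_pos_of_pos hw0 _).le (hB0 m)
  have hBN : Summable fun k => B (k + N) * (N : ℝ) ^ (-((q - 1) / 2)) :=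
    ((summable_nat_add_iff N).2 hBs).mul_right _
  have hsum : Summable fun k => a (k + N) * √(4 * (k + N : ℕ) + 3) :=
    Summable.of_nonneg_of_le (fun k => mul_nonneg (ha _) (Real.sqrt_nonneg _)) hterm hBN
  refine ⟨hsum, (hsum.tsum_le_tsum hterm hBN).trans ?_⟩
  rw [tsum_mul_right]
  refine mul_le_mul_of_nonneg_right ?_ (Real.rpow_nonneg hN0.le _)
  have := hBs.sum_add_tsum_nat_add N
  linarith [Finset.sum_nonneg fun k (_ : k ∈ Finset.range N) => hB0 k]

/-- The Hermite coefficients are bounded by the spectral projections of the oscillator, because the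
Hermite functions are eigenvectors. -/
theorem norm_inner_hermiteUnit_le (k : ℕ) (f : L2) :
    ‖⟪hermiteUnit k, f⟫_ℂ‖ ≤ ‖eigenProj oscillator ((4 * k + 3 : ℝ) : ℂ) f‖ := by
  have h := inner_sub_eigenProj oscillator _ (hermiteUnit_mem_eigenspace k) f
  rw [inner_sub_right, sub_eq_zero] at h
  rw [h]
  refine (norm_inner_le_norm _ _).trans ?_
  rw [orthonormal_hermiteUnit.1 k, one_mul]

theorem summable_of_mem_powDomain {q : ℝ} {f : L2} (hf : f ∈ powDomain oscillator q) :
    Summable fun k : ℕ => (4 * k + 3 : ℝ) ^ (2 * q) * ‖⟪hermiteUnit k, f⟫_ℂ‖ ^ 2 := by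
  have hinj : Function.Injective fun k : ℕ => (4 * k + 3 : ℝ) := by
    intro j k h
    have h' : (4 * j + 3 : ℝ) = 4 * k + 3 := h
    have : (j : ℝ) = k := by linarith
    exact_mod_cast this
  have h : Summable fun μ : ℝ => μ ^ (2 * q) * ‖eigenProj oscillator μ f‖ ^ 2 := hf
  refine Summable.of_nonneg_of_le (fun k => by positivity) (fun k => ?_)
    (h.comp_injective hinj)
  have := norm_inner_hermiteUnit_le k f
  simp only [Function.comp]
  gcongr

/-- Partial sums of the Hermite expansion of `f ∈ Dom(Ã^q)` approximate `f` in the graph norm, in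
either component `J`. -/
theorem exists_hermite_approx {H : Spinor →ₗ.[ℂ] Spinor} (hcl : H.IsClosed) (J : L2 →L[ℂ] Spinor)
    (hJ : ∀ f, ‖J f‖ = ‖f‖) {D : ℝ} (hD : 0 ≤ D)
    (hJD : ∀ k : ℕ, ∃ h : J (hermiteUnit k) ∈ H.domain, ‖H ⟨_, h⟩‖ ≤ D * √(4 * k + 3))
    {q : ℝ} (hq : 1 < q) {f : L2} (hf : f ∈ powDomain oscillator q) :
    ∃ C, 0 ≤ C ∧ ∀ N : ℕ, 1 ≤ N →
      ∃ h : J (f - ∑ k ∈ Finset.range N, ⟪hermiteUnit k, f⟫_ℂ • hermiteUnit k) ∈ H.domain,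
        ‖J (f - ∑ k ∈ Finset.range N, ⟪hermiteUnit k, f⟫_ℂ • hermiteUnit k)‖ ≤
          C * (N : ℝ) ^ (-((q - 1) / 2)) ∧
        ‖H ⟨_, h⟩‖ ≤ C * (N : ℝ) ^ (-((q - 1) / 2)) := by
  set c : ℕ → ℂ := fun k => ⟪hermiteUnit k, f⟫_ℂ with hc
  obtain ⟨C, hC, hCN⟩ := exists_tail_le hq (a := fun k => ‖c k‖) (fun k => norm_nonneg _)
    (summable_of_mem_powDomain hf)
  choose hd hle using hJD
  refine ⟨(1 + D) * C, by positivity, fun N hN => ?_⟩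
  obtain ⟨hsum, htail⟩ := hCN N hN
  have hN0 : 0 ≤ (N : ℝ) ^ (-((q - 1) / 2)) := Real.rpow_nonneg N.cast_nonneg _
  have hs : HasSum (fun k => c (k + N) • hermiteUnit (k + N))
      (f - ∑ k ∈ Finset.range N, c k • hermiteUnit k) :=
    (hasSum_nat_add_iff' N).2 (hasSum_hermiteUnit f)
  let x : ℕ → H.domain := fun k => c (k + N) • ⟨J (hermiteUnit (k + N)), hd (k + N)⟩
  have hxs : HasSum (fun k => (x k : Spinor))
      (J (f - ∑ k ∈ Finset.range N, c k • hermiteUnit k)) := by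
    have := hs.mapL J
    simp only [map_smul] at this
    exact this
  have hHx : ∀ k, ‖H (x k)‖ ≤ D * (‖c (k + N)‖ * √(4 * (k + N : ℕ) + 3)) := by
    intro k
    simp only [x]
    rw [H.map_smul, norm_smul]
    calc _ ≤ ‖c (k + N)‖ * (D * √(4 * (k + N : ℕ) + 3)) := by gcongr; exact hle _
      _ = _ := by ring
  have hsumH : Summable fun k => ‖H (x k)‖ :=
    Summable.of_nonneg_of_le (fun _ => norm_nonneg _) hHx (hsum.mul_left D)
  obtain ⟨h, hb⟩ := norm_apply_le_tsum hcl hxs hsumH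
  refine ⟨h, ?_, ?_⟩
  · rw [hJ]
    have hcn : ∀ k, ‖c (k + N) • hermiteUnit (k + N)‖ ≤
        ‖c (k + N)‖ * √(4 * (k + N : ℕ) + 3) := by
      intro k
      rw [norm_smul, orthonormal_hermiteUnit.1]
      gcongr
      rw [Real.one_le_sqrt]
      linarith [((k + N).cast_nonneg : (0 : ℝ) ≤ (k + N : ℕ))]
    have hsn : Summable fun k => ‖c (k + N) • hermiteUnit (k + N)‖ :=
      Summable.of_nonneg_of_le (fun _ => norm_nonneg _) hcn hsum
    calc _ ≤ ∑' k, ‖c (k + N) • hermiteUnit (k + N)‖ := by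
          rw [← hs.tsum_eq]; exact norm_tsum_le_tsum_norm hsn
      _ ≤ ∑' k, ‖c (k + N)‖ * √(4 * (k + N : ℕ) + 3) := hsn.tsum_le_tsum hcn hsum
      _ ≤ C * (N : ℝ) ^ (-((q - 1) / 2)) := htail
      _ ≤ _ := by nlinarith [mul_nonneg (mul_nonneg hD hC) hN0]
  · calc _ ≤ ∑' k, ‖H (x k)‖ := hb
      _ ≤ ∑' k, D * (‖c (k + N)‖ * √(4 * (k + N : ℕ) + 3)) :=
        hsumH.tsum_le_tsum hHx (hsum.mul_left D)
      _ = D * ∑' k, ‖c (k + N)‖ * √(4 * (k + N : ℕ) + 3) := tsum_mul_left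
      _ ≤ D * (C * (N : ℝ) ^ (-((q - 1) / 2))) := by gcongr
      _ ≤ _ := by nlinarith [mul_nonneg hC hN0]

theorem finiteDimensional_testSpace (N M : ℕ) : FiniteDimensional ℂ (testSpace N M) := by
  refine FiniteDimensional.span_of_finite ℂ (Finite.union ?_ ?_)
  · refine ((finite_lt_nat N).image fun k => WithLp.toLp 2 (hermiteVec k, (0 : L2))).subset ?_
    rintro x ⟨k, hk, rfl⟩
    exact ⟨k, hk, rfl⟩
  · refine ((finite_lt_nat M).image fun k => WithLp.toLp 2 ((0 : L2), hermiteVec k)).subset ?_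
    rintro x ⟨k, hk, rfl⟩
    exact ⟨k, hk, rfl⟩

theorem upperIncl_mem_testSpace {N k : ℕ} (hk : k < N) (M : ℕ) :
    upperIncl (hermiteUnit k) ∈ testSpace N M := by
  obtain ⟨a, ha⟩ := hermiteUnit_eq_smul k
  rw [ha, map_smul]
  exact Submodule.smul_mem _ _ (Submodule.subset_span (Or.inl ⟨k, hk, rfl⟩))

theorem lowerIncl_mem_testSpace {M k : ℕ} (hk : k < M) (N : ℕ) :
    lowerIncl (hermiteUnit k) ∈ testSpace N M := by
  obtain ⟨a, ha⟩ := hermiteUnit_eq_smul k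
  rw [ha, map_smul]
  exact Submodule.smul_mem _ _ (Submodule.subset_span (Or.inr ⟨k, hk, rfl⟩))

theorem testSpace_ne_bot {N : ℕ} (hN : 1 ≤ N) (M : ℕ) : testSpace N M ≠ ⊥ := by
  intro h
  have h1 := upperIncl_mem_testSpace (k := 0) hN M
  rw [h, Submodule.mem_bot, ← norm_eq_zero, norm_upperIncl, orthonormal_hermiteUnit.1] at h1
  exact one_ne_zero h1

theorem hermiteVec_eq_smul (k : ℕ) : ∃ a : ℂ, hermiteVec k = a • hermiteUnit k := by
  obtain ⟨a, ha⟩ := hermiteUnit_eq_smul k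
  have ha0 : a ≠ 0 := by
    rintro rfl
    have := orthonormal_hermiteUnit.1 k
    rw [ha, zero_smul, norm_zero] at this
    exact zero_ne_one this
  exact ⟨a⁻¹, by rw [ha, smul_smul, inv_mul_cancel₀ ha0, one_smul]⟩

theorem testSpace_le_domain {H : Spinor →ₗ.[ℂ] Spinor}
    (hup : ∀ k, upperIncl (hermiteUnit k) ∈ H.domain)
    (hlow : ∀ k, lowerIncl (hermiteUnit k) ∈ H.domain) (N M : ℕ) :
    testSpace N M ≤ H.domain := by
  refine Submodule.span_le.2 ?_
  rintro x (⟨k, -, rfl⟩ | ⟨k, -, rfl⟩)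
  · obtain ⟨a, ha⟩ := hermiteVec_eq_smul k
    rw [ha, ← upperIncl_apply, map_smul]
    exact H.domain.smul_mem _ (hup k)
  · obtain ⟨a, ha⟩ := hermiteVec_eq_smul k
    rw [ha, ← lowerIncl_apply, map_smul]
    exact H.domain.smul_mem _ (hlow k)

/-- The rate `N^{-(q-1)/2} + M^{-(q-1)/2}`. -/
def rate (q : ℝ) (N M : ℕ) : ℝ := (N : ℝ) ^ (-((q - 1) / 2)) + (M : ℝ) ^ (-((q - 1) / 2))

theorem rate_nonneg (q : ℝ) (N M : ℕ) : 0 ≤ rate q N M := by unfold rate; positivity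

/-- One element of `Dom(A^q)` in the domain of `H` is approximated from the test spaces. -/
theorem exists_testSpace_approx {H : Spinor →ₗ.[ℂ] Spinor} (hcl : H.IsClosed) {D : ℝ} (hD : 0 ≤ D)
    (hHD : ∀ k : ℕ,
      (∃ h : upperIncl (hermiteUnit k) ∈ H.domain, ‖H ⟨_, h⟩‖ ≤ D * √(4 * k + 3)) ∧
      (∃ h : lowerIncl (hermiteUnit k) ∈ H.domain, ‖H ⟨_, h⟩‖ ≤ D * √(4 * k + 3)))
    {q : ℝ} (hq : 1 < q) (E : ℝ) {u : Spinor} (hu : u ∈ powDomainA q) (hud : u ∈ H.domain) :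
    ∃ C, 0 ≤ C ∧ ∀ N M : ℕ, 1 ≤ N → 1 ≤ M → ∃ v : H.domain, (v : Spinor) ∈ testSpace N M ∧
      ‖((⟨u, hud⟩ - v : H.domain) : Spinor)‖ ≤ C * rate q N M ∧
      ‖shift H E (⟨u, hud⟩ - v)‖ ≤ C * rate q N M := by
  obtain ⟨C₁, hC₁, h₁⟩ := exists_hermite_approx hcl upperIncl norm_upperIncl hD
    (fun k => (hHD k).1) hq hu.1
  obtain ⟨C₂, hC₂, h₂⟩ := exists_hermite_approx hcl lowerIncl norm_lowerIncl hD
    (fun k => (hHD k).2) hq hu.2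
  refine ⟨(1 + |E|) * (C₁ + C₂), by positivity, fun N M hN hM => ?_⟩
  obtain ⟨d₁, n₁, b₁⟩ := h₁ N hN
  obtain ⟨d₂, n₂, b₂⟩ := h₂ M hM
  set f₁ := ∑ k ∈ Finset.range N, ⟪hermiteUnit k, u.fst⟫_ℂ • hermiteUnit k with hf₁
  set f₂ := ∑ k ∈ Finset.range M, ⟪hermiteUnit k, u.snd⟫_ℂ • hermiteUnit k with hf₂
  have hv : upperIncl f₁ + lowerIncl f₂ ∈ testSpace N M := by
    refine Submodule.add_mem _ ?_ ?_
    · rw [hf₁, map_sum]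
      refine Submodule.sum_mem _ fun k hk => ?_
      rw [map_smul]
      exact Submodule.smul_mem _ _ (upperIncl_mem_testSpace (Finset.mem_range.1 hk) M)
    · rw [hf₂, map_sum]
      refine Submodule.sum_mem _ fun k hk => ?_
      rw [map_smul]
      exact Submodule.smul_mem _ _ (lowerIncl_mem_testSpace (Finset.mem_range.1 hk) N)
  have hvd := testSpace_le_domain (fun k => (hHD k).1.1) (fun k => (hHD k).2.1) N M hv
  have e : (⟨u, hud⟩ - ⟨_, hvd⟩ : H.domain) =
      ⟨upperIncl (u.fst - f₁), d₁⟩ + ⟨lowerIncl (u.snd - f₂), d₂⟩ := by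
    ext1
    simp only [Submodule.coe_sub, Submodule.coe_add, map_sub]
    nth_rw 1 [← upperIncl_add_lowerIncl u]
    abel
  have hr1 : C₁ * (N : ℝ) ^ (-((q - 1) / 2)) + C₂ * (M : ℝ) ^ (-((q - 1) / 2)) ≤
      (C₁ + C₂) * rate q N M := by
    have p1 : 0 ≤ (N : ℝ) ^ (-((q - 1) / 2)) := by positivity
    have p2 : 0 ≤ (M : ℝ) ^ (-((q - 1) / 2)) := by positivity
    unfold rate
    nlinarith [mul_nonneg hC₁ p2, mul_nonneg hC₂ p1]
  have hr2 : 0 ≤ (C₁ + C₂) * rate q N M := mul_nonneg (by positivity) (rate_nonneg q N M)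
  have bn : ‖((⟨upperIncl (u.fst - f₁), d₁⟩ + ⟨lowerIncl (u.snd - f₂), d₂⟩ : H.domain) : Spinor)‖ ≤
      (C₁ + C₂) * rate q N M :=
    (norm_add_le _ _).trans ((add_le_add n₁ n₂).trans hr1)
  refine ⟨⟨_, hvd⟩, hv, ?_, ?_⟩
  · rw [e]
    refine bn.trans ?_
    nlinarith [abs_nonneg E]
  · rw [e, shift_apply, H.map_add]
    have bH := (norm_add_le (H ⟨upperIncl (u.fst - f₁), d₁⟩) (H ⟨lowerIncl (u.snd - f₂), d₂⟩)).trans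
      ((add_le_add b₁ b₂).trans hr1)
    refine (norm_sub_le _ _).trans ?_
    rw [norm_smul, Complex.norm_real, Real.norm_eq_abs, add_mul, add_mul, one_mul]
    rw [mul_assoc]
    gcongr

/-- A finite-dimensional space is approximated uniformly as soon as each element is. -/
theorem exists_uniform_approx {X ι : Type*} [NormedAddCommGroup X] [InnerProductSpace ℂ X]
    {T : X →ₗ.[ℂ] X} {V : Submodule ℂ X} [FiniteDimensional ℂ V] (hV : V ≤ T.domain) (z : ℂ)
    {P : ι → Prop} {ℒ : ι → Submodule ℂ X} {ρ : ι → ℝ} (hρ : ∀ i, 0 ≤ ρ i)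
    (h : ∀ (u : X) (hu : u ∈ V), ∃ C, 0 ≤ C ∧ ∀ i, P i → ∃ v : T.domain, (v : X) ∈ ℒ i ∧
      ‖((⟨u, hV hu⟩ - v : T.domain) : X)‖ ≤ C * ρ i ∧ ‖shift T z (⟨u, hV hu⟩ - v)‖ ≤ C * ρ i) :
    ∃ C, 0 ≤ C ∧ ∀ i, P i → ∀ u : T.domain, (u : X) ∈ V → ∃ v : T.domain, (v : X) ∈ ℒ i ∧
      ‖((u - v : T.domain) : X)‖ ≤ C * ρ i * ‖(u : X)‖ ∧
      ‖shift T z (u - v)‖ ≤ C * ρ i * ‖(u : X)‖ := by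
  let b := stdOrthonormalBasis ℂ V
  choose C hC hCi using fun j => h (b j) (b j).2
  refine ⟨∑ j, C j, Finset.sum_nonneg fun j _ => hC j, fun i hi u hu => ?_⟩
  choose v hvL hv1 hv2 using fun j => hCi j i hi
  set c : Fin (Module.finrank ℂ V) → ℂ := fun j => b.repr ⟨u, hu⟩ j with hc
  have hcn : ∀ j, ‖c j‖ ≤ ‖(u : X)‖ := fun j => by
    have h1 : c j = ⟪b j, (⟨u, hu⟩ : V)⟫_ℂ := b.repr_apply_apply _ _
    rw [h1]
    refine (norm_inner_le_norm _ _).trans ?_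
    rw [b.orthonormal.1, one_mul]
    rfl
  have hsum : u = ∑ j, c j • (⟨b j, hV (b j).2⟩ : T.domain) := by
    ext1
    have h1 := congrArg V.subtype (b.sum_repr ⟨u, hu⟩)
    rw [map_sum] at h1
    simp only [map_smul, Submodule.subtype_apply] at h1
    rw [← h1]
    simp [hc]
  have e : u - ∑ j, c j • v j = ∑ j, c j • (⟨b j, hV (b j).2⟩ - v j) := by
    nth_rw 1 [hsum]
    simp only [smul_sub, Finset.sum_sub_distrib]
  refine ⟨∑ j, c j • v j, ?_, ?_, ?_⟩
  · simp only [Submodule.coe_sum, Submodule.coe_smul]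
    exact Submodule.sum_mem _ fun j _ => Submodule.smul_mem _ _ (hvL j)
  · rw [e, Submodule.coe_sum, Finset.sum_mul, Finset.sum_mul]
    refine (norm_sum_le _ _).trans (Finset.sum_le_sum fun j _ => ?_)
    rw [Submodule.coe_smul, norm_smul, mul_comm]
    exact mul_le_mul (hv1 j) (hcn j) (norm_nonneg _) (mul_nonneg (hC j) (hρ i))
  · rw [e, map_sum, Finset.sum_mul, Finset.sum_mul]
    refine (norm_sum_le _ _).trans (Finset.sum_le_sum fun j _ => ?_)
    rw [map_smul, norm_smul, mul_comm]
    exact mul_le_mul (hv2 j) (hcn j) (norm_nonneg _) (mul_nonneg (hC j) (hρ i))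

theorem isSymm_of_isSelfAdjoint {X : Type*} [NormedAddCommGroup X] [InnerProductSpace ℂ X]
    [CompleteSpace X] {T : X →ₗ.[ℂ] X} (hT : IsSelfAdjoint T) : IsSymm T := by
  intro x y
  have h := LinearPMap.adjoint_isFormalAdjoint (T := T) hT.dense_domain
  rw [LinearPMap.isSelfAdjoint_def.1 hT] at h
  exact h x y

theorem eventually_rate_le {q : ℝ} (hq : 1 < q) {η : ℝ} (hη : 0 < η) :
    ∃ n₀ : ℕ, ∀ N M : ℕ, n₀ ≤ N → n₀ ≤ M → rate q N M ≤ η := by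
  have h : Tendsto (fun n : ℕ => (n : ℝ) ^ (-((q - 1) / 2))) atTop (𝓝 0) :=
    (tendsto_rpow_neg_atTop (by linarith : 0 < (q - 1) / 2)).comp tendsto_natCast_atTop_atTop
  obtain ⟨n₀, hn₀⟩ := eventually_atTop.1 (h.eventually (gt_mem_nhds (half_pos hη)))
  refine ⟨n₀, fun N M hN hM => ?_⟩
  have h1 := hn₀ N hN
  have h2 := hn₀ M hM
  unfold rate
  linarith

end Approximation

end RadialDirac

end


open RadialDirac in
theorem corollary3p4 (κ : ℤ) (hκ : κ ≠ 0) (φsc φel φam : ℝ → ℝ)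
    (hsc : IsAdmissible φsc) (hel : IsAdmissible φel) (ham : IsAdmissible φam)
    (H : Spinor →ₗ.[ℂ] Spinor) (hH : IsRadialDirac κ φsc φel φam H)
    (E : ℝ) (hE : IsIsolatedEigenvalue H E)
    (q : ℝ) (hq : 1 < q) (hreg : (eigenspace H E : Set Spinor) ⊆ powDomainA q) :
    ∃ b > (0 : ℝ), ∃ n₀ : ℕ, ∃ lam : ℕ → ℕ → ℂ, ∀ N M : ℕ, 1 ≤ N → 1 ≤ M →
      lam N M ∈ spec₂ H (testSpace N M) ∧
      (n₀ ≤ N → n₀ ≤ M →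
        ‖lam N M - E‖ < b * ((N : ℝ) ^ (-((q - 1) / 2)) + (M : ℝ) ^ (-((q - 1) / 2))) ∧
        ∀ v : Spinor, SolvesQ H (testSpace N M) (lam N M) v → ‖v‖ = 1 →
          ‖v - eigenProj H E v‖ <
            b * ((N : ℝ) ^ (-((q - 1) / 2)) + (M : ℝ) ^ (-((q - 1) / 2)))) := by
  have hsymm : IsSymm H := isSymm_of_isSelfAdjoint hH.isSelfAdjoint
  have hcl := hH.isSelfAdjoint.isClosed
  obtain ⟨d, hd, hgap⟩ := hsymm.exists_hasGap hE.isolated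
  have : FiniteDimensional ℂ (eigenspace H E) := hE.finite_multiplicity
  obtain ⟨D, hD, hHD⟩ := hH.exists_norm_hermiteUnit_le hsc hel ham
  have hdom : ∀ N M, testSpace N M ≤ H.domain :=
    testSpace_le_domain (fun k => (hHD k).1.1) (fun k => (hHD k).2.1)
  obtain ⟨C, hC, happ⟩ := exists_uniform_approx (ι := ℕ × ℕ) (eigenspace_le_domain H E) E
    (P := fun i => 1 ≤ i.1 ∧ 1 ≤ i.2) (ℒ := fun i => testSpace i.1 i.2)
    (ρ := fun i => rate q i.1 i.2) (fun i => rate_nonneg q i.1 i.2) fun u hu => by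
      obtain ⟨C, hC, h⟩ := exists_testSpace_approx hcl hD hHD hq E (hreg hu)
        (eigenspace_le_domain H E hu)
      exact ⟨C, hC, fun i hi => h i.1 i.2 hi.1 hi.2⟩
  -- for rates below `η`, the accuracy `δ = (C + 1) rate` satisfies `16 δ ≤ min 1 (d / 8)`
  set η : ℝ := min 1 (d / 8) / (16 * (C + 1)) with hη
  have hη0 : 0 < η := by positivity
  obtain ⟨n₀, hn₀⟩ := eventually_rate_le hq hη0
  -- the summand `1` makes the inequalities strict
  set b : ℝ := 16 * (C + 1) * (1 + 2 / d) + 1 with hb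
  have hpoint : ∀ N M : ℕ, 1 ≤ N → 1 ≤ M → ∃ z ∈ spec₂ H (testSpace N M),
      n₀ ≤ N → n₀ ≤ M → ‖z - E‖ ≤ 16 * ((C + 1) * rate q N M) := by
    intro N M hN hM
    have := finiteDimensional_testSpace N M
    by_cases hNM : n₀ ≤ N ∧ n₀ ≤ M
    · have hr0 : 0 < rate q N M := by
        have hN' : (0 : ℝ) < N := by exact_mod_cast hN
        have hM' : (0 : ℝ) < M := by exact_mod_cast hM
        unfold rate
        positivity
      have hr := hn₀ N M hNM.1 hNM.2
      rw [hη, le_div_iff₀ (by positivity)] at hr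
      obtain ⟨z, hz, hzE⟩ := hsymm.exists_mem_spec₂ hgap hE.eigenspace_ne_bot (hdom N M)
        -- `C + 1` rather than `C`, since the accuracy has to be positive
        (δ := (C + 1) * rate q N M) (by positivity)
        (by linarith [min_le_left 1 (d / 8)]) (by linarith [min_le_right 1 (d / 8)])
        (fun u hu => by
          obtain ⟨v, hv, h1, h2⟩ := happ (N, M) ⟨hN, hM⟩ u hu
          refine ⟨v, hv, h1.trans ?_, h2.trans ?_⟩ <;> dsimp only <;> gcongr <;> linarith)
      exact ⟨z, hz, fun _ _ => hzE⟩
    · obtain ⟨z, hz⟩ := hsymm.spec₂_nonempty (hdom N M) (testSpace_ne_bot hN M)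
      exact ⟨z, hz, fun h1 h2 => absurd ⟨h1, h2⟩ hNM⟩
  choose! lam hlam hlamE using hpoint
  refine ⟨b, by positivity, n₀, lam, fun N M hN hM => ⟨hlam N M hN hM, fun h1 h2 => ?_⟩⟩
  have := finiteDimensional_testSpace N M
  have hz := hlamE N M hN hM h1 h2
  change _ < b * rate q N M ∧ _
  have hr0 : 0 < rate q N M := by
    have hN' : (0 : ℝ) < N := by exact_mod_cast hN
    have hM' : (0 : ℝ) < M := by exact_mod_cast hM
    unfold rate
    positivity
  have hr := hn₀ N M h1 h2
  rw [hη, le_div_iff₀ (by positivity)] at hr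
  have hpos : 0 ≤ 16 * (C + 1) * (2 / d) * rate q N M := by positivity
  have hpos' : 0 ≤ 16 * (C + 1) * rate q N M := by positivity
  constructor
  · rw [hb]; linarith
  · intro v hv hv1
    have hle := hsymm.norm_sub_eigenProj_le hd hgap (hdom N M) (z := lam N M)
      (by linarith [min_le_right 1 (d / 8)]) hv hv1
    have h3 : 2 / d * ‖lam N M - E‖ ≤ 2 / d * (16 * ((C + 1) * rate q N M)) := by gcongr
    change _ < b * rate q N M
    rw [hb]
    linarith
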